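/- Let $M$ be a closed connected oriented smooth $3$-manifold, let $X$ be a nowhere vanishing $C^1$ vector field on $M$, and let $\phi^t$ be its flow. The flow is called *Anosov* if there are a continuous $\phi^t_*$-invariant splitting $TM=E^{ss}\oplus E^{uu}\oplus\langle X\rangle$ into line bundles, a constant $C>0$ and a continuous norm on $TM$ with $\|\phi^t_*u\|\le e^{-Ct}\|u\|$ and $\|\phi^t_*v\|\ge e^{Ct}\|v\|$ for all $u\in E^{ss}$, $v\in E^{uu}$, $t\ge 0$. It is called *projectively Anosov* if there are a continuous splitting $TM/\langle X\rangle=E^s\oplus E^u$ into line bundles, invariant under the linear flow $\tilde\phi^t_*$ induced by $\phi^t_*$ on $TM/\langle X\rangle$, a constant $C>0$ and a continuous norm on $TM/\langle X\rangle$ with $$\frac{\|\tilde\phi^t_*v\|}{\|\tilde\phi^t_*u\|}\ \ge\ e^{Ct}\,\frac{\|v\|}{\|u\|}\qquad\text{for all } 0\ne u\in E^s_p,\ 0\ne v\in E^u_p,\ p\in M,\ t\ge 0 .$$ The preimages of $E^s,E^u$ in $TM$ are plane fields containing $X$, denoted by the same letters. A *positive* (*negative*) *contact form* is a $C^1$ $1$-form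 $\alpha$ with $\alpha\wedge d\alpha>0$ ($<0$), and its kernel is a positive (negative) contact structure. A *supporting bi-contact structure* for $X$ is a pair $(\xi_-,\xi_+)$ of a negative and a positive contact structure that are everywhere transverse and both contain $X$. Suppose that the flow of $X$ is projectively Anosov with orientable $E^s$ and $E^u$, and that $\alpha_+$ (or $\alpha_-$) is a positive (negative) contact form whose kernel is part of a supporting bi-contact structure. Write uniquely $\alpha_+=\alpha_u-\alpha_s$ (respectively $\alpha_-=\alpha_u+\alpha_s$) with continuous $1$-forms $\alpha_u,\alpha_s$ such that $\ker\alpha_u=E^s$ and $\ker\alpha_s=E^u$, and let $\Omega^{\alpha_\pm}:=\alpha_s\wedge\alpha_u\wedge\alpha_X$, where $\alpha_X$ is any $1$-form with $\alpha_X(X)=1$; this is a positive volume form independent of $\alpha_X$, and differentiable along the flow. Its divergence is the function $\mathrm{div}_X\Omega$ with $\frac{d}{dt}\big|_{t=0}(\phi^t)^*\Omega=(\mathrm{div}_X\Omega)\,\Omega$. Inequalities between $3$-forms are taken pointwise with respect to the orientation of $M$. **Theorem.** Let $X$ be as above, with projectively Anosov flow and orientable $E^s,E^u$, and supported by a bi-contact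 structure $(\xi_-,\xi_+)$. The following are equivalent: 1. The flow of $X$ is Anosov. 2. There is a positive contact form $\alpha_+$ such that, for some $\xi_-$, the pair $(\xi_-,\ker\alpha_+)$ is a supporting bi-contact structure for $X$, and $$-\alpha_+\wedge d\alpha_+<(\mathrm{div}_X\Omega^{\alpha_+})\,\Omega^{\alpha_+}<\alpha_+\wedge d\alpha_+ .$$ 3. There is a negative contact form $\alpha_-$ such that, for some $\xi_+$, the pair $(\ker\alpha_-,\xi_+)$ is a supporting bi-contact structure for $X$, and $$\alpha_-\wedge d\alpha_-<(\mathrm{div}_X\Omega^{\alpha_-})\,\Omega^{\alpha_-}<-\alpha_-\wedge d\alpha_- .$$ -/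

import Mathlib

open Bundle Filter Topology
open scoped Manifold ContDiff

noncomputable section

namespace BiContact

/-- The model space of three-dimensional manifolds. -/
abbrev E3 : Type := EuclideanSpace ℝ (Fin 3)

section Basics

variable {M : Type*} [TopologicalSpace M] [ChartedSpace E3 M]

/-- A (not necessarily continuous) vector field on `M`. -/
abbrev VField (M : Type*) [TopologicalSpace M] [ChartedSpace E3 M] : Type _ :=
  (p : M) → TangentSpace (𝓡 3) p

/-- A (not necessarily continuous) 1-form on `M`. -/
abbrev OneForm (M : Type*) [TopologicalSpace M] [ChartedSpace E3 M] : Type _ :=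
  (p : M) → TangentSpace (𝓡 3) p →L[ℝ] ℝ

/-- A 3-form on `M`, given by its values on triples of tangent vectors. All 3-forms below are
wedge products, hence alternating and multilinear. -/
abbrev ThreeForm (M : Type*) [TopologicalSpace M] [ChartedSpace E3 M] : Type _ :=
  (p : M) → (Fin 3 → TangentSpace (𝓡 3) p) → ℝ

/-- A field of linear subspaces of the tangent spaces of `M`. -/
abbrev Distribution (M : Type*) [TopologicalSpace M] [ChartedSpace E3 M] : Type _ :=
  (p : M) → Submodule ℝ (TangentSpace (𝓡 3) p)

/-- The line field `⟨X⟩` spanned by a vector field. -/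
def lineField (X : VField M) : Distribution M := fun p => Submodule.span ℝ {X p}

/-- The kernel of a 1-form, as a field of subspaces. -/
def kerField (α : OneForm M) : Distribution M := fun p => LinearMap.ker (α p).toLinearMap

/-- The differential `φᵗ_* : T_p M → T_{φᵗ(p)} M` of the time-`t` map of a flow. -/
def push (φ : Flow ℝ M) (t : ℝ) (p : M) :
    TangentSpace (𝓡 3) p →L[ℝ] TangentSpace (𝓡 3) (φ t p) :=
  mfderiv (𝓡 3) (𝓡 3) (φ t) p

/-- `φ` is the flow generated by `X`: every orbit is an integral curve of `X`. -/
def IsFlowOf (X : VField M) (φ : Flow ℝ M) : Prop :=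
  ∀ p : M, IsMIntegralCurve (I := 𝓡 3) (fun t : ℝ => φ t p) X

/-- A field of subspaces is invariant under the flow: `φᵗ_*` maps the subspace at `p` onto the
subspace at `φᵗ(p)`. -/
def IsInvariantField (φ : Flow ℝ M) (D : Distribution M) : Prop :=
  ∀ (t : ℝ) (p : M), (D p).map (push φ t p).toLinearMap = D (φ t p)

end Basics

section Bundles

variable {M : Type*} [TopologicalSpace M] [ChartedSpace E3 M] [IsManifold (𝓡 3) ∞ M]

/-- A vector field is `Cⁿ` (as a section of the tangent bundle). -/
def IsCnVField (n : ℕ) (X : VField M) : Prop :=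
  ContMDiff (𝓡 3) (𝓡 3).tangent n (fun p : M => (⟨p, X p⟩ : TangentBundle (𝓡 3) M))

/-- A vector field is continuous on a set. -/
def ContinuousVFieldOn (Y : VField M) (U : Set M) : Prop :=
  ContinuousOn (fun p : M => (⟨p, Y p⟩ : TangentBundle (𝓡 3) M)) U

/-- A 1-form is `Cⁿ` (as a section of the cotangent bundle). -/
def IsCnForm (n : ℕ) (α : OneForm M) : Prop :=
  ContMDiff (𝓡 3) ((𝓡 3).prod 𝓘(ℝ, E3 →L[ℝ] ℝ)) n
    (fun p : M => TotalSpace.mk' (E3 →L[ℝ] ℝ)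
      (E := fun p : M => TangentSpace (𝓡 3) p →L[ℝ] Bundle.Trivial M ℝ p) p (α p))

/-- A continuous subbundle of rank `k` of `TM`: near every point, the subspaces have a basis that
consists of continuous vector fields. -/
def IsContinuousSubbundle (k : ℕ) (D : Distribution M) : Prop :=
  ∀ p : M, ∃ U ∈ 𝓝 p, ∃ e : Fin k → VField M,
    (∀ i, ContinuousVFieldOn (e i) U) ∧
    ∀ q ∈ U, LinearIndependent ℝ (fun i => e i q) ∧
      Submodule.span ℝ (Set.range fun i => e i q) = D q

/-- An orientation of `M`: an orientation of every tangent space, such that every point has a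
neighbourhood with a continuous oriented frame. -/
structure ManifoldOrientation (M : Type*) [TopologicalSpace M] [ChartedSpace E3 M]
    [IsManifold (𝓡 3) ∞ M] where
  /-- The orientation of the tangent space at a point. -/
  at_point : (p : M) → Orientation ℝ (TangentSpace (𝓡 3) p) (Fin 3)
  continuous_frame : ∀ p : M, ∃ U ∈ 𝓝 p, ∃ e : Fin 3 → VField M,
    (∀ i, ContinuousVFieldOn (e i) U) ∧
    ∀ q ∈ U, ∃ b : Module.Basis (Fin 3) ℝ (TangentSpace (𝓡 3) q),
      (⇑b = fun i => e i q) ∧ b.orientation = at_point q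

/-- `ω₁ < ω₂` for 3-forms on the oriented manifold `M`: the inequality holds at every point, on
every positively oriented basis. -/
def ThreeFormLT (o : ManifoldOrientation M) (ω₁ ω₂ : ThreeForm M) : Prop :=
  ∀ (p : M) (b : Module.Basis (Fin 3) ℝ (TangentSpace (𝓡 3) p)),
    b.orientation = o.at_point p → ω₁ p b < ω₂ p b

/-- A continuous norm on the bundle `TM`. -/
def IsTangentNorm (N : (p : M) → Seminorm ℝ (TangentSpace (𝓡 3) p)) : Prop :=
  Continuous (fun v : TangentBundle (𝓡 3) M => N v.proj v.snd) ∧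
  ∀ (p : M) (v : TangentSpace (𝓡 3) p), N p v = 0 ↔ v = 0

/-- A continuous norm on the normal bundle `TM/⟨X⟩`, given by the induced function on `TM`: a norm
on the quotient space `T_p M/⟨X(p)⟩` is the same thing as a seminorm on `T_p M` that vanishes
exactly on `⟨X(p)⟩`. -/
def IsNormalNorm (X : VField M) (N : (p : M) → Seminorm ℝ (TangentSpace (𝓡 3) p)) : Prop :=
  Continuous (fun v : TangentBundle (𝓡 3) M => N v.proj v.snd) ∧
  ∀ (p : M) (v : TangentSpace (𝓡 3) p), N p v = 0 ↔ v ∈ lineField X p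

/-- The flow `φ` generated by `X` is Anosov: there is a continuous invariant splitting
`TM = Ess ⊕ Euu ⊕ ⟨X⟩` into line bundles, with exponential contraction of `Ess` and expansion
of `Euu`. Here `X` has no zeros, so that the three lines span the three-dimensional tangent space
if and only if their sum is direct. -/
def IsAnosov (X : VField M) (φ : Flow ℝ M) : Prop :=
  ∃ Ess Euu : Distribution M,
    IsContinuousSubbundle 1 Ess ∧ IsContinuousSubbundle 1 Euu ∧
    IsInvariantField φ Ess ∧ IsInvariantField φ Euu ∧
    (∀ p, Ess p ⊔ Euu p ⊔ lineField X p = ⊤) ∧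
    ∃ (C : ℝ) (N : (p : M) → Seminorm ℝ (TangentSpace (𝓡 3) p)),
      0 < C ∧ IsTangentNorm N ∧
      ∀ (t : ℝ), 0 ≤ t → ∀ p : M,
        (∀ u ∈ Ess p, N (φ t p) (push φ t p u) ≤ Real.exp (-C * t) * N p u) ∧
        (∀ v ∈ Euu p, Real.exp (C * t) * N p v ≤ N (φ t p) (push φ t p v))

/-- `Es` and `Eu` are the stable and unstable plane fields of a projectively Anosov flow `φ`
generated by `X`: they are the preimages in `TM` of the line bundles of a continuous splitting
`TM/⟨X⟩ = Es/⟨X⟩ ⊕ Eu/⟨X⟩` that is invariant and dominated under the linear flow that `φ` induces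
on `TM/⟨X⟩`, that is
`‖φᵗ_* v‖ / ‖φᵗ_* u‖ ≥ exp (C t) ‖v‖ / ‖u‖` for `0 ≠ u ∈ Es/⟨X⟩`, `0 ≠ v ∈ Eu/⟨X⟩`, `t ≥ 0`
(written without denominators). -/
def IsDominatedSplitting (X : VField M) (φ : Flow ℝ M) (Es Eu : Distribution M) : Prop :=
  IsContinuousSubbundle 2 Es ∧ IsContinuousSubbundle 2 Eu ∧
  (∀ p, Es p ⊓ Eu p = lineField X p) ∧ (∀ p, Es p ⊔ Eu p = ⊤) ∧
  IsInvariantField φ Es ∧ IsInvariantField φ Eu ∧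
  ∃ (C : ℝ) (N : (p : M) → Seminorm ℝ (TangentSpace (𝓡 3) p)),
    0 < C ∧ IsNormalNorm X N ∧
    ∀ (t : ℝ), 0 ≤ t → ∀ p : M, ∀ u ∈ Es p, ∀ v ∈ Eu p,
      Real.exp (C * t) * N p v * N (φ t p) (push φ t p u) ≤
        N (φ t p) (push φ t p v) * N p u

/-- The line subbundle `D/⟨X⟩` of `TM/⟨X⟩` is orientable: it has a continuous section without
zeros, written as a continuous section of `D` that is nowhere tangent to `X`. -/
def IsOrientableModX (X : VField M) (D : Distribution M) : Prop :=
  ∃ e : VField M, ContinuousVFieldOn e Set.univ ∧ ∀ p, e p ∈ D p ∧ e p ∉ lineField X p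

/-- The coordinate expression of the 1-form `α` in the preferred chart at `p`: the pullback of `α`
by the inverse of the chart. -/
def coordForm (α : OneForm M) (p : M) (y : E3) : E3 →L[ℝ] ℝ :=
  (α ((extChartAt (𝓡 3) p).symm y)).comp
    (mfderiv 𝓘(ℝ, E3) (𝓡 3) (extChartAt (𝓡 3) p).symm y :
      E3 →L[ℝ] TangentSpace (𝓡 3) ((extChartAt (𝓡 3) p).symm y))

/-- The exterior derivative `dα` of a 1-form on `M`: the value at `p` is computed in the preferred
chart at `p`. -/
def dForm (α : OneForm M) (p : M) (v w : TangentSpace (𝓡 3) p) : ℝ :=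
  extDeriv (fun y : E3 => ContinuousAlternatingMap.ofSubsingleton ℝ E3 ℝ (0 : Fin 1)
      (coordForm α p y)) (extChartAt (𝓡 3) p p)
    ![(mfderiv (𝓡 3) 𝓘(ℝ, E3) (extChartAt (𝓡 3) p) p v : E3),
      (mfderiv (𝓡 3) 𝓘(ℝ, E3) (extChartAt (𝓡 3) p) p w : E3)]

/-- The 3-form `α ∧ dα`. -/
def contactVolume (α : OneForm M) : ThreeForm M := fun p v =>
  α p (v 0) * dForm α p (v 1) (v 2) - α p (v 1) * dForm α p (v 0) (v 2) +
    α p (v 2) * dForm α p (v 0) (v 1)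

/-- The 3-form `α ∧ β ∧ γ`, for 1-forms `α`, `β`, `γ`. -/
def wedge3 (α β γ : OneForm M) : ThreeForm M := fun p v =>
  Matrix.det !![α p (v 0), α p (v 1), α p (v 2);
                β p (v 0), β p (v 1), β p (v 2);
                γ p (v 0), γ p (v 1), γ p (v 2)]

/-- A positive contact form: a `C¹` 1-form with `α ∧ dα > 0`. -/
def IsPositiveContactForm (o : ManifoldOrientation M) (α : OneForm M) : Prop :=
  IsCnForm 1 α ∧ ThreeFormLT o 0 (contactVolume α)

/-- A negative contact form: a `C¹` 1-form with `α ∧ dα < 0`. -/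
def IsNegativeContactForm (o : ManifoldOrientation M) (α : OneForm M) : Prop :=
  IsCnForm 1 α ∧ ThreeFormLT o (contactVolume α) 0

/-- A positive contact structure: the kernel of a positive contact form. -/
def IsPositiveContactStructure (o : ManifoldOrientation M) (ξ : Distribution M) : Prop :=
  ∃ α : OneForm M, IsPositiveContactForm o α ∧ ξ = kerField α

/-- A negative contact structure: the kernel of a negative contact form. -/
def IsNegativeContactStructure (o : ManifoldOrientation M) (ξ : Distribution M) : Prop :=
  ∃ α : OneForm M, IsNegativeContactForm o α ∧ ξ = kerField α

/-- `(ξm, ξp)` is a bi-contact structure that supports `X`: a negative and a positive contact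
structure which are transverse everywhere, and both contain `X`. -/
def IsSupportingBiContact (o : ManifoldOrientation M) (X : VField M)
    (ξm ξp : Distribution M) : Prop :=
  IsNegativeContactStructure o ξm ∧ IsPositiveContactStructure o ξp ∧
  ∀ p, ξm p ⊔ ξp p = ⊤ ∧ X p ∈ ξm p ⊓ ξp p

/-- `Ω` is the positive volume form `αs ∧ αu ∧ αX`, where `αs`, `αu` are continuous 1-forms with
`ker αs = Eu` and `ker αu = Es`, and `αX` is any 1-form with `αX(X) = 1` (`Ω` does not depend on
this choice, since `αs` and `αu` vanish on `X`). Positivity of `Ω` is the sign condition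
`αs(es) > 0`, `αu(eu) > 0`, for orientations of the two line bundles such that `(es, eu, X)` is an
oriented basis. -/
def IsVolumeOfPair (o : ManifoldOrientation M) (X : VField M) (Es Eu : Distribution M)
    (αs αu : OneForm M) (Ω : ThreeForm M) : Prop :=
  IsCnForm 0 αs ∧ IsCnForm 0 αu ∧ kerField αs = Eu ∧ kerField αu = Es ∧
  (∃ αX : OneForm M, (∀ p, αX p (X p) = 1) ∧ Ω = wedge3 αs αu αX) ∧
  ThreeFormLT o 0 Ω

/-- `Ω` is the volume form `Ω^α = αs ∧ αu ∧ αX` induced by a positive contact form `α`, through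
the unique decomposition `α = αu - αs`. -/
def IsInducedVolumePos (o : ManifoldOrientation M) (X : VField M) (Es Eu : Distribution M)
    (α : OneForm M) (Ω : ThreeForm M) : Prop :=
  ∃ αs αu : OneForm M, IsVolumeOfPair o X Es Eu αs αu Ω ∧ α = αu - αs

/-- `Ω` is the volume form `Ω^α = αs ∧ αu ∧ αX` induced by a negative contact form `α`, through
the unique decomposition `α = αu + αs`. -/
def IsInducedVolumeNeg (o : ManifoldOrientation M) (X : VField M) (Es Eu : Distribution M)
    (α : OneForm M) (Ω : ThreeForm M) : Prop :=
  ∃ αs αu : OneForm M, IsVolumeOfPair o X Es Eu αs αu Ω ∧ α = αu + αs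

/-- `Ω` is differentiable along the flow `φ` of `X`, and its divergence is the function `δ`:
`L_X Ω = d/dt (φᵗ)^* Ω |_{t = 0}` exists and equals `δ Ω`. -/
def IsDivergence (φ : Flow ℝ M) (Ω : ThreeForm M) (δ : M → ℝ) : Prop :=
  ∀ (p : M) (v : Fin 3 → TangentSpace (𝓡 3) p),
    HasDerivAt (fun t : ℝ => Ω (φ t p) (fun i => push φ t p (v i))) (δ p * Ω p v) 0

/-- The 3-form `δ Ω`, for a function `δ`. -/
def scale (δ : M → ℝ) (Ω : ThreeForm M) : ThreeForm M := fun p v => δ p * Ω p v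

end Bundles

end BiContact

end

noncomputable section

namespace BiContact

section LocalFlow

variable {E : Type*} [NormedAddCommGroup E] [NormedSpace ℝ E]

/-- Two-sided Grönwall inequality around `0`. -/
theorem norm_le_gronwallBound_abs {w w' : ℝ → E} {K ε τ : ℝ}
    (hw : ∀ t, |t| < τ → HasDerivAt w (w' t) t)
    (hK : ∀ t, |t| < τ → ‖w' t‖ ≤ K * ‖w t‖ + ε) {t : ℝ} (ht : |t| < τ) :
    ‖w t‖ ≤ gronwallBound ‖w 0‖ K ε |t| := by
  rcases le_total 0 t with h0 | h0
  · rw [abs_of_nonneg h0] at ht ⊢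
    have hlt : ∀ r ∈ Set.Icc 0 t, |r| < τ := fun r hr => by
      rw [abs_of_nonneg hr.1]; exact hr.2.trans_lt ht
    have := norm_le_gronwallBound_of_norm_deriv_right_le (f := w) (f' := w') (δ := ‖w 0‖) (K := K)
      (ε := ε) (a := 0) (b := t)
      (fun r hr => (hw r (hlt r hr)).continuousAt.continuousWithinAt)
      (fun r hr => (hw r (hlt r ⟨hr.1, hr.2.le⟩)).hasDerivWithinAt) le_rfl
      (fun r hr => hK r (hlt r ⟨hr.1, hr.2.le⟩)) t ⟨h0, le_rfl⟩
    simpa using this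
  · rw [abs_of_nonpos h0] at ht ⊢
    have hlt : ∀ r ∈ Set.Icc 0 (-t), |-r| < τ := fun r hr => by
      rw [abs_neg, abs_of_nonneg hr.1]; exact hr.2.trans_lt ht
    have hd : ∀ r ∈ Set.Icc 0 (-t), HasDerivAt (fun r => w (-r)) (-w' (-r)) r := fun r hr => by
      simpa [Function.comp_def] using (hw (-r) (hlt r hr)).scomp r (hasDerivAt_neg r)
    have := norm_le_gronwallBound_of_norm_deriv_right_le (f := fun r => w (-r))
      (f' := fun r => -w' (-r)) (δ := ‖w 0‖) (K := K)
      (ε := ε) (a := 0) (b := -t)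
      (fun r hr => (hd r hr).continuousAt.continuousWithinAt)
      (fun r hr => (hd r ⟨hr.1, hr.2.le⟩).hasDerivWithinAt) (by simp)
      (fun r hr => by simpa using hK (-r) (hlt r ⟨hr.1, hr.2.le⟩)) (-t) ⟨by linarith, le_rfl⟩
    simpa using this

/-- `x` is a local flow on `U`, for times in `(-τ, τ)`, of a `C¹` vector field `Y` with derivative
bounded by `L` on a convex open set `s`; the time-`t` maps are assumed differentiable. -/
structure IsLocalFlow (Y : E → E) (s U : Set E) (x : ℝ → E → E) (τ L : ℝ) : Prop where
  convex : Convex ℝ s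
  isOpen_range : IsOpen s
  contDiffOn : ContDiffOn ℝ 1 Y s
  L_pos : 0 < L
  bound : ∀ z ∈ s, ‖fderiv ℝ Y z‖ ≤ L
  isOpen : IsOpen U
  zero : ∀ y ∈ U, x 0 y = y
  mem : ∀ t, |t| < τ → ∀ y ∈ U, x t y ∈ s
  continuousOn : ContinuousOn (fun z : ℝ × E => x z.1 z.2) (Set.Ioo (-τ) τ ×ˢ U)
  hasDerivAt : ∀ t, |t| < τ → ∀ y ∈ U, HasDerivAt (fun r => x r y) (Y (x t y)) t
  differentiableAt : ∀ t, |t| < τ → ∀ y ∈ U, DifferentiableAt ℝ (x t) y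

namespace IsLocalFlow

variable {Y : E → E} {s U : Set E} {x : ℝ → E → E} {τ L : ℝ}

theorem differentiableAt_field (h : IsLocalFlow Y s U x τ L) {z : E} (hz : z ∈ s) :
    DifferentiableAt ℝ Y z :=
  (h.contDiffOn.differentiableOn one_ne_zero).differentiableAt (h.isOpen_range.mem_nhds hz)

theorem norm_field_sub_le (h : IsLocalFlow Y s U x τ L) {y z : E} (hy : y ∈ s) (hz : z ∈ s) :
    ‖Y y - Y z‖ ≤ L * ‖y - z‖ :=
  h.convex.norm_image_sub_le_of_norm_fderiv_le (fun _ hw => h.differentiableAt_field hw)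
    h.bound hz hy

theorem norm_sub_le (h : IsLocalFlow Y s U x τ L) {t : ℝ} (ht : |t| < τ) {y z : E} (hy : y ∈ U)
    (hz : z ∈ U) : ‖x t y - x t z‖ ≤ Real.exp (L * τ) * ‖y - z‖ := by
  have := norm_le_gronwallBound_abs (w := fun t => x t y - x t z) (K := L) (ε := 0)
    (fun t ht => (h.hasDerivAt t ht y hy).sub (h.hasDerivAt t ht z hz))
    (fun t ht => by simpa using h.norm_field_sub_le (h.mem t ht y hy) (h.mem t ht z hz)) ht
  rw [gronwallBound_ε0, h.zero y hy, h.zero z hz, mul_comm] at this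
  refine this.trans ?_
  gcongr
  exact h.L_pos.le

theorem norm_fderiv_le (h : IsLocalFlow Y s U x τ L) {t : ℝ} (ht : |t| < τ) {y : E} (hy : y ∈ U) :
    ‖fderiv ℝ (x t) y‖ ≤ Real.exp (L * τ) :=
  norm_fderiv_le_of_lip' ℝ (Real.exp_pos _).le (by
    filter_upwards [h.isOpen.mem_nhds hy] with z hz using h.norm_sub_le ht hz hy)

theorem norm_fderiv_apply_le (h : IsLocalFlow Y s U x τ L) {t : ℝ} (ht : |t| < τ) {y : E}
    (hy : y ∈ U) (v : E) : ‖fderiv ℝ (x t) y v‖ ≤ Real.exp (L * τ) * ‖v‖ :=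
  (fderiv ℝ (x t) y).le_of_opNorm_le (h.norm_fderiv_le ht hy) v

theorem continuousOn_path (h : IsLocalFlow Y s U x τ L) {y : E} (hy : y ∈ U) :
    ContinuousOn (fun t => x t y) (Set.Ioo (-τ) τ) := fun t ht =>
  (h.hasDerivAt t (abs_lt.2 ht) y hy).continuousAt.continuousWithinAt

theorem fderiv_apply_sub [CompleteSpace E] (h : IsLocalFlow Y s U x τ L) {t₁ t₂ : ℝ}
    (h₁ : |t₁| < τ) (h₂ : |t₂| < τ) {y : E} (hy : y ∈ U) (v : E) :
    fderiv ℝ (x t₂) y v - fderiv ℝ (x t₁) y v =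
      ∫ r in t₁..t₂, fderiv ℝ Y (x r y) (fderiv ℝ (x r) y v) := by
  have hsub : Set.uIcc t₁ t₂ ⊆ Set.Ioo (-τ) τ :=
    Set.OrdConnected.uIcc_subset Set.ordConnected_Ioo (abs_lt.1 h₁) (abs_lt.1 h₂)
  have hU : ∀ᶠ a : ℝ in 𝓝[≠] 0, y + a • v ∈ U := by
    have : ContinuousAt (fun a : ℝ => y + a • v) 0 := by fun_prop
    exact nhdsWithin_le_nhds (this (h.isOpen.mem_nhds (by simpa using hy)))
  have hlim : ∀ t, |t| < τ → Tendsto (fun a : ℝ => a⁻¹ • (x t (y + a • v) - x t y)) (𝓝[≠] 0)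
      (𝓝 (fderiv ℝ (x t) y v)) := fun t ht =>
    ((h.differentiableAt t ht y hy).hasFDerivAt.hasLineDerivAt v).tendsto_slope_zero
  have hcont : ∀ z ∈ U, ContinuousOn (fun r => Y (x r z)) (Set.Ioo (-τ) τ) := fun z hz =>
    h.contDiffOn.continuousOn.comp (h.continuousOn_path hz)
      (fun r hr => h.mem r (abs_lt.2 hr) z hz)
  have hint : ∀ z ∈ U, ∫ r in t₁..t₂, Y (x r z) = x t₂ z - x t₁ z := fun z hz =>
    intervalIntegral.integral_eq_sub_of_hasDerivAt
      (fun r hr => h.hasDerivAt r (abs_lt.2 (hsub hr)) z hz)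
      ((hcont z hz).mono hsub).intervalIntegrable
  have hI : Tendsto (fun a : ℝ => ∫ r in t₁..t₂, a⁻¹ • (Y (x r (y + a • v)) - Y (x r y))) (𝓝[≠] 0)
      (𝓝 (∫ r in t₁..t₂, fderiv ℝ Y (x r y) (fderiv ℝ (x r) y v))) := by
    refine intervalIntegral.tendsto_integral_filter_of_dominated_convergence
      (fun _ => L * (Real.exp (L * τ) * ‖v‖)) ?_ ?_ intervalIntegrable_const ?_
    · filter_upwards [hU] with a ha
      exact ((((hcont _ ha).sub (hcont _ hy)).const_smul _).mono
        (Set.uIoc_subset_uIcc.trans hsub)).aestronglyMeasurable measurableSet_uIoc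
    · filter_upwards [hU, self_mem_nhdsWithin] with a ha ha0
      refine Eventually.of_forall fun r hr => ?_
      have hr' : |r| < τ := abs_lt.2 (hsub (Set.uIoc_subset_uIcc hr))
      have ha1 : (0 : ℝ) < |a| := abs_pos.2 ha0
      rw [norm_smul, norm_inv, Real.norm_eq_abs, inv_mul_le_iff₀ ha1]
      calc ‖Y (x r (y + a • v)) - Y (x r y)‖ ≤ L * ‖x r (y + a • v) - x r y‖ :=
            h.norm_field_sub_le (h.mem r hr' _ ha) (h.mem r hr' _ hy)
        _ ≤ L * (Real.exp (L * τ) * ‖(y + a • v) - y‖) := by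
            have := h.L_pos.le
            gcongr
            exact h.norm_sub_le hr' ha hy
        _ = |a| * (L * (Real.exp (L * τ) * ‖v‖)) := by
            rw [add_sub_cancel_left, norm_smul, Real.norm_eq_abs]; ring
    · refine Eventually.of_forall fun r hr => ?_
      have hr' : |r| < τ := abs_lt.2 (hsub (Set.uIoc_subset_uIcc hr))
      exact (((h.differentiableAt_field (h.mem r hr' y hy)).hasFDerivAt.comp y
        (h.differentiableAt r hr' y hy).hasFDerivAt).hasLineDerivAt v).tendsto_slope_zero
  refine tendsto_nhds_unique ((hlim t₂ h₂).sub (hlim t₁ h₁)) (hI.congr' ?_)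
  filter_upwards [hU] with a ha
  rw [intervalIntegral.integral_smul, intervalIntegral.integral_sub, hint _ ha, hint _ hy,
    ← smul_sub]
  · congr 1; abel
  · exact ((hcont _ ha).mono hsub).intervalIntegrable
  · exact ((hcont _ hy).mono hsub).intervalIntegrable

theorem continuousOn_fderiv_field (h : IsLocalFlow Y s U x τ L) :
    ContinuousOn (fun z : ℝ × E => fderiv ℝ Y (x z.1 z.2)) (Set.Ioo (-τ) τ ×ˢ U) :=
  (h.contDiffOn.continuousOn_fderiv_of_isOpen h.isOpen_range le_rfl).comp h.continuousOn
    (fun z hz => h.mem z.1 (abs_lt.2 hz.1) z.2 hz.2)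

theorem continuousOn_fderiv_path [CompleteSpace E] (h : IsLocalFlow Y s U x τ L) {y : E}
    (hy : y ∈ U) (v : E) :
    ContinuousOn (fun t => fderiv ℝ (x t) y v) (Set.Ioo (-τ) τ) := by
  have hlip : LipschitzOnWith (Real.toNNReal (L * (Real.exp (L * τ) * ‖v‖)))
      (fun t => fderiv ℝ (x t) y v) (Set.Ioo (-τ) τ) := by
    refine LipschitzOnWith.of_dist_le_mul fun t₂ h₂ t₁ h₁ => ?_
    have h0 := h.L_pos.le
    rw [dist_eq_norm, h.fderiv_apply_sub (abs_lt.2 h₁) (abs_lt.2 h₂) hy v, Real.dist_eq,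
      Real.coe_toNNReal _ (by positivity)]
    refine intervalIntegral.norm_integral_le_of_norm_le_const fun r hr => ?_
    have hr' : |r| < τ := abs_lt.2 (Set.OrdConnected.uIcc_subset Set.ordConnected_Ioo
      h₁ h₂ (Set.uIoc_subset_uIcc hr))
    exact ((fderiv ℝ Y (x r y)).le_of_opNorm_le (h.bound _ (h.mem r hr' y hy)) _).trans
      (by gcongr; exact h.norm_fderiv_apply_le hr' hy v)
  exact hlip.continuousOn

/-- The first variational equation. -/
theorem hasDerivAt_fderiv [CompleteSpace E] (h : IsLocalFlow Y s U x τ L) {t : ℝ} (ht : |t| < τ)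
    {y : E} (hy : y ∈ U) (v : E) :
    HasDerivAt (fun t => fderiv ℝ (x t) y v) (fderiv ℝ Y (x t y) (fderiv ℝ (x t) y v)) t := by
  have h0 : |(0 : ℝ)| < τ := by simpa using (abs_nonneg t).trans_lt ht
  have hc : ContinuousOn (fun r => fderiv ℝ Y (x r y) (fderiv ℝ (x r) y v)) (Set.Ioo (-τ) τ) := by
    refine ContinuousOn.clm_apply ?_ (h.continuousOn_fderiv_path hy v)
    exact h.continuousOn_fderiv_field.comp (f := fun r : ℝ => (r, y)) (by fun_prop)
      (fun r hr => ⟨hr, hy⟩)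
  have hI := intervalIntegral.integral_hasDerivAt_right (a := 0) (b := t)
    (hc.mono (Set.OrdConnected.uIcc_subset Set.ordConnected_Ioo (abs_lt.1 h0)
      (abs_lt.1 ht))).intervalIntegrable
    (hc.stronglyMeasurableAtFilter isOpen_Ioo t (abs_lt.1 ht))
    (hc.continuousAt (isOpen_Ioo.mem_nhds (abs_lt.1 ht)))
  refine (hI.const_add (fderiv ℝ (x 0) y v)).congr_of_eventuallyEq ?_
  filter_upwards [isOpen_Ioo.mem_nhds (abs_lt.1 ht)] with r hr
  rw [← h.fderiv_apply_sub h0 (abs_lt.2 hr) hy v]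
  abel

theorem fderiv_zero (h : IsLocalFlow Y s U x τ L) {y : E} (hy : y ∈ U) (v : E) :
    fderiv ℝ (x 0) y v = v := by
  have : x 0 =ᶠ[𝓝 y] id := by
    filter_upwards [h.isOpen.mem_nhds hy] with z hz using h.zero z hz
  rw [this.fderiv_eq, fderiv_id]; rfl

theorem continuousOn_fderiv_apply [CompleteSpace E] (h : IsLocalFlow Y s U x τ L) (v : E) :
    ContinuousOn (fun z : ℝ × E => fderiv ℝ (x z.1) z.2 v) (Set.Ioo (-τ) τ ×ˢ U) := by
  rintro ⟨t₀, y₀⟩ ⟨ht₀, hy₀⟩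
  refine ContinuousAt.continuousWithinAt ?_
  simp only at ht₀ hy₀
  have hL := h.L_pos
  obtain ⟨τ', h1, h2⟩ := exists_between (abs_lt.2 ht₀)
  have hpath := (h.continuousOn_fderiv_path hy₀ v).continuousAt (isOpen_Ioo.mem_nhds ht₀)
  set K := Real.exp (L * τ) * ‖v‖ with hK
  have key : ∀ ε > 0, ∀ᶠ y in 𝓝 y₀, ∀ t, |t| < τ' →
      ‖fderiv ℝ (x t) y v - fderiv ℝ (x t) y₀ v‖ ≤ ε * (K / L * Real.exp (L * τ')) := by
    intro ε hε
    have hunif : ∀ᶠ y in 𝓝 y₀, ∀ t ∈ Set.Icc (-τ') τ',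
        ‖fderiv ℝ Y (x t y) - fderiv ℝ Y (x t y₀)‖ < ε := by
      refine isCompact_Icc.eventually_forall_of_forall_eventually fun t ht => ?_
      have ht' : t ∈ Set.Ioo (-τ) τ := ⟨by linarith [ht.1], by linarith [ht.2]⟩
      have hc := h.continuousOn_fderiv_field.continuousAt
        ((isOpen_Ioo.prod h.isOpen).mem_nhds (show (t, y₀) ∈ Set.Ioo (-τ) τ ×ˢ U from ⟨ht', hy₀⟩))
      have hA : ContinuousAt (fun z : E × ℝ => fderiv ℝ Y (x z.2 z.1)) (y₀, t) :=
        ContinuousAt.comp (f := fun z : E × ℝ => (z.2, z.1))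
          (g := fun z : ℝ × E => fderiv ℝ Y (x z.1 z.2)) hc (by fun_prop)
      have hB : ContinuousAt (fun z : E × ℝ => fderiv ℝ Y (x z.2 y₀)) (y₀, t) :=
        ContinuousAt.comp (f := fun z : E × ℝ => (z.2, y₀))
          (g := fun z : ℝ × E => fderiv ℝ Y (x z.1 z.2)) hc (by fun_prop)
      have hC := (hA.sub hB).norm
      rw [ContinuousAt] at hC
      exact hC.eventually_lt_const (by simpa using hε)
    filter_upwards [hunif, h.isOpen.mem_nhds hy₀] with y hy hyU t ht
    have := norm_le_gronwallBound_abs (τ := τ')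
      (w := fun t => fderiv ℝ (x t) y v - fderiv ℝ (x t) y₀ v) (K := L) (ε := ε * K)
      (fun t ht => (h.hasDerivAt_fderiv (ht.trans h2) hyU v).sub
        (h.hasDerivAt_fderiv (ht.trans h2) hy₀ v)) (fun t ht => ?_) ht
    · simp only [h.fderiv_zero hyU, h.fderiv_zero hy₀, sub_self, norm_zero] at this
      refine this.trans ?_
      rw [gronwallBound_of_K_ne_0 hL.ne']
      have hK0 : 0 ≤ K := by positivity
      calc 0 * Real.exp (L * |t|) + ε * K / L * (Real.exp (L * |t|) - 1)
          ≤ ε * K / L * Real.exp (L * τ') := by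
            rw [zero_mul, zero_add]
            gcongr
            have : Real.exp (L * |t|) ≤ Real.exp (L * τ') := by gcongr
            linarith
        _ = _ := by ring
    · have ht' := ht.trans h2
      have e : fderiv ℝ Y (x t y) (fderiv ℝ (x t) y v) - fderiv ℝ Y (x t y₀) (fderiv ℝ (x t) y₀ v)
          = fderiv ℝ Y (x t y) (fderiv ℝ (x t) y v - fderiv ℝ (x t) y₀ v) +
            (fderiv ℝ Y (x t y) - fderiv ℝ Y (x t y₀)) (fderiv ℝ (x t) y₀ v) := by
        simp
      rw [e]
      refine (norm_add_le _ _).trans (add_le_add ?_ ?_)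
      · exact (fderiv ℝ Y (x t y)).le_of_opNorm_le (h.bound _ (h.mem t ht' y hyU)) _
      · refine (ContinuousLinearMap.le_of_opNorm_le _ (hy t (abs_le.1 ht.le)).le _).trans ?_
        gcongr
        exact h.norm_fderiv_apply_le ht' hy₀ v
  rw [Metric.continuousAt_iff']
  intro ε hε
  set c := K / L * Real.exp (L * τ') + 1 with hc
  have hc0 : 0 < c := by positivity
  have e1 := key (ε / 2 / c) (by positivity)
  have e2 := (Metric.continuousAt_iff'.1 hpath) (ε / 2) (by positivity)
  have e3 : ∀ᶠ t in 𝓝 t₀, |t| < τ' :=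
    (continuous_abs.continuousAt (x := t₀)).eventually_lt_const h1
  rw [nhds_prod_eq]
  filter_upwards [(e2.and e3).prod_mk e1] with z ⟨⟨hz1, hz2⟩, hz3⟩
  have hz4 := hz3 z.1 hz2
  have : ε / 2 / c * (K / L * Real.exp (L * τ')) ≤ ε / 2 := by
    rw [div_mul_eq_mul_div, div_le_iff₀ hc0]
    gcongr
    rw [hc]; linarith
  calc dist (fderiv ℝ (x z.1) z.2 v) (fderiv ℝ (x t₀) y₀ v)
      ≤ dist (fderiv ℝ (x z.1) z.2 v) (fderiv ℝ (x z.1) y₀ v) +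
        dist (fderiv ℝ (x z.1) y₀ v) (fderiv ℝ (x t₀) y₀ v) := dist_triangle _ _ _
    _ < ε := by rw [dist_eq_norm]; linarith

end IsLocalFlow

end LocalFlow

section Chart

variable {M : Type*} [TopologicalSpace M] [ChartedSpace E3 M]

/-- The differential of the preferred chart at `p`. -/
def dchart (p q : M) : TangentSpace (𝓡 3) q →L[ℝ] E3 :=
  mfderiv (𝓡 3) 𝓘(ℝ, E3) (extChartAt (𝓡 3) p) q

/-- The differential of the inverse of the preferred chart at `p`. -/
def dchartSymm (p : M) (y : E3) : E3 →L[ℝ] TangentSpace (𝓡 3) ((extChartAt (𝓡 3) p).symm y) :=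
  mfderiv 𝓘(ℝ, E3) (𝓡 3) (extChartAt (𝓡 3) p).symm y

/-- A vector field in the preferred chart at `p`. -/
def coordField (X : VField M) (p : M) (y : E3) : E3 :=
  dchart p ((extChartAt (𝓡 3) p).symm y) (X ((extChartAt (𝓡 3) p).symm y))

/-- A flow in the preferred chart at `p`. -/
def coordFlow (φ : Flow ℝ M) (p : M) (t : ℝ) (y : E3) : E3 :=
  extChartAt (𝓡 3) p (φ t ((extChartAt (𝓡 3) p).symm y))

theorem coordField_chart (X : VField M) {p q : M} (hq : q ∈ (extChartAt (𝓡 3) p).source) :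
    coordField X p (extChartAt (𝓡 3) p q) = dchart p q (X q) := by
  rw [coordField, (extChartAt (𝓡 3) p).left_inv hq]

variable [IsManifold (𝓡 3) ∞ M]

theorem hasMFDerivAt_chart {p q : M} (hq : q ∈ (extChartAt (𝓡 3) p).source) :
    HasMFDerivAt (𝓡 3) 𝓘(ℝ, E3) (extChartAt (𝓡 3) p) q (dchart p q) :=
  (mdifferentiableAt_extChartAt (by rwa [extChartAt_source] at hq)).hasMFDerivAt

theorem hasMFDerivAt_chart_symm {p : M} {y : E3} (hy : y ∈ (extChartAt (𝓡 3) p).target) :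
    HasMFDerivAt 𝓘(ℝ, E3) (𝓡 3) (extChartAt (𝓡 3) p).symm y (dchartSymm p y) := by
  have h := mdifferentiableWithinAt_extChartAt_symm (I := 𝓡 3) hy
  rw [ModelWithCorners.range_eq_univ, mdifferentiableWithinAt_univ] at h
  exact h.hasMFDerivAt

theorem dchart_dchartSymm {p : M} {y : E3} (hy : y ∈ (extChartAt (𝓡 3) p).target) (v : E3) :
    dchart p ((extChartAt (𝓡 3) p).symm y) (dchartSymm p y v) = v := by
  have h := mfderiv_extChartAt_comp_mfderivWithin_extChartAt_symm (I := 𝓡 3) hy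
  rw [ModelWithCorners.range_eq_univ, mfderivWithin_univ] at h
  exact congrArg (fun f : E3 →L[ℝ] E3 => f v) h

theorem dchartSymm_dchart {p : M} {y : E3} (hy : y ∈ (extChartAt (𝓡 3) p).target)
    (w : TangentSpace (𝓡 3) ((extChartAt (𝓡 3) p).symm y)) :
    dchartSymm p y (dchart p ((extChartAt (𝓡 3) p).symm y) w) = w := by
  have h := mfderivWithin_extChartAt_symm_comp_mfderiv_extChartAt (I := 𝓡 3) hy
  rw [ModelWithCorners.range_eq_univ, mfderivWithin_univ] at h
  exact congrArg (fun f : TangentSpace (𝓡 3) ((extChartAt (𝓡 3) p).symm y) →L[ℝ]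
    TangentSpace (𝓡 3) ((extChartAt (𝓡 3) p).symm y) => f w) h

theorem coordForm_dchart (α : OneForm M) {p q : M} (hq : q ∈ (extChartAt (𝓡 3) p).source)
    (w : TangentSpace (𝓡 3) q) :
    coordForm α p (extChartAt (𝓡 3) p q) (dchart p q w) = α q w := by
  obtain ⟨y, hy, rfl⟩ : ∃ y ∈ (extChartAt (𝓡 3) p).target, (extChartAt (𝓡 3) p).symm y = q :=
    ⟨_, (extChartAt (𝓡 3) p).map_source hq, (extChartAt (𝓡 3) p).left_inv hq⟩
  rw [(extChartAt (𝓡 3) p).right_inv hy]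
  exact congrArg (α _) (dchartSymm_dchart hy w)

theorem dchart_injective {p q : M} (hq : q ∈ (extChartAt (𝓡 3) p).source) :
    Function.Injective (dchart p q) := by
  obtain ⟨y, hy, rfl⟩ : ∃ y ∈ (extChartAt (𝓡 3) p).target, (extChartAt (𝓡 3) p).symm y = q :=
    ⟨_, (extChartAt (𝓡 3) p).map_source hq, (extChartAt (𝓡 3) p).left_inv hq⟩
  exact Function.LeftInverse.injective (dchartSymm_dchart hy)

theorem trivializationAt_snd {p : M} {v : TangentBundle (𝓡 3) M}
    (hv : v.proj ∈ (extChartAt (𝓡 3) p).source) :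
    (trivializationAt E3 (TangentSpace (𝓡 3)) p v).2 = dchart p v.proj v.snd := by
  rw [extChartAt_source] at hv
  have h := TangentBundle.continuousLinearMapAt_trivializationAt (I := 𝓡 3) hv
  rw [dchart, ← h, Trivialization.continuousLinearMapAt_apply, Trivialization.linearMapAt_apply,
    if_pos (by simpa using hv)]

/-- Continuity of a map into the tangent bundle, in the preferred chart at a point. -/
theorem continuousWithinAt_tangentBundle_iff {Z : Type*} [TopologicalSpace Z]
    {f : Z → TangentBundle (𝓡 3) M} {s : Set Z} {z₀ : Z} {p : M}
    (hp : (f z₀).proj ∈ (extChartAt (𝓡 3) p).source) :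
    ContinuousWithinAt f s z₀ ↔ ContinuousWithinAt (fun z => (f z).proj) s z₀ ∧
      ContinuousWithinAt (fun z => dchart p (f z).proj (f z).snd) s z₀ := by
  have hp' : f z₀ ∈ (trivializationAt E3 (TangentSpace (𝓡 3)) p).source := by
    rw [Trivialization.mem_source]; simpa using hp
  have h := (trivializationAt E3 (TangentSpace (𝓡 3)) p).tendsto_nhds_iff (f := f) (l := 𝓝[s] z₀)
    hp'
  refine h.trans (and_congr_right fun h1 => ?_)
  have hev : (fun z => (trivializationAt E3 (TangentSpace (𝓡 3)) p (f z)).2) =ᶠ[𝓝[s] z₀]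
      fun z => dchart p (f z).proj (f z).snd := by
    filter_upwards [h1 ((isOpen_extChartAt_source p).mem_nhds hp)] with z hz
    exact trivializationAt_snd hz
  rw [ContinuousWithinAt, tendsto_congr' hev]
  simp [trivializationAt_snd hp]

theorem continuousAt_tangentBundle_iff {Z : Type*} [TopologicalSpace Z]
    {f : Z → TangentBundle (𝓡 3) M} {z₀ : Z} {p : M}
    (hp : (f z₀).proj ∈ (extChartAt (𝓡 3) p).source) :
    ContinuousAt f z₀ ↔ ContinuousAt (fun z => (f z).proj) z₀ ∧
      ContinuousAt (fun z => dchart p (f z).proj (f z).snd) z₀ := by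
  simpa [continuousWithinAt_univ] using
    continuousWithinAt_tangentBundle_iff (f := f) (s := Set.univ) hp

theorem continuousAt_dchart {p : M} {v : TangentBundle (𝓡 3) M}
    (hp : v.proj ∈ (extChartAt (𝓡 3) p).source) :
    ContinuousAt (fun w : TangentBundle (𝓡 3) M => dchart p w.proj w.snd) v :=
  ((continuousAt_tangentBundle_iff (f := id) hp).1 continuousAt_id).2

theorem continuousAt_proj (v : TangentBundle (𝓡 3) M) :
    ContinuousAt (fun w : TangentBundle (𝓡 3) M => w.proj) v :=
  (FiberBundle.continuous_proj E3 (TangentSpace (𝓡 3) : M → Type _)).continuousAt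

theorem contDiffOn_coordField {X : VField M} {n : ℕ} (hX : IsCnVField n X) (p : M) :
    ContDiffOn ℝ n (coordField X p) (extChartAt (𝓡 3) p).target := by
  have h1 := (Trivialization.contMDiffOn_section_baseSet_iff (IB := 𝓡 3) (n := n)
    (trivializationAt E3 (TangentSpace (𝓡 3)) p) (s := X)).1 hX.contMDiffOn
  have h2 : ContMDiffOn 𝓘(ℝ, E3) (𝓡 3) n (extChartAt (𝓡 3) p).symm (extChartAt (𝓡 3) p).target :=
    (contMDiffOn_extChartAt_symm (n := ∞) p).of_le (by exact_mod_cast le_top)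
  rw [← contMDiffOn_iff_contDiffOn]
  refine ((h1.comp h2 ?_).congr ?_)
  · intro y hy
    simpa using (extChartAt (𝓡 3) p).map_target hy
  · intro y hy
    exact (trivializationAt_snd (v := ⟨_, X ((extChartAt (𝓡 3) p).symm y)⟩)
      ((extChartAt (𝓡 3) p).map_target hy)).symm

theorem inCoordinates_eq_coordForm (α : OneForm M) {p q : M}
    (hq : q ∈ (extChartAt (𝓡 3) p).source) :
    ContinuousLinearMap.inCoordinates E3 (TangentSpace (𝓡 3)) ℝ (Bundle.Trivial M ℝ) p q p q (α q) =
      coordForm α p (extChartAt (𝓡 3) p q) := by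
  obtain ⟨y, hy, rfl⟩ : ∃ y ∈ (extChartAt (𝓡 3) p).target, (extChartAt (𝓡 3) p).symm y = q :=
    ⟨_, (extChartAt (𝓡 3) p).map_source hq, (extChartAt (𝓡 3) p).left_inv hq⟩
  rw [ContinuousLinearMap.inCoordinates,
    TangentBundle.symmL_trivializationAt (by rwa [extChartAt_source] at hq),
    ModelWithCorners.range_eq_univ, mfderivWithin_univ, coordForm, (extChartAt (𝓡 3) p).right_inv hy]
  ext v
  simp

theorem isCnForm_iff {α : OneForm M} {n : ℕ} :
    IsCnForm n α ↔ ∀ p, ContDiffAt ℝ n (coordForm α p) (extChartAt (𝓡 3) p p) := by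
  refine forall_congr' fun p => ?_
  have hp := mem_extChartAt_source (I := 𝓡 3) p
  rw [contMDiffAt_hom_bundle]
  have hev : (fun q => ContinuousLinearMap.inCoordinates E3 (TangentSpace (𝓡 3)) ℝ
      (Bundle.Trivial M ℝ) p q p q (α q)) =ᶠ[𝓝 p]
      fun q => coordForm α p (extChartAt (𝓡 3) p q) := by
    filter_upwards [(isOpen_extChartAt_source (I := 𝓡 3) p).mem_nhds hp] with q hq
    exact inCoordinates_eq_coordForm α hq
  rw [← contMDiffAt_iff_contDiffAt]
  constructor
  · rintro ⟨-, h⟩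
    have h2 : ContMDiffAt 𝓘(ℝ, E3) (𝓡 3) n (extChartAt (𝓡 3) p).symm (extChartAt (𝓡 3) p p) :=
      ((contMDiffOn_extChartAt_symm (n := ∞) p).contMDiffAt
        ((isOpen_extChartAt_target p).mem_nhds (mem_extChartAt_target p))).of_le
        (by exact_mod_cast le_top)
    have h3 := (h.congr_of_eventuallyEq hev.symm)
    refine (ContMDiffAt.comp_of_eq (x := extChartAt (𝓡 3) p p)
      (g := fun q => coordForm α p (extChartAt (𝓡 3) p q)) h3 h2
      (extChartAt_to_inv p)).congr_of_eventuallyEq ?_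
    filter_upwards [(isOpen_extChartAt_target p).mem_nhds (mem_extChartAt_target p)] with y hy
    exact congrArg (coordForm α p) ((extChartAt (𝓡 3) p).right_inv hy).symm
  · intro h
    refine ⟨contMDiffAt_id, ContMDiffAt.congr_of_eventuallyEq ?_ hev⟩
    exact h.comp p ((contMDiffAt_extChartAt (n := ∞)).of_le (by exact_mod_cast le_top))

theorem IsCnForm.eventually_contDiffAt {α : OneForm M} (hα : IsCnForm 1 α) (p : M) :
    ∀ᶠ q in 𝓝 p, ContDiffAt ℝ 1 (coordForm α p) (extChartAt (𝓡 3) p q) :=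
  (continuousAt_extChartAt (I := 𝓡 3) p).eventually
    ((isCnForm_iff.1 hα p).eventually (by simp))

theorem IsCnForm.zero {α : OneForm M} (hα : IsCnForm 1 α) : IsCnForm 0 α :=
  ContMDiff.of_le hα (by simp)

theorem continuousOn_dchartSymm (p : M) :
    ContinuousOn (fun z : E3 × E3 => (⟨_, dchartSymm p z.1 z.2⟩ : TangentBundle (𝓡 3) M))
      ((extChartAt (𝓡 3) p).target ×ˢ Set.univ) := by
  rintro ⟨y, v⟩ ⟨hy, -⟩
  rw [continuousWithinAt_tangentBundle_iff (p := p) ((extChartAt (𝓡 3) p).map_target hy)]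
  constructor
  · exact ((continuousOn_extChartAt_symm p).comp continuousOn_fst (fun z hz => hz.1)) _ ⟨hy, trivial⟩
  · refine (continuousWithinAt_snd (s := (extChartAt (𝓡 3) p).target ×ˢ Set.univ)).congr
      (fun z hz => ?_) ?_
    · exact dchart_dchartSymm hz.1 z.2
    · exact dchart_dchartSymm hy v

/-- A 1-form is continuous if and only if it is continuous as a function on the tangent bundle. -/
theorem isCnForm_zero_iff {α : OneForm M} :
    IsCnForm 0 α ↔ Continuous (fun v : TangentBundle (𝓡 3) M => α v.proj v.snd) := by
  constructor
  · intro h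
    rw [continuous_iff_continuousAt]
    intro v
    have hp := mem_extChartAt_source (I := 𝓡 3) v.proj
    have h1 : ContinuousAt (fun w : TangentBundle (𝓡 3) M =>
        coordForm α v.proj (extChartAt (𝓡 3) v.proj w.proj) (dchart v.proj w.proj w.snd)) v := by
      refine ContinuousAt.clm_apply ?_ (continuousAt_dchart hp)
      refine ContinuousAt.comp (g := coordForm α v.proj)
        (f := fun w : TangentBundle (𝓡 3) M => extChartAt (𝓡 3) v.proj w.proj)
        (isCnForm_iff.1 h v.proj).continuousAt ?_
      exact ContinuousAt.comp (g := extChartAt (𝓡 3) v.proj) (continuousAt_extChartAt (I := 𝓡 3) v.proj)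
        (continuousAt_proj v)
    refine h1.congr ?_
    filter_upwards [(continuousAt_proj v) ((isOpen_extChartAt_source v.proj).mem_nhds hp)] with w hw
    exact coordForm_dchart α hw w.snd
  · intro h
    rw [isCnForm_iff]
    intro p
    simp only [Nat.cast_zero, contDiffAt_zero]
    refine ⟨_, (isOpen_extChartAt_target p).mem_nhds (mem_extChartAt_target p), ?_⟩
    rw [continuousOn_clm_apply]
    intro w
    exact h.comp_continuousOn ((continuousOn_dchartSymm p).comp (f := fun y => (y, w)) (by fun_prop)
      (fun y hy => ⟨hy, trivial⟩))

end Chart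

section FlowChart

variable {M : Type*} [TopologicalSpace M] [ChartedSpace E3 M] [IsManifold (𝓡 3) ∞ M]

/-- `φ` is the flow of the `C¹` vector field `X`, and its time-`t` maps are differentiable. -/
structure IsDiffFlow (X : VField M) (φ : Flow ℝ M) : Prop where
  field : IsCnVField 1 X
  flow : IsFlowOf X φ
  mdiff : ∀ t p, MDifferentiableAt (𝓡 3) (𝓡 3) (φ t) p

variable {X : VField M} {φ : Flow ℝ M}

theorem IsDominatedSplitting.surjective_push {Es Eu : Distribution M}
    (h : IsDominatedSplitting X φ Es Eu) (t : ℝ) (p : M) : Function.Surjective (push φ t p) := by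
  obtain ⟨-, -, -, h1, h2, h3, -⟩ := h
  have : (⊤ : Submodule ℝ (TangentSpace (𝓡 3) p)).map (push φ t p).toLinearMap = ⊤ := by
    rw [← h1 p, Submodule.map_sup, h2 t p, h3 t p, h1]
  rw [Submodule.map_top] at this
  exact LinearMap.range_eq_top.1 this

theorem IsDominatedSplitting.isDiffFlow {Es Eu : Distribution M}
    (h : IsDominatedSplitting X φ Es Eu) (hX : IsCnVField 1 X) (hφ : IsFlowOf X φ) :
    IsDiffFlow X φ := by
  refine ⟨hX, hφ, fun t p => ?_⟩
  by_contra hc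
  have h0 : push φ t p = 0 := mfderiv_zero_of_not_mdifferentiableAt hc
  obtain ⟨v, hv⟩ := h.surjective_push t p
    (EuclideanSpace.single (0 : Fin 3) (1 : ℝ) : E3)
  rw [h0] at hv
  have : (0 : E3) = EuclideanSpace.single (0 : Fin 3) (1 : ℝ) := hv
  simpa using congrArg (fun w : E3 => w 0) this

omit [IsManifold (𝓡 3) ∞ M] in
theorem eventually_flow_mem_chart (φ : Flow ℝ M) {s : Set E3} {p : M}
    (hs : s ∈ 𝓝 (extChartAt (𝓡 3) p p)) :
    ∀ᶠ z : ℝ × E3 in 𝓝 (0, extChartAt (𝓡 3) p p),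
      φ z.1 ((extChartAt (𝓡 3) p).symm z.2) ∈ (extChartAt (𝓡 3) p).source ∧
        coordFlow φ p z.1 z.2 ∈ s := by
  have h1 : ContinuousAt (fun z : ℝ × E3 => φ z.1 ((extChartAt (𝓡 3) p).symm z.2))
      (0, extChartAt (𝓡 3) p p) := by
    refine ContinuousAt.comp (g := fun w : ℝ × M => φ w.1 w.2)
      (f := fun z : ℝ × E3 => (z.1, (extChartAt (𝓡 3) p).symm z.2)) φ.cont'.continuousAt ?_
    refine continuousAt_fst.prodMk ?_
    exact ContinuousAt.comp (g := (extChartAt (𝓡 3) p).symm) (continuousAt_extChartAt_symm p)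
      continuousAt_snd
  have h0 : φ 0 ((extChartAt (𝓡 3) p).symm (extChartAt (𝓡 3) p p)) = p := by
    rw [φ.map_zero_apply, extChartAt_to_inv]
  have h2 : ContinuousAt (fun z : ℝ × E3 => coordFlow φ p z.1 z.2) (0, extChartAt (𝓡 3) p p) :=
    ContinuousAt.comp_of_eq (g := extChartAt (𝓡 3) p) (continuousAt_extChartAt (I := 𝓡 3) p) h1 h0
  have e1 := h1.preimage_mem_nhds (t := (extChartAt (𝓡 3) p).source)
    (by simp only [h0]; exact extChartAt_source_mem_nhds p)
  have e2 := h2.preimage_mem_nhds (t := s) (by simpa only [coordFlow, h0] using hs)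
  filter_upwards [e1, e2] with z h3 h4 using ⟨h3, h4⟩

theorem IsDiffFlow.exists_isLocalFlow (h : IsDiffFlow X φ) (p : M) :
    ∃ (s V : Set E3) (τ L : ℝ), 0 < τ ∧
      IsLocalFlow (coordField X p) s V (coordFlow φ p) τ L ∧
      extChartAt (𝓡 3) p p ∈ V ∧ V ⊆ (extChartAt (𝓡 3) p).target ∧
      ∀ t, |t| < τ → ∀ y ∈ V,
        φ t ((extChartAt (𝓡 3) p).symm y) ∈ (extChartAt (𝓡 3) p).source := by
  have hT := isOpen_extChartAt_target (I := 𝓡 3) p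
  have hY := contDiffOn_coordField h.field p
  have hb : ∀ᶠ y in 𝓝 (extChartAt (𝓡 3) p p), ‖fderiv ℝ (coordField X p) y‖ <
      ‖fderiv ℝ (coordField X p) (extChartAt (𝓡 3) p p)‖ + 1 :=
    ((hY.continuousOn_fderiv_of_isOpen hT (by simp)).continuousAt
      (hT.mem_nhds (mem_extChartAt_target p))).norm.eventually_lt_const (lt_add_one _)
  obtain ⟨r, hr, hball⟩ := Metric.eventually_nhds_iff_ball.1
    (hb.and (hT.mem_nhds (mem_extChartAt_target p)))
  obtain ⟨a, ha, b, hb', hab⟩ := eventually_prod_iff.1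
    ((nhds_prod_eq (x := (0 : ℝ)) (y := extChartAt (𝓡 3) p p)) ▸
      eventually_flow_mem_chart φ (Metric.ball_mem_nhds _ hr))
  obtain ⟨τ, hτ, hτa⟩ := Metric.eventually_nhds_iff_ball.1 ha
  obtain ⟨V, hVb, hVo, hVp⟩ := eventually_nhds_iff.1
    (hb'.and (hT.mem_nhds (mem_extChartAt_target p)))
  have hτ' : ∀ t, |t| < τ → a t := fun t ht => hτa t (by simpa using ht)
  have hVT : V ⊆ (extChartAt (𝓡 3) p).target := fun y hy => (hVb y hy).2
  have hsrc : ∀ t, |t| < τ → ∀ y ∈ V,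
      φ t ((extChartAt (𝓡 3) p).symm y) ∈ (extChartAt (𝓡 3) p).source := fun t ht y hy =>
    (hab (hτ' t ht) (hVb y hy).1).1
  refine ⟨Metric.ball (extChartAt (𝓡 3) p p) r, V, τ, _, hτ,
    { convex := convex_ball _ _
      isOpen_range := Metric.isOpen_ball
      contDiffOn := hY.mono fun y hy => (hball y hy).2
      L_pos := by positivity
      bound := fun y hy => (hball y hy).1.le
      isOpen := hVo
      zero := fun y hy => ?_
      mem := fun t ht y hy => (hab (hτ' t ht) (hVb y hy).1).2
      continuousOn := ?_
      hasDerivAt := fun t ht y hy => ?_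
      differentiableAt := fun t ht y hy => ?_ }, hVp, hVT, hsrc⟩
  · rw [coordFlow, φ.map_zero_apply, (extChartAt (𝓡 3) p).right_inv (hVT hy)]
  · refine (continuousOn_extChartAt p).comp (g := extChartAt (𝓡 3) p)
      (f := fun z : ℝ × E3 => φ z.1 ((extChartAt (𝓡 3) p).symm z.2)) ?_
      (fun z hz => hsrc z.1 (abs_lt.2 hz.1) z.2 hz.2)
    refine φ.cont'.comp_continuousOn
      (f := fun z : ℝ × E3 => (z.1, (extChartAt (𝓡 3) p).symm z.2)) ?_
    exact continuousOn_fst.prodMk ((continuousOn_extChartAt_symm p).comp continuousOn_snd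
      (fun z hz => hVT hz.2))
  · have h1 := (hasMFDerivAt_chart (hsrc t ht y hy)).comp t
      (h.flow ((extChartAt (𝓡 3) p).symm y) t)
    rw [coordFlow, coordField_chart X (hsrc t ht y hy)]
    have h2 : HasFDerivAt (fun r => coordFlow φ p r y)
        ((1 : ℝ →L[ℝ] ℝ).smulRight (dchart p _ (X (φ t ((extChartAt (𝓡 3) p).symm y))))) t := by
      refine h1.hasFDerivAt.congr_fderiv ?_
      ext
      exact (dchart p _).map_smul (1 : ℝ) _
    simpa using h2.hasDerivAt
  · have h1 := (hasMFDerivAt_chart (hsrc t ht y hy)).comp y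
      ((h.mdiff t _).hasMFDerivAt.comp y (hasMFDerivAt_chart_symm (hVT hy)))
    exact h1.hasFDerivAt.differentiableAt

/-- The differential of a flow in the preferred chart at `p`. -/
theorem IsDiffFlow.dchart_push (h : IsDiffFlow X φ) {p q : M} {t : ℝ}
    (hq : q ∈ (extChartAt (𝓡 3) p).source) (hq' : φ t q ∈ (extChartAt (𝓡 3) p).source)
    (w : TangentSpace (𝓡 3) q) :
    dchart p (φ t q) (push φ t q w) =
      fderiv ℝ (coordFlow φ p t) (extChartAt (𝓡 3) p q) (dchart p q w) := by
  have hy := (extChartAt (𝓡 3) p).map_source hq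
  have hd : DifferentiableAt ℝ (coordFlow φ p t) (extChartAt (𝓡 3) p q) := by
    have hz : φ t ((extChartAt (𝓡 3) p).symm (extChartAt (𝓡 3) p q)) ∈
        (extChartAt (𝓡 3) p).source := by rwa [(extChartAt (𝓡 3) p).left_inv hq]
    have h1 := (hasMFDerivAt_chart hz).comp (extChartAt (𝓡 3) p q)
      ((h.mdiff t _).hasMFDerivAt.comp (extChartAt (𝓡 3) p q) (hasMFDerivAt_chart_symm hy))
    exact h1.hasFDerivAt.differentiableAt
  have h1 := (hasMFDerivAt_chart hq').comp q (h.mdiff t q).hasMFDerivAt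
  have h2 := hd.hasFDerivAt.hasMFDerivAt.comp q (hasMFDerivAt_chart hq)
  have h3 := h2.congr_of_eventuallyEq (f₁ := extChartAt (𝓡 3) p ∘ φ t) (by
    filter_upwards [(isOpen_extChartAt_source (I := 𝓡 3) p).mem_nhds hq] with z hz
    simp only [Function.comp, coordFlow, (extChartAt (𝓡 3) p).left_inv hz])
  exact congrArg (fun f : TangentSpace (𝓡 3) q →L[ℝ] E3 => f w) (hasMFDerivAt_unique h1 h3)

end FlowChart

section PushContinuity

variable {M : Type*} [TopologicalSpace M] [ChartedSpace E3 M]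

theorem tangentMap_zero (φ : Flow ℝ M) (v : TangentBundle (𝓡 3) M) :
    tangentMap (𝓡 3) (𝓡 3) (φ 0) v = v := by
  rw [φ.map_zero, tangentMap_id]; rfl

variable [IsManifold (𝓡 3) ∞ M] {X : VField M} {φ : Flow ℝ M}

theorem IsDiffFlow.tangentMap_add (h : IsDiffFlow X φ) (s t : ℝ) (v : TangentBundle (𝓡 3) M) :
    tangentMap (𝓡 3) (𝓡 3) (φ (s + t)) v =
      tangentMap (𝓡 3) (𝓡 3) (φ s) (tangentMap (𝓡 3) (𝓡 3) (φ t) v) := by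
  have : φ (s + t) = φ s ∘ φ t := funext (φ.map_add s t)
  rw [this, tangentMap_comp_at _ (h.mdiff s _) (h.mdiff t _)]

theorem IsDiffFlow.push_field (h : IsDiffFlow X φ) (t : ℝ) (p : M) :
    push φ t p (X p) = X (φ t p) := by
  let f : M → E3 := fun q => push φ t q (X q)
  let g : M → E3 := fun q => X q
  have h1 := (h.mdiff t (φ 0 p)).hasMFDerivAt.comp (0 : ℝ) (h.flow p 0)
  have h2 := h.flow (φ t p) 0
  have he : (φ t ∘ fun s => φ s p) = fun s => φ s (φ t p) := by
    funext s
    simp only [Function.comp, ← φ.map_add, add_comm]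
  rw [he] at h1
  have h3 := congrArg (fun L : ℝ →L[ℝ] E3 => L 1) (hasMFDerivAt_unique h1 h2)
  have h4 : f (φ 0 p) = g (φ 0 (φ t p)) := by
    have e1 : ((1 : ℝ →L[ℝ] ℝ).smulRight (g (φ 0 (φ t p)))) 1 = g (φ 0 (φ t p)) := by simp
    have e2 : (mfderiv (𝓡 3) (𝓡 3) (φ t) (φ 0 p))
        (((1 : ℝ →L[ℝ] ℝ).smulRight (X (φ 0 p))) 1) = f (φ 0 p) := by
      exact congrArg (push φ t (φ 0 p)) (by
        rw [ContinuousLinearMap.smulRight_apply, one_apply_eq_self, one_smul])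
    exact e2.symm.trans (h3.trans e1)
  rwa [φ.map_zero_apply, φ.map_zero_apply] at h4

theorem IsDiffFlow.exists_continuousAt_tangentMap (h : IsDiffFlow X φ) (p : M) :
    ∃ U ∈ 𝓝 p, ∃ τ > 0, ∀ (t : ℝ) (v : TangentBundle (𝓡 3) M), |t| < τ → v.proj ∈ U →
      ContinuousAt (fun z : ℝ × TangentBundle (𝓡 3) M => tangentMap (𝓡 3) (𝓡 3) (φ z.1) z.2)
        (t, v) := by
  obtain ⟨s, V, τ, L, hτ, hl, hpV, hVT, hsrc⟩ := h.exists_isLocalFlow p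
  have hUo : IsOpen ((extChartAt (𝓡 3) p).source ∩ extChartAt (𝓡 3) p ⁻¹' V) :=
    (continuousOn_extChartAt p).isOpen_inter_preimage (isOpen_extChartAt_source p) hl.isOpen
  refine ⟨_, hUo.mem_nhds ⟨mem_extChartAt_source p, hpV⟩, τ, hτ, fun t v ht hv => ?_⟩
  have hsrc' : ∀ t, |t| < τ → ∀ q ∈ (extChartAt (𝓡 3) p).source ∩ extChartAt (𝓡 3) p ⁻¹' V,
      φ t q ∈ (extChartAt (𝓡 3) p).source := fun t ht q hq => by
    have := hsrc t ht _ hq.2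
    rwa [(extChartAt (𝓡 3) p).left_inv hq.1] at this
  have hproj : ContinuousAt (fun z : ℝ × TangentBundle (𝓡 3) M => z.2.proj) (t, v) :=
    ContinuousAt.comp (g := fun w : TangentBundle (𝓡 3) M => w.proj) (continuousAt_proj v)
      continuousAt_snd
  rw [continuousAt_tangentBundle_iff (p := p) (hsrc' t ht _ hv)]
  constructor
  · exact ContinuousAt.comp (g := fun w : ℝ × M => φ w.1 w.2)
      (f := fun z : ℝ × TangentBundle (𝓡 3) M => (z.1, z.2.proj)) φ.cont'.continuousAt
      (continuousAt_fst.prodMk hproj)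
  · have hD : ContinuousOn (fun z : ℝ × E3 => fderiv ℝ (coordFlow φ p z.1) z.2)
        (Set.Ioo (-τ) τ ×ˢ V) :=
      continuousOn_clm_apply.2 fun w => hl.continuousOn_fderiv_apply w
    have hD' := hD.continuousAt ((isOpen_Ioo.prod hl.isOpen).mem_nhds
      (show (t, extChartAt (𝓡 3) p v.proj) ∈ Set.Ioo (-τ) τ ×ˢ V from ⟨abs_lt.1 ht, hv.2⟩))
    have hc : ContinuousAt (fun z : ℝ × TangentBundle (𝓡 3) M =>
        fderiv ℝ (coordFlow φ p z.1) (extChartAt (𝓡 3) p z.2.proj) (dchart p z.2.proj z.2.snd))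
        (t, v) := by
      refine ContinuousAt.clm_apply ?_ ?_
      · refine ContinuousAt.comp (g := fun z : ℝ × E3 => fderiv ℝ (coordFlow φ p z.1) z.2)
          (f := fun z : ℝ × TangentBundle (𝓡 3) M => (z.1, extChartAt (𝓡 3) p z.2.proj)) hD' ?_
        exact continuousAt_fst.prodMk (ContinuousAt.comp (g := extChartAt (𝓡 3) p)
          (continuousAt_extChartAt' hv.1) hproj)
      · exact ContinuousAt.comp (g := fun w : TangentBundle (𝓡 3) M => dchart p w.proj w.snd)
          (f := fun z : ℝ × TangentBundle (𝓡 3) M => z.2) (continuousAt_dchart hv.1) continuousAt_snd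
    refine hc.congr ?_
    have e1 : ∀ᶠ z : ℝ × TangentBundle (𝓡 3) M in 𝓝 (t, v), |z.1| < τ :=
      (continuous_abs.comp continuous_fst).continuousAt.eventually_lt_const ht
    filter_upwards [e1, hproj (hUo.mem_nhds hv)] with z hz1 hz2
    exact (h.dchart_push hz2.1 (hsrc' _ hz1 _ hz2) z.2.snd).symm

theorem IsDiffFlow.continuous_tangentMap [CompactSpace M] (h : IsDiffFlow X φ) :
    Continuous (fun z : ℝ × TangentBundle (𝓡 3) M => tangentMap (𝓡 3) (𝓡 3) (φ z.1) z.2) := by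
  obtain ⟨τ, hτ, hc⟩ : ∃ τ > 0, ∀ (t : ℝ) (v : TangentBundle (𝓡 3) M), |t| < τ →
      v.proj ∈ (Set.univ : Set M) →
      ContinuousAt (fun z : ℝ × TangentBundle (𝓡 3) M => tangentMap (𝓡 3) (𝓡 3) (φ z.1) z.2)
        (t, v) := by
    refine isCompact_univ.induction_on (p := fun U : Set M => ∃ τ > 0, ∀ (t : ℝ)
      (v : TangentBundle (𝓡 3) M), |t| < τ → v.proj ∈ U → ContinuousAt (fun z : ℝ ×
      TangentBundle (𝓡 3) M => tangentMap (𝓡 3) (𝓡 3) (φ z.1) z.2) (t, v)) ?_ ?_ ?_ ?_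
    · exact ⟨1, one_pos, fun t v _ hv => hv.elim⟩
    · rintro s t hst ⟨τ, hτ, H⟩
      exact ⟨τ, hτ, fun r v hr hv => H r v hr (hst hv)⟩
    · rintro s t ⟨τ, hτ, H⟩ ⟨τ', hτ', H'⟩
      refine ⟨min τ τ', lt_min hτ hτ', fun r v hr hv => ?_⟩
      rcases hv with hv | hv
      · exact H r v (hr.trans_le (min_le_left _ _)) hv
      · exact H' r v (hr.trans_le (min_le_right _ _)) hv
    · intro p _
      obtain ⟨U, hU, τ, hτ, H⟩ := h.exists_continuousAt_tangentMap p
      exact ⟨U, mem_nhdsWithin_of_mem_nhds hU, τ, hτ, H⟩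
  have key : ∀ (n : ℕ) (t : ℝ) (v : TangentBundle (𝓡 3) M), |t| < τ * (n + 1) →
      ContinuousAt (fun z : ℝ × TangentBundle (𝓡 3) M => tangentMap (𝓡 3) (𝓡 3) (φ z.1) z.2)
        (t, v) := by
    intro n
    induction n with
    | zero => intro t v ht; exact hc t v (by simpa using ht) trivial
    | succ n ih =>
      intro t v ht
      push_cast at ht
      have hn : (0 : ℝ) < n + 1 + 1 := by positivity
      set c : ℝ := (n + 1) / (n + 1 + 1) with hcdef
      have hc1 : |c * t| < τ * (n + 1) := by
        rw [abs_mul, abs_of_nonneg (by positivity), hcdef, div_mul_eq_mul_div, div_lt_iff₀ hn]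
        nlinarith [show (0 : ℝ) < n + 1 by positivity]
      have hc2 : |(1 - c) * t| < τ := by
        have : 1 - c = 1 / (n + 1 + 1) := by rw [hcdef]; field_simp; ring
        rw [this, abs_mul, abs_of_nonneg (by positivity), div_mul_eq_mul_div, div_lt_iff₀ hn]
        linarith
      have h1 := ih (c * t) v hc1
      have h2 := hc ((1 - c) * t) (tangentMap (𝓡 3) (𝓡 3) (φ (c * t)) v) hc2 trivial
      have h3 : ContinuousAt (fun z : ℝ × TangentBundle (𝓡 3) M =>
          tangentMap (𝓡 3) (𝓡 3) (φ (c * z.1)) z.2) (t, v) :=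
        ContinuousAt.comp (g := fun z : ℝ × TangentBundle (𝓡 3) M =>
          tangentMap (𝓡 3) (𝓡 3) (φ z.1) z.2)
          (f := fun z : ℝ × TangentBundle (𝓡 3) M => (c * z.1, z.2)) h1 (by fun_prop)
      have h4 : ContinuousAt (fun z : ℝ × TangentBundle (𝓡 3) M => tangentMap (𝓡 3) (𝓡 3)
          (φ ((1 - c) * z.1)) (tangentMap (𝓡 3) (𝓡 3) (φ (c * z.1)) z.2)) (t, v) :=
        ContinuousAt.comp (g := fun z : ℝ × TangentBundle (𝓡 3) M =>
          tangentMap (𝓡 3) (𝓡 3) (φ z.1) z.2)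
          (f := fun z : ℝ × TangentBundle (𝓡 3) M =>
            ((1 - c) * z.1, tangentMap (𝓡 3) (𝓡 3) (φ (c * z.1)) z.2)) h2
          ((by fun_prop : ContinuousAt (fun z : ℝ × TangentBundle (𝓡 3) M => (1 - c) * z.1)
            (t, v)).prodMk h3)
      refine h4.congr (Eventually.of_forall fun z => ?_)
      simp only
      rw [← h.tangentMap_add]
      congr 2
      ring
  rw [continuous_iff_continuousAt]
  rintro ⟨t, v⟩
  obtain ⟨n, hn⟩ := exists_nat_gt (|t| / τ)
  refine key n t v ?_
  rw [div_lt_iff₀ hτ] at hn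
  nlinarith

end PushContinuity

section LieDerivative

variable {M : Type*} [TopologicalSpace M] [ChartedSpace E3 M] [IsManifold (𝓡 3) ∞ M]
  {X : VField M} {φ : Flow ℝ M} {α : OneForm M}

/-- The form `i_X dα` in the preferred chart at `p`. -/
def coordLie (α : OneForm M) (X : VField M) (p q : M) (w : TangentSpace (𝓡 3) q) : ℝ :=
  fderiv ℝ (coordForm α p) (extChartAt (𝓡 3) p q) (coordField X p (extChartAt (𝓡 3) p q))
      (dchart p q w) -
    fderiv ℝ (coordForm α p) (extChartAt (𝓡 3) p q) (dchart p q w)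
      (coordField X p (extChartAt (𝓡 3) p q))

theorem IsCnForm.dForm_eq (hα : IsCnForm 1 α) (p : M) (v w : TangentSpace (𝓡 3) p) :
    dForm α p v w =
      fderiv ℝ (coordForm α p) (extChartAt (𝓡 3) p p) (dchart p p v) (dchart p p w) -
      fderiv ℝ (coordForm α p) (extChartAt (𝓡 3) p p) (dchart p p w) (dchart p p v) := by
  have hd : DifferentiableAt ℝ (coordForm α p) (extChartAt (𝓡 3) p p) :=
    (isCnForm_iff.1 hα p).differentiableAt (by simp)
  have hω : DifferentiableAt ℝ (fun y : E3 => ContinuousAlternatingMap.ofSubsingleton ℝ E3 ℝ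
      (0 : Fin 1) (coordForm α p y)) (extChartAt (𝓡 3) p p) :=
    (ContinuousAlternatingMap.ofSubsingletonLIE (𝕜 := ℝ) (E := E3) (F := ℝ)
      (0 : Fin 1)).differentiableAt.comp _ hd
  have hap : ∀ v w : E3, fderiv ℝ (fun y => coordForm α p y v) (extChartAt (𝓡 3) p p) w =
      fderiv ℝ (coordForm α p) (extChartAt (𝓡 3) p p) w v := fun v w => by
    rw [(hd.hasFDerivAt.clm_apply (hasFDerivAt_const v _)).fderiv]
    simp
  rw [dForm, extDeriv_apply hω, Fin.sum_univ_two]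
  simp only [ContinuousAlternatingMap.ofSubsingleton_apply_apply, Fin.removeNth]
  rw [← hap (dchart p p w) (dchart p p v), ← hap (dchart p p v) (dchart p p w)]
  simp [dchart, sub_eq_add_neg]
  rfl

theorem IsCnForm.coordLie_self (hα : IsCnForm 1 α) (X : VField M) (p : M)
    (w : TangentSpace (𝓡 3) p) : coordLie α X p p w = dForm α p (X p) w := by
  rw [hα.dForm_eq, coordLie, coordField_chart X (mem_extChartAt_source p)]

theorem IsDiffFlow.eventually_hasDerivAt_coordLie (h : IsDiffFlow X φ) (hα : IsCnForm 1 α)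
    (hαX : ∀ p, α p (X p) = 0) (p : M) :
    ∀ᶠ q in 𝓝 p, ∀ w : TangentSpace (𝓡 3) q,
      HasDerivAt (fun t => α (φ t q) (push φ t q w)) (coordLie α X p q w) 0 := by
  obtain ⟨s, V, τ, L, hτ, hl, hpV, hVT, hsrc⟩ := h.exists_isLocalFlow p
  have hτ0 : |(0 : ℝ)| < τ := by simpa using hτ
  filter_upwards [hα.eventually_contDiffAt p, extChartAt_source_mem_nhds (I := 𝓡 3) p,
    (continuousAt_extChartAt (I := 𝓡 3) p).preimage_mem_nhds (hl.isOpen.mem_nhds hpV)]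
    with q hq1 hq2 hq3 w
  set y := extChartAt (𝓡 3) p q with hy
  have ha : DifferentiableAt ℝ (coordForm α p) y := hq1.differentiableAt (by simp)
  have hY : DifferentiableAt ℝ (coordField X p) y :=
    ((contDiffOn_coordField h.field p).differentiableOn (by simp)).differentiableAt
      ((isOpen_extChartAt_target p).mem_nhds (hVT hq3))
  have hx0 : coordFlow φ p 0 y = y := hl.zero y hq3
  have h1 : HasDerivAt (fun t => coordForm α p (coordFlow φ p t y))
      (fderiv ℝ (coordForm α p) y (coordField X p y)) 0 := by
    have e := hl.hasDerivAt 0 hτ0 y hq3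
    rw [hx0] at e
    exact ha.hasFDerivAt.comp_hasDerivAt_of_eq 0 e hx0.symm
  have h2 := hl.hasDerivAt_fderiv hτ0 hq3 (dchart p q w)
  rw [hl.fderiv_zero hq3, hx0] at h2
  have h3 := h1.clm_apply h2
  rw [hl.fderiv_zero hq3, hx0] at h3
  have h4 : (fun z => coordForm α p z (coordField X p z)) =ᶠ[𝓝 y] fun _ => 0 := by
    filter_upwards [(isOpen_extChartAt_target p).mem_nhds (hVT hq3)] with z hz
    have hz' := (extChartAt (𝓡 3) p).map_target hz
    have e := coordForm_dchart α hz' (X ((extChartAt (𝓡 3) p).symm z))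
    rwa [(extChartAt (𝓡 3) p).right_inv hz, hαX] at e
  have h5 := (ha.hasFDerivAt.clm_apply hY.hasFDerivAt).unique
    ((hasFDerivAt_const (0 : ℝ) y).congr_of_eventuallyEq h4)
  have h6 := congrArg (fun l : E3 →L[ℝ] ℝ => l (dchart p q w)) h5
  simp only [add_apply, ContinuousLinearMap.comp_apply,
    ContinuousLinearMap.flip_apply, zero_apply] at h6
  have h7 : fderiv ℝ (coordForm α p) y (coordField X p y) (dchart p q w) +
      coordForm α p y (fderiv ℝ (coordField X p) y (dchart p q w)) = coordLie α X p q w := by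
    rw [coordLie]; linarith
  rw [h7] at h3
  refine h3.congr_of_eventuallyEq ?_
  filter_upwards [isOpen_Ioo.mem_nhds (abs_lt.1 hτ0)] with t ht
  have hs := hsrc t (abs_lt.2 ht) y hq3
  rw [hy, (extChartAt (𝓡 3) p).left_inv hq2] at hs
  rw [← coordForm_dchart α hs, h.dchart_push hq2 hs, coordFlow, hy,
    (extChartAt (𝓡 3) p).left_inv hq2]

/-- Cartan's formula for a 1-form that vanishes on the generator of a flow. -/
theorem IsDiffFlow.hasDerivAt_form_push (h : IsDiffFlow X φ) (hα : IsCnForm 1 α)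
    (hαX : ∀ p, α p (X p) = 0) (p : M) (w : TangentSpace (𝓡 3) p) :
    HasDerivAt (fun t => α (φ t p) (push φ t p w)) (dForm α p (X p) w) 0 := by
  rw [← hα.coordLie_self]
  exact (h.eventually_hasDerivAt_coordLie hα hαX p).self_of_nhds w

theorem IsDiffFlow.continuous_dForm (h : IsDiffFlow X φ) (hα : IsCnForm 1 α)
    (hαX : ∀ p, α p (X p) = 0) :
    Continuous (fun v : TangentBundle (𝓡 3) M => dForm α v.proj (X v.proj) v.snd) := by
  rw [continuous_iff_continuousAt]
  intro v
  have hp := mem_extChartAt_source (I := 𝓡 3) v.proj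
  have hψ : ContinuousAt (fun w : TangentBundle (𝓡 3) M => extChartAt (𝓡 3) v.proj w.proj) v :=
    ContinuousAt.comp (g := extChartAt (𝓡 3) v.proj) (continuousAt_extChartAt (I := 𝓡 3) v.proj)
      (continuousAt_proj v)
  have hY : ContinuousAt (fun w : TangentBundle (𝓡 3) M =>
      coordField X v.proj (extChartAt (𝓡 3) v.proj w.proj)) v :=
    ContinuousAt.comp (g := coordField X v.proj)
      ((contDiffOn_coordField h.field v.proj).continuousOn.continuousAt
        ((isOpen_extChartAt_target v.proj).mem_nhds (mem_extChartAt_target v.proj))) hψ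
  have hD : ContinuousAt (fun w : TangentBundle (𝓡 3) M =>
      fderiv ℝ (coordForm α v.proj) (extChartAt (𝓡 3) v.proj w.proj)) v :=
    ContinuousAt.comp (g := fderiv ℝ (coordForm α v.proj))
      ((isCnForm_iff.1 hα v.proj).continuousAt_fderiv (by simp)) hψ
  have hc : ContinuousAt (fun w : TangentBundle (𝓡 3) M => coordLie α X v.proj w.proj w.snd) v :=
    ((hD.clm_apply hY).clm_apply (continuousAt_dchart hp)).sub
      ((hD.clm_apply (continuousAt_dchart hp)).clm_apply hY)
  refine hc.congr ?_
  filter_upwards [(continuousAt_proj v).eventually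
    (h.eventually_hasDerivAt_coordLie hα hαX v.proj)] with w hw
  exact (hw w.snd).unique (h.hasDerivAt_form_push hα hαX w.proj w.snd)

end LieDerivative

section ParametricIntegral

/-- The integral of a function that is `C¹` in a parameter is `C¹` in this parameter. -/
theorem contDiffOn_intervalIntegral {E F : Type*} [NormedAddCommGroup E] [NormedSpace ℝ E]
    [NormedAddCommGroup F] [NormedSpace ℝ F] [CompleteSpace F]
    {f : ℝ → E → F} {f' : ℝ → E → E →L[ℝ] F} {U : Set E} (hU : IsOpen U)
    (hf : ContinuousOn (fun z : ℝ × E => f z.1 z.2) (Set.univ ×ˢ U))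
    (hf' : ContinuousOn (fun z : ℝ × E => f' z.1 z.2) (Set.univ ×ˢ U))
    (hd : ∀ t, ∀ y ∈ U, HasFDerivAt (f t) (f' t y) y) (a b : ℝ) :
    ContDiffOn ℝ 1 (fun y => ∫ t in a..b, f t y) U := by
  have hpath : ∀ y ∈ U, Continuous (fun t => f t y) := fun y hy =>
    hf.comp_continuous (f := fun t : ℝ => (t, y)) (by fun_prop) (fun t => ⟨trivial, hy⟩)
  have hpath' : ∀ y ∈ U, Continuous (fun t => f' t y) := fun y hy =>
    hf'.comp_continuous (f := fun t : ℝ => (t, y)) (by fun_prop) (fun t => ⟨trivial, hy⟩)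
  have hD : ∀ y ∈ U, HasFDerivAt (fun y => ∫ t in a..b, f t y) (∫ t in a..b, f' t y) y := by
    intro y hy
    have hb : ∀ᶠ z in 𝓝 y, ∀ t ∈ Set.uIcc a b, ‖f' t z‖ < ‖f' t y‖ + 1 := by
      refine isCompact_uIcc.eventually_forall_of_forall_eventually fun t _ => ?_
      have h1 := hf'.continuousAt ((isOpen_univ.prod hU).mem_nhds
        (show (t, y) ∈ Set.univ ×ˢ U from ⟨trivial, hy⟩))
      have h2 : ContinuousAt (fun z : E × ℝ => ‖f' z.2 z.1‖) (y, t) :=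
        (ContinuousAt.comp (f := fun z : E × ℝ => (z.2, z.1))
          (g := fun z : ℝ × E => f' z.1 z.2) h1 (by fun_prop)).norm
      have h3 : ContinuousAt (fun z : E × ℝ => ‖f' z.2 y‖ + 1) (y, t) :=
        (((hpath' y hy).comp continuous_snd).norm.add continuous_const).continuousAt
      exact h2.eventually_lt h3 (by simp)
    refine intervalIntegral.hasFDerivAt_integral_of_dominated_of_fderiv_le (𝕜 := ℝ)
      (F' := fun y t => f' t y) (bound := fun t => ‖f' t y‖ + 1)
      (hb.and (hU.mem_nhds hy)) ?_ ((hpath y hy).intervalIntegrable _ _)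
      (hpath' y hy).aestronglyMeasurable ?_ ?_ ?_
    · filter_upwards [hU.mem_nhds hy] with z hz using (hpath z hz).aestronglyMeasurable
    · exact Eventually.of_forall fun t ht z hz => (hz.1 t (Set.uIoc_subset_uIcc ht)).le
    · exact ((hpath' y hy).norm.add continuous_const).intervalIntegrable _ _
    · exact Eventually.of_forall fun t _ z hz => hd t z hz.2
  rw [show (1 : WithTop ℕ∞) = 0 + 1 from (zero_add 1).symm, contDiffOn_succ_iff_fderiv_of_isOpen hU]
  refine ⟨fun y hy => (hD y hy).differentiableAt.differentiableWithinAt, by simp, ?_⟩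
  rw [contDiffOn_zero]
  refine ContinuousOn.congr ?_ (fun y hy => (hD y hy).fderiv)
  rw [continuousOn_iff_continuous_domRestrict]
  refine intervalIntegral.continuous_parametric_intervalIntegral_of_continuous'
    (f := fun (y : U) t => f' t y) ?_ a b
  exact hf'.comp_continuous (f := fun z : U × ℝ => (z.2, (z.1 : E))) (by fun_prop)
    (fun z => ⟨trivial, z.1.2⟩)

theorem hasDerivAt_integral_comp_add {u : ℝ → ℝ} (hu : Continuous u) (T : ℝ) :
    HasDerivAt (fun s => ∫ t in (0 : ℝ)..T, u (t + s)) (u T - u 0) 0 := by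
  have h1 : HasDerivAt (fun s => ∫ t in (0 : ℝ)..(T + s), u t) (u T) 0 := by
    have h := intervalIntegral.integral_hasDerivAt_right (hu.intervalIntegrable 0 (T + 0))
      hu.stronglyMeasurable.stronglyMeasurableAtFilter hu.continuousAt
    simpa using h.comp_const_add T 0
  have h2 : HasDerivAt (fun s => ∫ t in (0 : ℝ)..s, u t) (u 0) 0 :=
    intervalIntegral.integral_hasDerivAt_right (hu.intervalIntegrable 0 0)
      hu.stronglyMeasurable.stronglyMeasurableAtFilter hu.continuousAt
  refine (h1.sub h2).congr_of_eventuallyEq (Eventually.of_forall fun s => ?_)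
  simp only [intervalIntegral.integral_comp_add_right, zero_add, Pi.sub_apply]
  rw [intervalIntegral.integral_interval_sub_left (hu.intervalIntegrable _ _)
    (hu.intervalIntegrable _ _)]

end ParametricIntegral

section Orbits

variable {M : Type*} [TopologicalSpace M] {φ : Flow ℝ M}

theorem continuous_orbit (φ : Flow ℝ M) {f : M → ℝ} (hf : Continuous f) (p : M) :
    Continuous (fun t => f (φ t p)) :=
  hf.comp (φ.continuous continuous_id continuous_const)

theorem hasDerivAt_along_flow {f k : M → ℝ}
    (hd : ∀ p, HasDerivAt (fun t => f (φ t p)) (k p) 0) (p : M) (t : ℝ) :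
    HasDerivAt (fun t => f (φ t p)) (k (φ t p)) t := by
  have h := hd (φ t p)
  have h2 := HasDerivAt.comp_sub_const t t (f := fun s => f (φ s (φ t p))) (f' := k (φ t p))
    (by simpa using h)
  simpa [← φ.map_add] using h2

end Orbits

section Averaging

variable {M : Type*} [TopologicalSpace M] [ChartedSpace E3 M] [IsManifold (𝓡 3) ∞ M]
  {X : VField M} {φ : Flow ℝ M}

theorem continuous_mfderiv_apply {F : M → ℝ} (hF : ContMDiff (𝓡 3) 𝓘(ℝ, ℝ) 1 F) :
    Continuous (fun v : TangentBundle (𝓡 3) M =>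
      (mfderiv (𝓡 3) 𝓘(ℝ, ℝ) F v.proj v.snd : ℝ)) :=
  (contMDiff_snd_tangentBundle_modelSpace ℝ 𝓘(ℝ, ℝ) (n := 1)).continuous.comp
    (hF.continuous_tangentMap le_rfl)

theorem IsDiffFlow.contMDiff_integral [CompactSpace M] (h : IsDiffFlow X φ) {F : M → ℝ}
    (hF : ContMDiff (𝓡 3) 𝓘(ℝ, ℝ) 1 F) (T : ℝ) :
    ContMDiff (𝓡 3) 𝓘(ℝ, ℝ) 1 (fun p => ∫ t in (0 : ℝ)..T, F (φ t p)) := by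
  intro p
  have hT := isOpen_extChartAt_target (I := 𝓡 3) p
  let f : ℝ → E3 → ℝ := fun t y => F (φ t ((extChartAt (𝓡 3) p).symm y))
  let f' : ℝ → E3 → E3 →L[ℝ] ℝ := fun t y =>
    (mfderiv (𝓡 3) 𝓘(ℝ, ℝ) F (φ t ((extChartAt (𝓡 3) p).symm y)) :
      TangentSpace (𝓡 3) (φ t ((extChartAt (𝓡 3) p).symm y)) →L[ℝ] ℝ).comp
      ((push φ t ((extChartAt (𝓡 3) p).symm y)).comp (dchartSymm p y))
  have hf : ContinuousOn (fun z : ℝ × E3 => f z.1 z.2)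
      (Set.univ ×ˢ (extChartAt (𝓡 3) p).target) := by
    refine (hF.continuous.comp φ.cont').comp_continuousOn
      (f := fun z : ℝ × E3 => (z.1, (extChartAt (𝓡 3) p).symm z.2)) ?_
    exact continuousOn_fst.prodMk ((continuousOn_extChartAt_symm p).comp continuousOn_snd
      (fun z hz => hz.2))
  have hf' : ContinuousOn (fun z : ℝ × E3 => f' z.1 z.2)
      (Set.univ ×ˢ (extChartAt (𝓡 3) p).target) := by
    rw [continuousOn_clm_apply]
    intro w
    refine ((continuous_mfderiv_apply hF).comp h.continuous_tangentMap).comp_continuousOn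
      (f := fun z : ℝ × E3 => (z.1, (⟨_, dchartSymm p z.2 w⟩ : TangentBundle (𝓡 3) M))) ?_
    exact continuousOn_fst.prodMk ((continuousOn_dchartSymm p).comp
      (f := fun z : ℝ × E3 => (z.2, w)) (by fun_prop) (fun z hz => ⟨hz.2, trivial⟩))
  have hd : ∀ t, ∀ y ∈ (extChartAt (𝓡 3) p).target, HasFDerivAt (f t) (f' t y) y := by
    intro t y hy
    exact (((hF.mdifferentiable one_ne_zero) _).hasMFDerivAt.comp y
      ((h.mdiff t _).hasMFDerivAt.comp y (hasMFDerivAt_chart_symm hy))).hasFDerivAt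
  have hI := contDiffOn_intervalIntegral hT hf hf' hd 0 T
  have h1 : ContMDiffAt (𝓡 3) 𝓘(ℝ, ℝ) 1 (fun q => ∫ t in (0 : ℝ)..T, f t (extChartAt (𝓡 3) p q)) p :=
    (hI.contDiffAt (hT.mem_nhds (mem_extChartAt_target p))).contMDiffAt.comp p
      ((contMDiffAt_extChartAt (n := ∞)).of_le (by exact_mod_cast le_top))
  refine h1.congr_of_eventuallyEq ?_
  filter_upwards [extChartAt_source_mem_nhds (I := 𝓡 3) p] with q hq
  simp only [f, (extChartAt (𝓡 3) p).left_inv hq]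

/-- A continuous function with a continuous derivative along the flow can be approximated by `C¹`
functions, together with its derivative along the flow. -/
theorem IsDiffFlow.exists_contMDiff_approx [CompactSpace M] [T2Space M] (h : IsDiffFlow X φ)
    {f k : M → ℝ} (hf : Continuous f) (hk : Continuous k)
    (hd : ∀ p, HasDerivAt (fun t => f (φ t p)) (k p) 0) {ε : ℝ} (hε : 0 < ε) :
    ∃ g l : M → ℝ, ContMDiff (𝓡 3) 𝓘(ℝ, ℝ) 1 g ∧
      (∀ p, HasDerivAt (fun t => g (φ t p)) (l p) 0) ∧
      (∀ p, |g p - f p| < ε) ∧ ∀ p, |l p - k p| < ε := by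
  have hev : ∀ u : M → ℝ, Continuous u → ∀ᶠ t : ℝ in 𝓝 0, ∀ p ∈ (Set.univ : Set M),
      |u (φ t p) - u p| < ε / 4 := by
    intro u hu
    refine isCompact_univ.eventually_forall_of_forall_eventually fun p _ => ?_
    have hc : Continuous (fun z : ℝ × M => |u (φ z.1 z.2) - u z.2|) :=
      ((hu.comp φ.cont').sub (hu.comp continuous_snd)).abs
    exact hc.continuousAt.eventually_lt_const (by simpa using hε)
  obtain ⟨r, hr, hball⟩ := Metric.eventually_nhds_iff_ball.1 ((hev f hf).and (hev k hk))
  obtain ⟨T, hT0, hT⟩ : ∃ T > 0, T < min r 1 := ⟨min r 1 / 2, by positivity, by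
    have : 0 < min r 1 := by positivity
    linarith⟩
  have hTr : ∀ t ∈ Set.uIoc 0 T, t ∈ Metric.ball (0 : ℝ) r := fun t ht => by
    rw [Set.uIoc_of_le hT0.le] at ht
    rw [mem_ball_zero_iff, Real.norm_eq_abs, abs_of_pos ht.1]
    exact ht.2.trans_lt (hT.trans_le (min_le_left _ _))
  have hT1 : T < 1 := hT.trans_le (min_le_right _ _)
  obtain ⟨F, hFf, -⟩ := hf.exists_contMDiff_approx (𝓡 3) (⊤ : ℕ∞)
    (ε := fun _ => ε * T / 8) continuous_const (fun _ => by positivity)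
  have hF1 : ContMDiff (𝓡 3) 𝓘(ℝ, ℝ) 1 F := F.contMDiff.of_le (by exact_mod_cast le_top)
  have hFf' : ∀ p, |F p - f p| < ε * T / 8 := fun p => by simpa [Real.dist_eq] using hFf p
  have hFc := hF1.continuous
  refine ⟨fun p => T⁻¹ * ∫ t in (0 : ℝ)..T, F (φ t p), fun p => T⁻¹ * (F (φ T p) - F p), ?_, ?_,
    ?_, ?_⟩
  · exact contMDiff_const.mul (h.contMDiff_integral hF1 T)
  · intro p
    have := (hasDerivAt_integral_comp_add (continuous_orbit φ hFc p) T).const_mul T⁻¹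
    simpa only [φ.map_add, φ.map_zero_apply] using this
  · intro p
    have hi := (continuous_orbit φ hFc p).intervalIntegrable (μ := MeasureTheory.volume) 0 T
    have e : T⁻¹ * (∫ t in (0 : ℝ)..T, F (φ t p)) - f p =
        T⁻¹ * ∫ t in (0 : ℝ)..T, (F (φ t p) - f p) := by
      rw [intervalIntegral.integral_sub hi intervalIntegrable_const,
        intervalIntegral.integral_const]
      simp only [sub_zero, smul_eq_mul]
      field_simp
    have hb := intervalIntegral.norm_integral_le_of_norm_le_const (a := 0) (b := T)
      (f := fun t => F (φ t p) - f p) (C := ε / 2) (fun t ht => by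
        have h1 := abs_lt.1 ((hball t (hTr t ht)).1 p trivial)
        have h2 := abs_lt.1 (hFf' (φ t p))
        have h3 : ε * T / 8 ≤ ε / 8 := by nlinarith
        rw [Real.norm_eq_abs, abs_le]
        constructor <;> linarith [h1.1, h1.2, h2.1, h2.2])
    rw [sub_zero, abs_of_pos hT0, Real.norm_eq_abs] at hb
    rw [e, abs_mul, abs_of_pos (inv_pos.2 hT0), inv_mul_lt_iff₀ hT0]
    nlinarith
  · intro p
    have hi := (continuous_orbit φ hk p).intervalIntegrable (μ := MeasureTheory.volume) 0 T
    have hftc : ∫ t in (0 : ℝ)..T, k (φ t p) = f (φ T p) - f p := by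
      rw [intervalIntegral.integral_eq_sub_of_hasDerivAt
        (fun t _ => hasDerivAt_along_flow hd p t) hi, φ.map_zero_apply]
    have e : T⁻¹ * (f (φ T p) - f p) - k p = T⁻¹ * ∫ t in (0 : ℝ)..T, (k (φ t p) - k p) := by
      rw [intervalIntegral.integral_sub hi intervalIntegrable_const,
        intervalIntegral.integral_const, hftc]
      simp only [sub_zero, smul_eq_mul]
      field_simp
    have hb := intervalIntegral.norm_integral_le_of_norm_le_const (a := 0) (b := T)
      (f := fun t => k (φ t p) - k p) (C := ε / 4) (fun t ht =>
        ((hball t (hTr t ht)).2 p trivial).le)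
    rw [sub_zero, abs_of_pos hT0, Real.norm_eq_abs] at hb
    have e1 : |T⁻¹ * (f (φ T p) - f p) - k p| ≤ ε / 4 := by
      rw [e, abs_mul, abs_of_pos (inv_pos.2 hT0), inv_mul_le_iff₀ hT0]
      linarith
    have e2 : |T⁻¹ * (F (φ T p) - F p) - T⁻¹ * (f (φ T p) - f p)| ≤ ε / 4 := by
      rw [← mul_sub, abs_mul, abs_of_pos (inv_pos.2 hT0), inv_mul_le_iff₀ hT0]
      have h1 := abs_lt.1 (hFf' (φ T p))
      have h2 := abs_lt.1 (hFf' p)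
      rw [abs_le]
      constructor <;> linarith [h1.1, h1.2, h2.1, h2.2]
    calc |T⁻¹ * (F (φ T p) - F p) - k p|
        ≤ |T⁻¹ * (F (φ T p) - F p) - T⁻¹ * (f (φ T p) - f p)| +
          |T⁻¹ * (f (φ T p) - f p) - k p| := abs_sub_le _ _ _
      _ < ε := by linarith

end Averaging

section Frames

variable {M : Type*} [TopologicalSpace M] [ChartedSpace E3 M]

instance (p : M) : FiniteDimensional ℝ (TangentSpace (𝓡 3) p) :=
  inferInstanceAs (FiniteDimensional ℝ E3)

instance (p : M) : T2Space (TangentSpace (𝓡 3) p) :=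
  inferInstanceAs (T2Space E3)

theorem finrank_tangentSpace (p : M) : Module.finrank ℝ (TangentSpace (𝓡 3) p) = 3 :=
  finrank_euclideanSpace_fin (𝕜 := ℝ) (n := 3)

/-- The standard determinant on `E3`. -/
def det3 : E3 [⋀^Fin 3]→ₗ[ℝ] ℝ := (EuclideanSpace.basisFun (Fin 3) ℝ).toBasis.det

theorem continuousAt_det3 {Z : Type*} [TopologicalSpace Z] {w : Fin 3 → Z → E3} {z : Z}
    (hw : ∀ i, ContinuousAt (w i) z) : ContinuousAt (fun z => det3 (fun i => w i z)) z := by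
  simp only [det3, Module.Basis.det_apply, Matrix.det_fin_three, Module.Basis.toMatrix_apply,
    OrthonormalBasis.coe_toBasis_repr_apply, EuclideanSpace.basisFun_repr]
  have h : ∀ i j, ContinuousAt (fun z => w i z j) z := fun i j =>
    (PiLp.continuous_apply 2 (fun _ : Fin 3 => ℝ) j).continuousAt.comp (hw i)
  have := fun i j => h i j
  fun_prop

theorem det3_ne_zero {w : Fin 3 → E3} (hw : LinearIndependent ℝ w) : det3 w ≠ 0 := by
  have := (Module.Basis.is_basis_iff_det (EuclideanSpace.basisFun (Fin 3) ℝ).toBasis).1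
    ⟨hw, hw.span_eq_top_of_card_eq_finrank' (by simp)⟩
  exact this.ne_zero

theorem det3_update_sum (w : Fin 3 → E3) (c : Fin 3 → ℝ) (i : Fin 3) :
    det3 (Function.update w i (∑ j, c j • w j)) = c i * det3 w := by
  rw [AlternatingMap.map_update_sum]
  simp only [AlternatingMap.map_update_smul, smul_eq_mul]
  rw [Finset.sum_eq_single i]
  · simp
  · intro j _ hj
    rw [AlternatingMap.map_update_self _ _ hj.symm, mul_zero]
  · simp

variable [IsManifold (𝓡 3) ∞ M]

/-- A continuous global frame of `TM`. -/
structure IsFrame (e : Fin 3 → VField M) : Prop where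
  cont : ∀ i, ContinuousVFieldOn (e i) Set.univ
  indep : ∀ p, LinearIndependent ℝ (fun i => e i p)

theorem ContinuousVFieldOn.continuous {Y : VField M} (hY : ContinuousVFieldOn Y Set.univ) :
    Continuous (fun p : M => (⟨p, Y p⟩ : TangentBundle (𝓡 3) M)) :=
  continuousOn_univ.1 hY

theorem linearIndependent_dchart {e : Fin 3 → VField M} {p q : M}
    (hq : q ∈ (extChartAt (𝓡 3) p).source) (h : LinearIndependent ℝ (fun i => e i q)) :
    LinearIndependent ℝ (fun i => dchart p q (e i q)) :=
  h.map' (dchart p q).toLinearMap (LinearMap.ker_eq_bot.2 (dchart_injective hq))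

namespace IsFrame

variable {e : Fin 3 → VField M} (h : IsFrame e)

/-- The basis of the tangent space given by a frame. -/
def basis (p : M) : Module.Basis (Fin 3) ℝ (TangentSpace (𝓡 3) p) :=
  basisOfLinearIndependentOfCardEqFinrank (h.indep p) (by rw [finrank_tangentSpace]; simp)

@[simp] theorem basis_apply (p : M) (i : Fin 3) : h.basis p i = e i p := by
  simp [basis]

theorem coe_basis (p : M) : ⇑(h.basis p) = fun i => e i p := funext (h.basis_apply p)

/-- The dual coframe of a frame. -/
def dual (i : Fin 3) : OneForm M := fun p => LinearMap.toContinuousLinearMap ((h.basis p).coord i)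

theorem dual_apply (i : Fin 3) (p : M) (v : TangentSpace (𝓡 3) p) :
    h.dual i p v = (h.basis p).repr v i := rfl

theorem dual_self (i j : Fin 3) (p : M) : h.dual i p (e j p) = if i = j then 1 else 0 := by
  rw [dual_apply, ← h.basis_apply, Module.Basis.repr_self, Finsupp.single_apply]
  simp [eq_comm]

theorem sum_dual (p : M) (v : TangentSpace (𝓡 3) p) :
    v = h.dual 0 p v • e 0 p + h.dual 1 p v • e 1 p + h.dual 2 p v • e 2 p := by
  conv_lhs => rw [← (h.basis p).sum_repr v, Fin.sum_univ_three]
  simp [dual_apply]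

include h in
theorem continuousAt_dchart_frame (i : Fin 3) {p : M} {v : TangentBundle (𝓡 3) M}
    (hv : v.proj ∈ (extChartAt (𝓡 3) p).source) :
    ContinuousAt (fun w : TangentBundle (𝓡 3) M => dchart p w.proj (e i w.proj)) v :=
  ContinuousAt.comp (g := fun w : TangentBundle (𝓡 3) M => dchart p w.proj w.snd)
    (f := fun w : TangentBundle (𝓡 3) M => (⟨w.proj, e i w.proj⟩ : TangentBundle (𝓡 3) M))
    (continuousAt_dchart hv)
    ((h.cont i).continuous.continuousAt.comp (continuousAt_proj v))

theorem dual_eq (i : Fin 3) {p q : M} (hq : q ∈ (extChartAt (𝓡 3) p).source)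
    (v : TangentSpace (𝓡 3) q) :
    h.dual i q v = det3 (fun j => Function.update (fun j => dchart p q (e j q)) i
      (dchart p q v) j) / det3 (fun j => dchart p q (e j q)) := by
  rw [eq_div_iff (det3_ne_zero (linearIndependent_dchart hq (h.indep q)))]
  rw [← det3_update_sum _ (fun j => h.dual j q v), Fin.sum_univ_three]
  congr 2
  conv_rhs => rw [h.sum_dual q v]
  simp only [map_add, map_smul]

theorem isCnForm_dual (i : Fin 3) : IsCnForm 0 (h.dual i) := by
  rw [isCnForm_zero_iff, continuous_iff_continuousAt]
  intro v
  have hp := mem_extChartAt_source (I := 𝓡 3) v.proj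
  have hc : ContinuousAt (fun w : TangentBundle (𝓡 3) M =>
      det3 (fun j => Function.update (fun j => dchart v.proj w.proj (e j w.proj)) i
      (dchart v.proj w.proj w.snd) j) / det3 (fun j => dchart v.proj w.proj (e j w.proj))) v := by
    refine ContinuousAt.div (continuousAt_det3 fun j => ?_)
      (continuousAt_det3 fun j => h.continuousAt_dchart_frame j hp)
      (det3_ne_zero (linearIndependent_dchart hp (h.indep _)))
    by_cases hij : j = i
    · subst hij
      simpa using continuousAt_dchart hp
    · simpa [hij] using h.continuousAt_dchart_frame j hp
  refine hc.congr ?_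
  filter_upwards [(continuousAt_proj v).preimage_mem_nhds
    ((isOpen_extChartAt_source v.proj).mem_nhds hp)] with w hw
  exact (h.dual_eq i hw w.snd).symm

end IsFrame

end Frames

section Alternating

variable {M : Type*} [TopologicalSpace M] [ChartedSpace E3 M]

theorem det3_dchart_eq {p q : M} (b : Module.Basis (Fin 3) ℝ (TangentSpace (𝓡 3) q))
    (w : Fin 3 → TangentSpace (𝓡 3) q) :
    det3 (fun i => dchart p q (w i)) = det3 (fun i => dchart p q (b i)) * b.det w := by
  have := AlternatingMap.eq_smul_basis_det b (det3.compLinearMap (dchart p q).toLinearMap)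
  exact congrArg (fun f => f w) this

/-- The 3-form is given by alternating maps. -/
def IsAlternating (Ω : ThreeForm M) : Prop :=
  ∀ p, ∃ A : (TangentSpace (𝓡 3) p) [⋀^Fin 3]→ₗ[ℝ] ℝ, ∀ v, Ω p v = A v

theorem isAlternating_zero : IsAlternating (0 : ThreeForm M) := fun _ => ⟨0, fun _ => rfl⟩

theorem IsAlternating.scale {Ω : ThreeForm M} (h : IsAlternating Ω) (δ : M → ℝ) :
    IsAlternating (scale δ Ω) := fun p =>
  let ⟨A, hA⟩ := h p
  ⟨δ p • A, fun v => by simp [BiContact.scale, hA]⟩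

theorem isAlternating_wedge3 (α β γ : OneForm M) : IsAlternating (wedge3 α β γ) := fun p => by
  refine ⟨Matrix.detRowAlternating.compLinearMap
    (LinearMap.pi ![(α p).toLinearMap, (β p).toLinearMap, (γ p).toLinearMap]), fun v => ?_⟩
  rw [wedge3, ← Matrix.det_transpose]
  refine congrArg Matrix.det ?_
  ext i j
  fin_cases i <;> fin_cases j <;> rfl

theorem IsAlternating.eq_mul_det {Ω : ThreeForm M} (h : IsAlternating Ω) {p : M}
    (b : Module.Basis (Fin 3) ℝ (TangentSpace (𝓡 3) p)) (v : Fin 3 → TangentSpace (𝓡 3) p) :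
    Ω p v = Ω p b * b.det v := by
  obtain ⟨A, hA⟩ := h p
  rw [hA, hA]
  exact congrArg (fun f => f v) (AlternatingMap.eq_smul_basis_det b A)

end Alternating

section Orientation

variable {M : Type*} [TopologicalSpace M] [ChartedSpace E3 M] [IsManifold (𝓡 3) ∞ M]

/-- Whether a global frame is positively oriented is locally constant. -/
theorem IsFrame.isLocallyConstant_orientation {e : Fin 3 → VField M} (h : IsFrame e)
    (o : ManifoldOrientation M) :
    IsLocallyConstant (fun p => (h.basis p).orientation = o.at_point p) := by
  rw [IsLocallyConstant.iff_eventually_eq]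
  intro p
  obtain ⟨U, hU, e', hc, hb⟩ := o.continuous_frame p
  have hp := mem_extChartAt_source (I := 𝓡 3) p
  have h1 : ContinuousAt (fun q => det3 (fun i => dchart p q (e i q))) p :=
    continuousAt_det3 fun i => ContinuousAt.comp (g := fun w : TangentBundle (𝓡 3) M =>
      dchart p w.proj w.snd) (f := fun q => (⟨q, e i q⟩ : TangentBundle (𝓡 3) M))
      (continuousAt_dchart hp) (h.cont i).continuous.continuousAt
  have h2 : ContinuousAt (fun q => det3 (fun i => dchart p q (e' i q))) p :=
    continuousAt_det3 fun i => ContinuousAt.comp (g := fun w : TangentBundle (𝓡 3) M =>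
      dchart p w.proj w.snd) (f := fun q => (⟨q, e' i q⟩ : TangentBundle (𝓡 3) M))
      (continuousAt_dchart hp) ((hc i).continuousAt hU)
  have key : ∀ q ∈ U ∩ (extChartAt (𝓡 3) p).source,
      ((h.basis q).orientation = o.at_point q ↔
        0 < det3 (fun i => dchart p q (e i q)) * det3 (fun i => dchart p q (e' i q))) ∧
      det3 (fun i => dchart p q (e i q)) * det3 (fun i => dchart p q (e' i q)) ≠ 0 := by
    rintro q ⟨hqU, hq⟩
    obtain ⟨b, hbe, hbo⟩ := hb q hqU
    have hD := det3_dchart_eq (p := p) b (fun i => e i q)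
    have hne := det3_ne_zero (linearIndependent_dchart hq (h.indep q))
    rw [hbe] at hD
    simp only at hD
    set D' := det3 (fun i => dchart p q (e' i q)) with hD'
    have hD0 : D' ≠ 0 := fun h0 => hne (by rw [hD, h0, zero_mul])
    constructor
    · rw [← hbo, eq_comm, Module.Basis.orientation_eq_iff_det_pos, h.coe_basis, hD]
      rw [show D' * b.det (fun i => e i q) * D' = b.det (fun i => e i q) * (D' * D') by ring]
      exact (mul_pos_iff_of_pos_right (mul_self_pos.2 hD0)).symm
    · exact mul_ne_zero hne hD0
  have hpU : p ∈ U ∩ (extChartAt (𝓡 3) p).source := ⟨mem_of_mem_nhds hU, hp⟩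
  obtain ⟨hk1, hk2⟩ := key p hpU
  have hmem : U ∩ (extChartAt (𝓡 3) p).source ∈ 𝓝 p :=
    inter_mem hU (extChartAt_source_mem_nhds p)
  rcases lt_or_gt_of_ne hk2 with h0 | h0
  · filter_upwards [(h1.mul h2).eventually_lt_const h0, hmem] with q hq1 hq2
    simp only [eq_iff_iff, (key q hq2).1, hk1, not_lt.2 h0.le, iff_false, not_lt]
    exact hq1.le
  · filter_upwards [(h1.mul h2).eventually_const_lt h0, hmem] with q hq1 hq2
    simp only [eq_iff_iff, (key q hq2).1, hk1, h0, iff_true]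
    exact hq1

omit [IsManifold (𝓡 3) ∞ M] in
theorem isAlternating_contactVolume (α : OneForm M) : IsAlternating (contactVolume α) := fun p => by
  set D := extDeriv (fun y : E3 => ContinuousAlternatingMap.ofSubsingleton ℝ E3 ℝ (0 : Fin 1)
    (coordForm α p y)) (extChartAt (𝓡 3) p p) with hD
  refine ⟨AlternatingMap.alternatizeUncurryFin (n := 2) ((α p).toLinearMap.smulRight
    (D.toAlternatingMap.compLinearMap (dchart p p).toLinearMap)), fun v => ?_⟩
  have hv : ∀ a : Fin 3, D.toAlternatingMap.compLinearMap (dchart p p).toLinearMap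
      (Fin.removeNth a v) = dForm α p (v (a.succAbove 0)) (v (a.succAbove 1)) := by
    intro a
    refine congrArg D ?_
    ext i
    fin_cases i <;> rfl
  rw [AlternatingMap.alternatizeUncurryFin_apply, Fin.sum_univ_three]
  simp only [LinearMap.smulRight_apply, AlternatingMap.smul_apply, hv]
  simp only [contactVolume]
  simp [show Fin.succAbove (2 : Fin 3) (1 : Fin 2) = 1 from rfl, sub_eq_add_neg]

theorem threeFormLT_of_frame {o : ManifoldOrientation M} {Ω₁ Ω₂ : ThreeForm M}
    (h₁ : IsAlternating Ω₁) (h₂ : IsAlternating Ω₂)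
    {B : ∀ p : M, Module.Basis (Fin 3) ℝ (TangentSpace (𝓡 3) p)}
    (hB : ∀ p, (B p).orientation = o.at_point p) (h : ∀ p, Ω₁ p (B p) < Ω₂ p (B p)) :
    ThreeFormLT o Ω₁ Ω₂ := by
  intro p b hb
  rw [h₁.eq_mul_det (B p), h₂.eq_mul_det (B p)]
  have : 0 < (B p).det b := by
    rw [← Module.Basis.orientation_eq_iff_det_pos, hB, hb]
  exact mul_lt_mul_of_pos_right (h p) this

end Orientation

section SplitFrame

variable {M : Type*} [TopologicalSpace M] [ChartedSpace E3 M] [IsManifold (𝓡 3) ∞ M]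

/-- A continuous frame `(e₀, e₁, X)` such that `e₀` and `X` span `Es`, and `e₁` and `X` span `Eu`,
where `Es`, `Eu` are invariant under the flow of `X`. -/
structure IsSplitFrame (X : VField M) (φ : Flow ℝ M) (Es Eu : Distribution M)
    (e : Fin 3 → VField M) : Prop extends IsFrame e where
  two : e 2 = X
  flow : IsDiffFlow X φ
  mem_s : ∀ p v, v ∈ Es p ↔ toIsFrame.dual 1 p v = 0
  mem_u : ∀ p v, v ∈ Eu p ↔ toIsFrame.dual 0 p v = 0
  inv_s : IsInvariantField φ Es
  inv_u : IsInvariantField φ Eu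

theorem IsDominatedSplitting.isSplitFrame {X : VField M} {φ : Flow ℝ M} {Es Eu : Distribution M}
    (h : IsDominatedSplitting X φ Es Eu) (hX : IsCnVField 1 X) (hX0 : ∀ p, X p ≠ 0)
    (hφ : IsFlowOf X φ) {es eu : VField M}
    (hs : ContinuousVFieldOn es Set.univ) (hs' : ∀ p, es p ∈ Es p ∧ es p ∉ lineField X p)
    (hu : ContinuousVFieldOn eu Set.univ) (hu' : ∀ p, eu p ∈ Eu p ∧ eu p ∉ lineField X p) :
    IsSplitFrame X φ Es Eu ![es, eu, X] := by
  have hflow := h.isDiffFlow hX hφ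
  obtain ⟨-, -, hinf, -, hi1, hi2, -⟩ := h
  have hXmem : ∀ p, X p ∈ Es p ⊓ Eu p := fun p => by
    rw [hinf p]; exact Submodule.mem_span_singleton_self _
  have key1 : ∀ p (a : ℝ), a • es p ∈ Eu p → a = 0 := by
    intro p a ha
    by_contra h0
    refine (hs' p).2 ?_
    rw [← hinf p]
    exact ⟨(hs' p).1, ((Eu p).smul_mem_iff h0).1 ha⟩
  have key2 : ∀ p (a : ℝ), a • eu p ∈ Es p → a = 0 := by
    intro p a ha
    by_contra h0
    refine (hu' p).2 ?_
    rw [← hinf p]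
    exact ⟨((Es p).smul_mem_iff h0).1 ha, (hu' p).1⟩
  have hli : ∀ p, LinearIndependent ℝ (fun i => (![es, eu, X] : Fin 3 → VField M) i p) := by
    intro p
    rw [Fintype.linearIndependent_iff]
    intro g hg
    rw [Fin.sum_univ_three] at hg
    simp only [Matrix.cons_val] at hg
    have h0 : g 0 = 0 := by
      refine key1 p _ ?_
      have : g 0 • es p = -(g 1 • eu p + g 2 • X p) := by
        rw [eq_neg_iff_add_eq_zero, ← add_assoc, hg]
      rw [this]
      exact (Eu p).neg_mem ((Eu p).add_mem ((Eu p).smul_mem _ (hu' p).1)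
        ((Eu p).smul_mem _ (hXmem p).2))
    have h1 : g 1 = 0 := by
      refine key2 p _ ?_
      have : g 1 • eu p = -(g 0 • es p + g 2 • X p) := by
        rw [eq_neg_iff_add_eq_zero, ← hg]; abel
      rw [this]
      exact (Es p).neg_mem ((Es p).add_mem ((Es p).smul_mem _ (hs' p).1)
        ((Es p).smul_mem _ (hXmem p).1))
    have h2 : g 2 = 0 := by
      rw [h0, h1, zero_smul, zero_smul, zero_add, zero_add] at hg
      exact (smul_eq_zero.1 hg).resolve_right (hX0 p)
    intro i
    fin_cases i
    · exact h0
    · exact h1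
    · exact h2
  have hfr : IsFrame ![es, eu, X] := by
    refine ⟨fun i => ?_, hli⟩
    fin_cases i
    · exact hs
    · exact hu
    · exact (ContMDiff.continuous hX).continuousOn
  refine ⟨hfr, rfl, hflow, fun p v => ?_, fun p v => ?_, hi1, hi2⟩
  · have hv := hfr.sum_dual p v
    simp only [Matrix.cons_val] at hv
    constructor
    · intro hvm
      refine key2 p _ ?_
      have : hfr.dual 1 p v • eu p = v - (hfr.dual 0 p v • es p + hfr.dual 2 p v • X p) := by
        rw [eq_sub_iff_add_eq]; nth_rw 4 [hv]; abel
      rw [this]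
      exact (Es p).sub_mem hvm ((Es p).add_mem ((Es p).smul_mem _ (hs' p).1)
        ((Es p).smul_mem _ (hXmem p).1))
    · intro h0
      rw [hv, h0, zero_smul, add_zero]
      exact (Es p).add_mem ((Es p).smul_mem _ (hs' p).1) ((Es p).smul_mem _ (hXmem p).1)
  · have hv := hfr.sum_dual p v
    simp only [Matrix.cons_val] at hv
    constructor
    · intro hvm
      refine key1 p _ ?_
      have : hfr.dual 0 p v • es p = v - (hfr.dual 1 p v • eu p + hfr.dual 2 p v • X p) := by
        rw [eq_sub_iff_add_eq]; nth_rw 4 [hv]; abel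
      rw [this]
      exact (Eu p).sub_mem hvm ((Eu p).add_mem ((Eu p).smul_mem _ (hu' p).1)
        ((Eu p).smul_mem _ (hXmem p).2))
    · intro h0
      rw [hv, h0, zero_smul, zero_add]
      exact (Eu p).add_mem ((Eu p).smul_mem _ (hu' p).1) ((Eu p).smul_mem _ (hXmem p).2)

namespace IsSplitFrame

variable {X : VField M} {φ : Flow ℝ M} {Es Eu : Distribution M} {e : Fin 3 → VField M}
  (h : IsSplitFrame X φ Es Eu e)

/-- The multiplier of the flow on `⟨e i, X⟩/⟨X⟩`. -/
def mult (i : Fin 3) (t : ℝ) (p : M) : ℝ := h.dual i (φ t p) (push φ t p (e i p))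

/-- The component along `X` of the image of `e i` under the flow. -/
def shear (i : Fin 3) (t : ℝ) (p : M) : ℝ := h.dual 2 (φ t p) (push φ t p (e i p))

include h in
theorem push_X (t : ℝ) (p : M) : push φ t p (e 2 p) = e 2 (φ t p) := by
  rw [h.two, h.flow.push_field]

include h in
theorem mem_s_zero (p : M) : e 0 p ∈ Es p := by rw [h.mem_s, h.dual_self]; simp

include h in
theorem mem_u_one (p : M) : e 1 p ∈ Eu p := by rw [h.mem_u, h.dual_self]; simp

theorem push_frame {i : Fin 3} (hi : i ≠ 2) (t : ℝ) (p : M) :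
    push φ t p (e i p) = h.mult i t p • e i (φ t p) + h.shear i t p • e 2 (φ t p) := by
  have h0 := h.sum_dual (φ t p) (push φ t p (e i p))
  fin_cases i
  · have : push φ t p (e 0 p) ∈ Es (φ t p) := by
      rw [← h.inv_s t p]; exact Submodule.mem_map_of_mem (h.mem_s_zero p)
    rw [h.mem_s] at this
    refine h0.trans ?_
    simp [this, mult, shear]
  · have : push φ t p (e 1 p) ∈ Eu (φ t p) := by
      rw [← h.inv_u t p]; exact Submodule.mem_map_of_mem (h.mem_u_one p)
    rw [h.mem_u] at this
    refine h0.trans ?_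
    simp [this, mult, shear]
  · exact absurd rfl hi

theorem dual_push {i : Fin 3} (hi : i ≠ 2) (t : ℝ) (p : M) (v : TangentSpace (𝓡 3) p) :
    h.dual i (φ t p) (push φ t p v) = h.mult i t p * h.dual i p v := by
  conv_lhs => rw [h.sum_dual p v]
  simp only [map_add, map_smul, h.push_X, h.push_frame (show (0 : Fin 3) ≠ 2 by decide),
    h.push_frame (show (1 : Fin 3) ≠ 2 by decide), h.dual_self, smul_eq_mul]
  fin_cases i
  · simp [mul_comm]
  · simp [mul_comm]
  · exact absurd rfl hi

theorem mult_zero (i : Fin 3) (p : M) : h.mult i 0 p = 1 := by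
  have := congrArg (fun v : TangentBundle (𝓡 3) M => h.dual i v.proj v.snd)
    (tangentMap_zero φ ⟨p, e i p⟩)
  exact this.trans (by simp [h.dual_self])

theorem mult_add {i : Fin 3} (hi : i ≠ 2) (s t : ℝ) (p : M) :
    h.mult i (s + t) p = h.mult i t p * h.mult i s (φ t p) := by
  have := congrArg (fun v : TangentBundle (𝓡 3) M => h.dual i v.proj v.snd)
    (h.flow.tangentMap_add s t ⟨p, e i p⟩)
  refine this.trans ((h.dual_push hi s (φ t p) _).trans ?_)
  rw [mul_comm]; rfl

theorem shear_add {i : Fin 3} (hi : i ≠ 2) (s t : ℝ) (p : M) :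
    h.shear i (s + t) p = h.mult i t p * h.shear i s (φ t p) + h.shear i t p := by
  have := congrArg (fun v : TangentBundle (𝓡 3) M => h.dual 2 v.proj v.snd)
    (h.flow.tangentMap_add s t ⟨p, e i p⟩)
  refine this.trans (show h.dual 2 _ (push φ s (φ t p) (push φ t p (e i p))) = _ from ?_)
  rw [h.push_frame hi, map_add, map_smul, map_smul, h.push_X, map_add, map_smul, map_smul,
    h.dual_self]
  simp [shear]

theorem mult_mul_neg {i : Fin 3} (hi : i ≠ 2) (t : ℝ) (p : M) :
    h.mult i t p * h.mult i (-t) (φ t p) = 1 := by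
  rw [← h.mult_add hi, neg_add_cancel, h.mult_zero]

theorem mult_ne_zero {i : Fin 3} (hi : i ≠ 2) (t : ℝ) (p : M) : h.mult i t p ≠ 0 :=
  left_ne_zero_of_mul (by rw [h.mult_mul_neg hi t p]; exact one_ne_zero)

include h in
theorem continuous_push_frame [CompactSpace M] (i : Fin 3) : Continuous (fun z : ℝ × M =>
    (⟨φ z.1 z.2, push φ z.1 z.2 (e i z.2)⟩ : TangentBundle (𝓡 3) M)) :=
  Continuous.comp
    (g := fun z : ℝ × TangentBundle (𝓡 3) M => tangentMap (𝓡 3) (𝓡 3) (φ z.1) z.2)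
    (f := fun z : ℝ × M => (z.1, (⟨z.2, e i z.2⟩ : TangentBundle (𝓡 3) M)))
    h.flow.continuous_tangentMap
    (continuous_fst.prodMk ((h.cont i).continuous.comp continuous_snd))

theorem continuous_mult [CompactSpace M] (i : Fin 3) :
    Continuous (fun z : ℝ × M => h.mult i z.1 z.2) :=
  Continuous.comp (g := fun v : TangentBundle (𝓡 3) M => h.dual i v.proj v.snd)
    (f := fun z : ℝ × M => (⟨φ z.1 z.2, push φ z.1 z.2 (e i z.2)⟩ : TangentBundle (𝓡 3) M))
    (isCnForm_zero_iff.1 (h.isCnForm_dual i)) (h.continuous_push_frame i)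

theorem continuous_shear [CompactSpace M] (i : Fin 3) :
    Continuous (fun z : ℝ × M => h.shear i z.1 z.2) :=
  Continuous.comp (g := fun v : TangentBundle (𝓡 3) M => h.dual 2 v.proj v.snd)
    (f := fun z : ℝ × M => (⟨φ z.1 z.2, push φ z.1 z.2 (e i z.2)⟩ : TangentBundle (𝓡 3) M))
    (isCnForm_zero_iff.1 (h.isCnForm_dual 2)) (h.continuous_push_frame i)

theorem mult_pos [CompactSpace M] {i : Fin 3} (hi : i ≠ 2) (t : ℝ) (p : M) : 0 < h.mult i t p := by
  by_contra hneg
  have hc : Continuous (fun t => h.mult i t p) :=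
    Continuous.comp (g := fun z : ℝ × M => h.mult i z.1 z.2) (f := fun t : ℝ => (t, p))
      (h.continuous_mult i) (continuous_id.prodMk continuous_const)
  have h0 : (0 : ℝ) ∈ Set.range (fun t => h.mult i t p) :=
    mem_range_of_exists_le_of_exists_ge hc ⟨t, not_lt.1 hneg⟩
      ⟨0, zero_le_one.trans_eq (h.mult_zero i p).symm⟩
  obtain ⟨s, hs⟩ := h0
  exact h.mult_ne_zero hi s p hs

variable {α : OneForm M}

theorem form_push (hαX : ∀ p, α p (X p) = 0) {i : Fin 3} (hi : i ≠ 2) (t : ℝ) (p : M) :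
    α (φ t p) (push φ t p (e i p)) = h.mult i t p * α (φ t p) (e i (φ t p)) := by
  rw [h.push_frame hi, map_add, map_smul, map_smul, h.two, hαX]
  simp

theorem form_eq (hαX : ∀ p, α p (X p) = 0) (p : M) (v : TangentSpace (𝓡 3) p) :
    α p v = h.dual 0 p v * α p (e 0 p) + h.dual 1 p v * α p (e 1 p) := by
  conv_lhs => rw [h.sum_dual p v]
  rw [map_add, map_add, map_smul, map_smul, map_smul, h.two, hαX]
  simp

theorem hasDerivAt_mult_mul_form (hα : IsCnForm 1 α) (hαX : ∀ p, α p (X p) = 0) {i : Fin 3}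
    (hi : i ≠ 2) (p : M) (t : ℝ) :
    HasDerivAt (fun t => h.mult i t p * α (φ t p) (e i (φ t p)))
      (h.mult i t p * dForm α (φ t p) (X (φ t p)) (e i (φ t p))) t := by
  have h1 := (h.flow.hasDerivAt_form_push hα hαX (φ t p) (e i (φ t p))).const_mul (h.mult i t p)
  have h2 := HasDerivAt.comp_sub_const t t (f := fun s => h.mult i t p *
    α (φ s (φ t p)) (push φ s (φ t p) (e i (φ t p)))) (by simpa using h1)
  refine h2.congr_of_eventuallyEq (Eventually.of_forall fun s => ?_)
  simp only
  rw [h.form_push hαX hi, ← mul_assoc, ← h.mult_add hi, ← φ.map_add, sub_add_cancel]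

include h in
theorem continuous_form_frame (hα : IsCnForm 0 α) (i : Fin 3) :
    Continuous (fun p => α p (e i p)) :=
  Continuous.comp (g := fun v : TangentBundle (𝓡 3) M => α v.proj v.snd)
    (f := fun p => (⟨p, e i p⟩ : TangentBundle (𝓡 3) M))
    (isCnForm_zero_iff.1 hα) (h.cont i).continuous

include h in
theorem continuous_dForm_frame (hα : IsCnForm 1 α) (hαX : ∀ p, α p (X p) = 0) (i : Fin 3) :
    Continuous (fun p => dForm α p (X p) (e i p)) :=
  Continuous.comp (g := fun v : TangentBundle (𝓡 3) M => dForm α v.proj (X v.proj) v.snd)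
    (f := fun p => (⟨p, e i p⟩ : TangentBundle (𝓡 3) M))
    (h.flow.continuous_dForm hα hαX) (h.cont i).continuous

end IsSplitFrame

theorem IsOrientableModX.neg_frame {X es : VField M} {D : Distribution M}
    (hs : ContinuousVFieldOn es Set.univ) (hs' : ∀ p, es p ∈ D p ∧ es p ∉ lineField X p) :
    ContinuousVFieldOn (-es) Set.univ ∧ ∀ p, (-es) p ∈ D p ∧ (-es) p ∉ lineField X p := by
  refine ⟨?_, fun p => ?_⟩
  · rw [ContinuousVFieldOn, continuousOn_univ, continuous_iff_continuousAt]
    intro p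
    have hp := mem_extChartAt_source (I := 𝓡 3) p
    have h1 := (continuousAt_tangentBundle_iff (z₀ := p) (p := p) hp).1
      hs.continuous.continuousAt
    refine (continuousAt_tangentBundle_iff (z₀ := p) (p := p) hp).2 ⟨h1.1, ?_⟩
    exact h1.2.neg.congr (Eventually.of_forall fun q => (map_neg (dchart p q) (es q)).symm)
  · simpa using hs' p

/-- An oriented frame adapted to a dominated splitting into orientable line bundles. -/
theorem IsDominatedSplitting.exists_isSplitFrame [ConnectedSpace M] {X : VField M} {φ : Flow ℝ M}
    {Es Eu : Distribution M} (h : IsDominatedSplitting X φ Es Eu) (hX : IsCnVField 1 X)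
    (hX0 : ∀ p, X p ≠ 0) (hφ : IsFlowOf X φ) (hEs : IsOrientableModX X Es)
    (hEu : IsOrientableModX X Eu) (o : ManifoldOrientation M) :
    ∃ (e : Fin 3 → VField M) (he : IsSplitFrame X φ Es Eu e),
      ∀ p, (he.basis p).orientation = o.at_point p := by
  obtain ⟨es, hs, hs'⟩ := hEs
  obtain ⟨eu, hu, hu'⟩ := hEu
  have he := h.isSplitFrame hX hX0 hφ hs hs' hu hu'
  obtain ⟨hn, hn'⟩ := IsOrientableModX.neg_frame hs hs'
  have he' := h.isSplitFrame hX hX0 hφ hn hn' hu hu'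
  have hloc := he.isLocallyConstant_orientation o
  obtain ⟨p₀⟩ := (inferInstance : Nonempty M)
  by_cases h0 : (he.basis p₀).orientation = o.at_point p₀
  · exact ⟨_, he, fun p => (hloc.apply_eq_of_isPreconnected isPreconnected_univ
      (Set.mem_univ p) (Set.mem_univ p₀)).mpr h0⟩
  · refine ⟨_, he', fun p => ?_⟩
    have hp : ¬ (he.basis p).orientation = o.at_point p := fun hp =>
      h0 ((hloc.apply_eq_of_isPreconnected isPreconnected_univ
        (Set.mem_univ p) (Set.mem_univ p₀)).mp hp)
    by_contra hp'
    have h1 := (Module.Basis.orientation_ne_iff_eq_neg (he.basis p) (o.at_point p)).1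
      (Ne.symm hp)
    have h2 := (Module.Basis.orientation_ne_iff_eq_neg (he'.basis p) (o.at_point p)).1
      (Ne.symm hp')
    have h3 : (he.basis p).orientation = (he'.basis p).orientation :=
      neg_injective (h1.symm.trans h2)
    rw [Module.Basis.orientation_eq_iff_det_pos] at h3
    have h4 : ⇑(he'.basis p) = Function.update ⇑(he.basis p) 0 ((-1 : ℝ) • he.basis p 0) := by
      refine Function.eq_update_iff.2 ⟨?_, fun i hi => ?_⟩
      · rw [he'.basis_apply, he.basis_apply, neg_one_smul]; rfl
      · rw [he'.basis_apply, he.basis_apply]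
        fin_cases i
        · exact absurd rfl hi
        · rfl
        · rfl
    rw [h4, AlternatingMap.map_update_smul, Function.update_eq_self, Module.Basis.det_self] at h3
    norm_num at h3

end SplitFrame

section Growth

theorem abs_le_exp_mul_abs {g ρ : ℝ → ℝ} {c : ℝ} (hd : ∀ t, HasDerivAt g (ρ t * g t) t)
    (hρ : ∀ t, ρ t ≤ c) {t : ℝ} (ht : 0 ≤ t) : |g t| ≤ Real.exp (c * t) * |g 0| := by
  have h1 : ∀ s, HasDerivAt (fun s => (Real.exp (-c * s) * g s) ^ 2)
      (2 * (ρ s - c) * (Real.exp (-c * s) * g s) ^ 2) s := by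
    intro s
    have he : HasDerivAt (fun s => Real.exp (-c * s)) (Real.exp (-c * s) * (-c * 1)) s :=
      ((hasDerivAt_id s).const_mul (-c)).exp
    refine ((he.mul (hd s)).pow 2).congr_deriv ?_
    simp only [Pi.mul_apply]
    ring
  have h2 : Antitone (fun s => (Real.exp (-c * s) * g s) ^ 2) := by
    refine antitone_of_deriv_nonpos (fun s => (h1 s).differentiableAt) fun s => ?_
    rw [(h1 s).deriv]
    exact mul_nonpos_of_nonpos_of_nonneg (by linarith [hρ s]) (sq_nonneg _)
  have h3 := h2 ht
  simp only [mul_zero, Real.exp_zero, one_mul] at h3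
  have h4 := sq_le_sq.1 h3
  calc |g t| = Real.exp (c * t) * |Real.exp (-c * t) * g t| := by
        rw [abs_mul, Real.abs_exp, ← mul_assoc, ← Real.exp_add]; simp
    _ ≤ Real.exp (c * t) * |g 0| := by gcongr

theorem exp_mul_abs_le {g ρ : ℝ → ℝ} {c : ℝ} (hd : ∀ t, HasDerivAt g (ρ t * g t) t)
    (hρ : ∀ t, c ≤ ρ t) {t : ℝ} (ht : 0 ≤ t) : Real.exp (c * t) * |g 0| ≤ |g t| := by
  have h1 : ∀ s, HasDerivAt (fun s => g (t - s)) (-ρ (t - s) * g (t - s)) s := fun s => by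
    simpa using (hd (t - s)).comp_const_sub t s
  have h2 := abs_le_exp_mul_abs h1 (fun s => neg_le_neg (hρ (t - s))) ht
  simp only [sub_self, sub_zero] at h2
  calc Real.exp (c * t) * |g 0| ≤ Real.exp (c * t) * (Real.exp (-c * t) * |g t|) := by gcongr
    _ = |g t| := by rw [← mul_assoc, ← Real.exp_add]; simp

theorem exists_pos_le_of_continuous {Y : Type*} [TopologicalSpace Y] [CompactSpace Y] {f : Y → ℝ}
    (hf : Continuous f) (h : ∀ y, 0 < f y) : ∃ c > 0, ∀ y, c ≤ f y := by
  rcases isEmpty_or_nonempty Y with hY | hY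
  · exact ⟨1, one_pos, fun y => hY.elim y⟩
  · obtain ⟨y, -, hy⟩ := isCompact_univ.exists_isMinOn Set.univ_nonempty hf.continuousOn
    exact ⟨f y, h y, fun z => hy (Set.mem_univ z)⟩

theorem exists_pos_ge_of_continuous {Y : Type*} [TopologicalSpace Y] [CompactSpace Y] {f : Y → ℝ}
    (hf : Continuous f) : ∃ K > 0, ∀ y, |f y| ≤ K := by
  obtain ⟨K, hK⟩ := isCompact_univ.exists_bound_of_continuousOn hf.continuousOn
  exact ⟨max K 1, by positivity, fun y => (hK y trivial).trans (le_max_left _ _)⟩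

end Growth

section Lift

variable {M : Type*} [TopologicalSpace M] [ChartedSpace E3 M] [IsManifold (𝓡 3) ∞ M]

theorem ContinuousVFieldOn.add_smul {Y Z : VField M} (hY : ContinuousVFieldOn Y Set.univ)
    (hZ : ContinuousVFieldOn Z Set.univ) {f : M → ℝ} (hf : Continuous f) :
    ContinuousVFieldOn (fun p => Y p + f p • Z p) Set.univ := by
  rw [ContinuousVFieldOn, continuousOn_univ, continuous_iff_continuousAt]
  intro p
  have hp := mem_extChartAt_source (I := 𝓡 3) p
  have h1 := (continuousAt_tangentBundle_iff (z₀ := p) (p := p) hp).1 hY.continuous.continuousAt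
  have h2 := (continuousAt_tangentBundle_iff (z₀ := p) (p := p) hp).1 hZ.continuous.continuousAt
  refine (continuousAt_tangentBundle_iff (z₀ := p) (p := p) hp).2 ⟨h1.1, ?_⟩
  refine (h1.2.add (hf.continuousAt.smul h2.2)).congr (Eventually.of_forall fun q => ?_)
  exact ((map_add (dchart p q) (Y q) (f q • Z q)).trans
    (congrArg (dchart p q (Y q) + ·) (map_smul (dchart p q) (f q) (Z q)))).symm

variable {X : VField M} {φ : Flow ℝ M} {Es Eu : Distribution M} {e : Fin 3 → VField M}
  [CompactSpace M] (h : IsSplitFrame X φ Es Eu e)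

namespace IsSplitFrame

/-- If the multiplier of the normal line bundle is uniformly less than `1` for some time, then
this line bundle lifts to an invariant line bundle in `TM`. -/
theorem exists_invariant_lift {i : Fin 3} (hi : i ≠ 2) {T : ℝ}
    (hT : ∀ p, h.mult i T p ≤ 1 / 2) :
    ∃ f : M → ℝ, Continuous f ∧
      ∀ t p, f p = h.mult i t p * f (φ t p) - h.shear i t p := by
  have hmT : Continuous (h.mult i T) := Continuous.comp (g := fun z : ℝ × M => h.mult i z.1 z.2)
    (f := fun p : M => (T, p)) (h.continuous_mult i) (continuous_const.prodMk continuous_id)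
  have hc : ∀ (t : ℝ) (f : C(M, ℝ)), Continuous
      (fun p => h.mult i t p * f (φ t p) - h.shear i t p) := by
    intro t f
    have h1 : Continuous (h.mult i t) := Continuous.comp (g := fun z : ℝ × M => h.mult i z.1 z.2)
      (f := fun p : M => (t, p)) (h.continuous_mult i) (continuous_const.prodMk continuous_id)
    have h2 : Continuous (h.shear i t) := Continuous.comp
      (g := fun z : ℝ × M => h.shear i z.1 z.2) (f := fun p : M => (t, p))
      (h.continuous_shear i) (continuous_const.prodMk continuous_id)
    exact (h1.mul (f.continuous.comp (φ.continuous continuous_const continuous_id))).sub h2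
  let Φ : ℝ → C(M, ℝ) → C(M, ℝ) := fun t f => ⟨_, hc t f⟩
  have hΦ : ∀ t f p, Φ t f p = h.mult i t p * f (φ t p) - h.shear i t p := fun _ _ _ => rfl
  have hadd : ∀ s t f, Φ s (Φ t f) = Φ (t + s) f := by
    intro s t f
    ext p
    rw [hΦ, hΦ, hΦ, h.mult_add hi, h.shear_add hi, φ.map_add]
    ring
  have hK : ContractingWith (1 / 2) (Φ T) := by
    refine ⟨by norm_num, LipschitzWith.of_dist_le_mul fun f g => ?_⟩
    refine (ContinuousMap.dist_le (by positivity)).2 fun p => ?_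
    rw [hΦ, hΦ, Real.dist_eq, sub_sub_sub_cancel_right, ← mul_sub, abs_mul,
      abs_of_pos (h.mult_pos hi T p)]
    have := ContinuousMap.dist_apply_le_dist (f := f) (g := g) (φ T p)
    rw [Real.dist_eq] at this
    have h2 := hT p
    push_cast
    gcongr
  refine ⟨hK.fixedPoint, (ContractingWith.fixedPoint (Φ T) hK).continuous, fun t p => ?_⟩
  rw [← hΦ]
  have hfix : Φ T (hK.fixedPoint) = hK.fixedPoint := hK.fixedPoint_isFixedPt
  have : Φ T (Φ t hK.fixedPoint) = Φ t hK.fixedPoint := by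
    rw [hadd, add_comm, ← hadd, hfix]
  exact congrArg (fun f : C(M, ℝ) => f p) (hK.fixedPoint_unique this).symm

omit [CompactSpace M] in
theorem push_lift (h : IsSplitFrame X φ Es Eu e) {i : Fin 3} (hi : i ≠ 2) {f : M → ℝ}
    (hf : ∀ t p, f p = h.mult i t p * f (φ t p) - h.shear i t p) (t : ℝ) (p : M) :
    push φ t p (e i p + f p • e 2 p) =
      h.mult i t p • (e i (φ t p) + f (φ t p) • e 2 (φ t p)) := by
  rw [map_add, map_smul, h.push_X, h.push_frame hi, hf t p]
  module

omit [CompactSpace M] in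
theorem isContinuousSubbundle_lift (h : IsSplitFrame X φ Es Eu e) {i : Fin 3} (hi : i ≠ 2)
    {f : M → ℝ} (hf : Continuous f) :
    IsContinuousSubbundle 1 (fun p => Submodule.span ℝ {e i p + f p • e 2 p}) := by
  intro p
  refine ⟨Set.univ, univ_mem, fun _ q => e i q + f q • e 2 q,
    fun _ => (h.cont i).add_smul (h.cont 2) hf, fun q _ => ⟨?_, ?_⟩⟩
  · refine LinearIndependent.of_subsingleton (0 : Fin 1) fun h0 => ?_
    have := congrArg (h.dual i q) h0
    rw [map_add, map_smul, h.dual_self, h.dual_self, map_zero] at this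
    simp [hi] at this
  · rw [Set.range_const]

omit [CompactSpace M] in
theorem isInvariantField_lift (h : IsSplitFrame X φ Es Eu e) {i : Fin 3} (hi : i ≠ 2) {f : M → ℝ}
    (hf : ∀ t p, f p = h.mult i t p * f (φ t p) - h.shear i t p) :
    IsInvariantField φ (fun p => Submodule.span ℝ {e i p + f p • e 2 p}) := by
  intro t p
  rw [Submodule.map_span, Set.image_singleton]
  refine (congrArg (fun v => Submodule.span ℝ {v}) (h.push_lift hi hf t p)).trans ?_
  exact Submodule.span_singleton_smul_eq (h.mult_ne_zero hi t p).isUnit _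

/-- The seminorm `|a₀ e⁰| + |a₁ e¹| + |e² - f₀ e⁰ - f₁ e¹|`, where `eⁱ` is the dual coframe. -/
def adaptedNorm (a₀ a₁ f₀ f₁ : M → ℝ) (p : M) : Seminorm ℝ (TangentSpace (𝓡 3) p) :=
  (normSeminorm ℝ ℝ).comp (a₀ p • h.dual 0 p).toLinearMap +
  (normSeminorm ℝ ℝ).comp (a₁ p • h.dual 1 p).toLinearMap +
  (normSeminorm ℝ ℝ).comp (h.dual 2 p - f₀ p • h.dual 0 p - f₁ p • h.dual 1 p).toLinearMap

omit [CompactSpace M] in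
theorem adaptedNorm_apply (h : IsSplitFrame X φ Es Eu e) (a₀ a₁ f₀ f₁ : M → ℝ) (p : M)
    (v : TangentSpace (𝓡 3) p) :
    h.adaptedNorm a₀ a₁ f₀ f₁ p v = |a₀ p * h.dual 0 p v| + |a₁ p * h.dual 1 p v| +
      |h.dual 2 p v - f₀ p * h.dual 0 p v - f₁ p * h.dual 1 p v| := rfl

omit [CompactSpace M] in
theorem isTangentNorm_adaptedNorm (h : IsSplitFrame X φ Es Eu e) {a₀ a₁ f₀ f₁ : M → ℝ}
    (ha₀ : Continuous a₀) (ha₁ : Continuous a₁) (hf₀ : Continuous f₀) (hf₁ : Continuous f₁)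
    (ha₀' : ∀ p, a₀ p ≠ 0) (ha₁' : ∀ p, a₁ p ≠ 0) :
    IsTangentNorm (h.adaptedNorm a₀ a₁ f₀ f₁) := by
  have hproj : Continuous (fun v : TangentBundle (𝓡 3) M => v.proj) :=
    continuous_iff_continuousAt.2 continuousAt_proj
  have hd := fun i => isCnForm_zero_iff.1 (h.isCnForm_dual i)
  constructor
  · simp only [adaptedNorm_apply]
    exact ((((ha₀.comp hproj).mul (hd 0)).abs.add ((ha₁.comp hproj).mul (hd 1)).abs)).add
      (((hd 2).sub ((hf₀.comp hproj).mul (hd 0))).sub ((hf₁.comp hproj).mul (hd 1))).abs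
  · intro p v
    rw [adaptedNorm_apply]
    constructor
    · intro h0
      have n0 := abs_nonneg (a₀ p * h.dual 0 p v)
      have n1 := abs_nonneg (a₁ p * h.dual 1 p v)
      have n2 := abs_nonneg (h.dual 2 p v - f₀ p * h.dual 0 p v - f₁ p * h.dual 1 p v)
      have z0 := (mul_eq_zero.1 (abs_eq_zero.1 (by linarith :
        |a₀ p * h.dual 0 p v| = 0))).resolve_left (ha₀' p)
      have z1 := (mul_eq_zero.1 (abs_eq_zero.1 (by linarith :
        |a₁ p * h.dual 1 p v| = 0))).resolve_left (ha₁' p)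
      have z2 := abs_eq_zero.1 (by linarith :
        |h.dual 2 p v - f₀ p * h.dual 0 p v - f₁ p * h.dual 1 p v| = 0)
      rw [z0, z1, mul_zero, mul_zero, sub_zero, sub_zero] at z2
      rw [h.sum_dual p v, z0, z1, z2]
      simp
    · rintro rfl
      simp

variable {α : OneForm M}

include h in
/-- A flow with a contact form that is infinitesimally contracted on the stable line bundle and
expanded on the unstable one is Anosov. -/
theorem isAnosov_of_form (hα : IsCnForm 1 α) (hαX : ∀ p, α p (X p) = 0)
    (h₀ : ∀ p, α p (e 0 p) ≠ 0) (h₁ : ∀ p, α p (e 1 p) ≠ 0)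
    (hr₀ : ∀ p, dForm α p (X p) (e 0 p) / α p (e 0 p) < 0)
    (hr₁ : ∀ p, 0 < dForm α p (X p) (e 1 p) / α p (e 1 p)) : IsAnosov X φ := by
  have h02 : (0 : Fin 3) ≠ 2 := by decide
  have h12 : (1 : Fin 3) ≠ 2 := by decide
  have ha := fun i => h.continuous_form_frame hα.zero i
  have hd := fun i => h.continuous_dForm_frame hα hαX i
  obtain ⟨c₀, hc₀, hc₀'⟩ := exists_pos_le_of_continuous ((hd 0).div (ha 0) h₀).neg
    fun p => neg_pos.2 (hr₀ p)
  obtain ⟨c₁, hc₁, hc₁'⟩ := exists_pos_le_of_continuous ((hd 1).div (ha 1) h₁) hr₁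
  obtain ⟨m₀, hm₀, hm₀'⟩ := exists_pos_le_of_continuous (ha 0).abs fun p => abs_pos.2 (h₀ p)
  obtain ⟨m₁, hm₁, hm₁'⟩ := exists_pos_le_of_continuous (ha 1).abs fun p => abs_pos.2 (h₁ p)
  obtain ⟨K₀, hK₀, hK₀'⟩ := exists_pos_ge_of_continuous (ha 0)
  obtain ⟨K₁, hK₁, hK₁'⟩ := exists_pos_ge_of_continuous (ha 1)
  set c := min c₀ c₁ with hcdef
  have hc : 0 < c := lt_min hc₀ hc₁
  have hderiv : ∀ i : Fin 3, i ≠ 2 → (∀ p, α p (e i p) ≠ 0) → ∀ p t,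
      HasDerivAt (fun t => h.mult i t p * α (φ t p) (e i (φ t p)))
        ((dForm α (φ t p) (X (φ t p)) (e i (φ t p)) / α (φ t p) (e i (φ t p))) *
          (h.mult i t p * α (φ t p) (e i (φ t p)))) t := by
    intro i hi hne p t
    refine (h.hasDerivAt_mult_mul_form hα hαX hi p t).congr_deriv ?_
    have := hne (φ t p)
    field_simp
  have hzero : ∀ (i : Fin 3) p, h.mult i 0 p * α (φ 0 p) (e i (φ 0 p)) = α p (e i p) := by
    intro i p
    rw [h.mult_zero, one_mul, φ.map_zero_apply]
  have hcontr : ∀ p t, 0 ≤ t → h.mult 0 t p * |α (φ t p) (e 0 (φ t p))| ≤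
      Real.exp (-c * t) * |α p (e 0 p)| := by
    intro p t ht
    have := abs_le_exp_mul_abs (c := -c) (hderiv 0 h02 h₀ p) (fun s => by
      have := hc₀' (φ s p)
      have := min_le_left c₀ c₁
      simp only [Pi.neg_apply, Pi.div_apply] at *
      linarith) ht
    rwa [hzero, abs_mul, abs_of_pos (h.mult_pos h02 t p)] at this
  have hexp : ∀ p t, 0 ≤ t → Real.exp (c * t) * |α p (e 1 p)| ≤
      h.mult 1 t p * |α (φ t p) (e 1 (φ t p))| := by
    intro p t ht
    have := exp_mul_abs_le (c := c) (hderiv 1 h12 h₁ p) (fun s => by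
      have := hc₁' (φ s p)
      have := min_le_right c₀ c₁
      simp only [Pi.div_apply] at *
      linarith) ht
    rwa [hzero, abs_mul, abs_of_pos (h.mult_pos h12 t p)] at this
  obtain ⟨T, hT, hT0, hT1⟩ : ∃ T : ℝ, 0 ≤ T ∧ Real.exp (-c * T) * K₀ ≤ m₀ / 2 ∧
      Real.exp (-c * T) * K₁ ≤ m₁ / 2 := by
    have hlim : Tendsto (fun t => Real.exp (-c * t)) atTop (𝓝 0) :=
      Real.tendsto_exp_atBot.comp (tendsto_id.const_mul_atTop_of_neg (neg_lt_zero.2 hc))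
    have e0 := (hlim.mul_const K₀).eventually_le_const (u := m₀ / 2) (by simpa using hm₀)
    have e1 := (hlim.mul_const K₁).eventually_le_const (u := m₁ / 2) (by simpa using hm₁)
    obtain ⟨T, hT⟩ := ((eventually_ge_atTop 0).and (e0.and e1)).exists
    exact ⟨T, hT⟩
  obtain ⟨f₀, hf₀, hf₀'⟩ := h.exists_invariant_lift h02 (T := T) (fun p => by
    have h1 := hcontr p T hT
    have h2 := h.mult_pos h02 T p
    have h3 := mul_le_mul_of_nonneg_left (hm₀' (φ T p)) h2.le
    have h4 := mul_le_mul_of_nonneg_left (hK₀' p) (Real.exp_pos (-c * T)).le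
    have h5 : h.mult 0 T p * m₀ ≤ 1 / 2 * m₀ := by linarith
    exact le_of_mul_le_mul_right h5 hm₀)
  obtain ⟨f₁, hf₁, hf₁'⟩ := h.exists_invariant_lift h12 (T := -T) (fun p => by
    have h0 := h.mult_mul_neg h12 (-T) p
    rw [neg_neg] at h0
    set q := φ (-T) p
    have h1 := hexp q T hT
    have h2 := h.mult_pos h12 T q
    have h3 := mul_le_mul_of_nonneg_left (hK₁' (φ T q)) h2.le
    have h4 := mul_le_mul_of_nonneg_left (hm₁' q) (Real.exp_pos (c * T)).le
    have h5 : Real.exp (c * T) * m₁ ≤ h.mult 1 T q * K₁ := by linarith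
    have h6 := mul_le_mul_of_nonneg_left h5 (Real.exp_pos (-c * T)).le
    rw [← mul_assoc, ← Real.exp_add, neg_mul, neg_add_cancel, Real.exp_zero, one_mul] at h6
    rw [neg_mul] at hT1
    have h7 : m₁ ≤ h.mult 1 T q * (m₁ / 2) := by
      calc m₁ ≤ h.mult 1 T q * (Real.exp (-(c * T)) * K₁) := by linarith
        _ ≤ _ := by gcongr
    have h8 : 2 ≤ h.mult 1 T q := by
      by_contra h9
      nlinarith
    nlinarith [h.mult_pos h12 (-T) p])
  have hN₀ : ∀ p, h.adaptedNorm (fun p => α p (e 0 p)) (fun p => α p (e 1 p)) f₀ f₁ p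
      (e 0 p + f₀ p • e 2 p) = |α p (e 0 p)| := by
    intro p
    simp [h.adaptedNorm_apply, h.dual_self]
  have hN₁ : ∀ p, h.adaptedNorm (fun p => α p (e 0 p)) (fun p => α p (e 1 p)) f₀ f₁ p
      (e 1 p + f₁ p • e 2 p) = |α p (e 1 p)| := by
    intro p
    simp [h.adaptedNorm_apply, h.dual_self]
  refine ⟨_, _, h.isContinuousSubbundle_lift h02 hf₀, h.isContinuousSubbundle_lift h12 hf₁,
    h.isInvariantField_lift h02 hf₀', h.isInvariantField_lift h12 hf₁', fun p => ?_, c,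
    h.adaptedNorm (fun p => α p (e 0 p)) (fun p => α p (e 1 p)) f₀ f₁, hc,
    h.isTangentNorm_adaptedNorm (ha 0) (ha 1) hf₀ hf₁ h₀ h₁, fun t ht p => ⟨fun u hu => ?_,
      fun v hv => ?_⟩⟩
  · rw [eq_top_iff]
    intro v _
    have hv : v = h.dual 0 p v • (e 0 p + f₀ p • e 2 p) + h.dual 1 p v • (e 1 p + f₁ p • e 2 p) +
        (h.dual 2 p v - h.dual 0 p v * f₀ p - h.dual 1 p v * f₁ p) • X p := by
      conv_lhs => rw [h.sum_dual p v]
      rw [h.two]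
      module
    rw [hv]
    exact Submodule.add_mem_sup (Submodule.add_mem_sup
      (Submodule.smul_mem _ _ (Submodule.mem_span_singleton_self _))
      (Submodule.smul_mem _ _ (Submodule.mem_span_singleton_self _)))
      (Submodule.smul_mem _ _ (Submodule.mem_span_singleton_self _))
  · obtain ⟨a, rfl⟩ := Submodule.mem_span_singleton.1 hu
    rw [map_smul (push φ t p), h.push_lift h02 hf₀', map_smul_eq_mul, map_smul_eq_mul, map_smul_eq_mul, hN₀,
      hN₀, Real.norm_eq_abs, Real.norm_eq_abs, abs_of_pos (h.mult_pos h02 t p)]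
    have := mul_le_mul_of_nonneg_left (hcontr p t ht) (abs_nonneg a)
    linarith
  · obtain ⟨a, rfl⟩ := Submodule.mem_span_singleton.1 hv
    rw [map_smul (push φ t p), h.push_lift h12 hf₁', map_smul_eq_mul, map_smul_eq_mul, map_smul_eq_mul, hN₁,
      hN₁, Real.norm_eq_abs, Real.norm_eq_abs, abs_of_pos (h.mult_pos h12 t p)]
    have := mul_le_mul_of_nonneg_left (hexp p t ht) (abs_nonneg a)
    linarith

end IsSplitFrame

end Lift

section Volume

variable {M : Type*} [TopologicalSpace M] [ChartedSpace E3 M] [IsManifold (𝓡 3) ∞ M]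
  {α : OneForm M}

theorem IsCnForm.dForm_swap (hα : IsCnForm 1 α) (p : M) (v w : TangentSpace (𝓡 3) p) :
    dForm α p v w = -dForm α p w v := by
  rw [hα.dForm_eq, hα.dForm_eq, neg_sub]

variable {X : VField M} {φ : Flow ℝ M} {Es Eu : Distribution M} {e : Fin 3 → VField M}
  (h : IsSplitFrame X φ Es Eu e)

namespace IsSplitFrame

include h in
theorem X_mem_s (p : M) : X p ∈ Es p := by rw [h.mem_s, ← congrFun h.two p, h.dual_self]; simp

include h in
theorem X_mem_u (p : M) : X p ∈ Eu p := by rw [h.mem_u, ← congrFun h.two p, h.dual_self]; simp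

include h in
theorem push_mem_s (t : ℝ) (p : M) : push φ t p (e 0 p) ∈ Es (φ t p) := by
  rw [← h.inv_s t p]; exact Submodule.mem_map_of_mem (h.mem_s_zero p)

include h in
theorem push_mem_u (t : ℝ) (p : M) : push φ t p (e 1 p) ∈ Eu (φ t p) := by
  rw [← h.inv_u t p]; exact Submodule.mem_map_of_mem (h.mem_u_one p)

theorem contactVolume_frame (hα : IsCnForm 1 α) (hαX : ∀ p, α p (X p) = 0) (p : M) :
    contactVolume α p (h.basis p) =
      dForm α p (X p) (e 0 p) * α p (e 1 p) - α p (e 0 p) * dForm α p (X p) (e 1 p) := by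
  rw [contactVolume, h.basis_apply, h.basis_apply, h.basis_apply, h.two, hαX,
    hα.dForm_swap p (e 1 p), hα.dForm_swap p (e 0 p) (X p)]
  ring

include h in
theorem wedge3_of_mem {αs αu αX : OneForm M} (hs : kerField αs = Eu) (hu : kerField αu = Es)
    (hX : ∀ p, αX p (X p) = 1) {p : M} {v : Fin 3 → TangentSpace (𝓡 3) p}
    (h₀ : v 0 ∈ Es p) (h₁ : v 1 ∈ Eu p) (h₂ : v 2 = X p) :
    wedge3 αs αu αX p v = αs p (v 0) * αu p (v 1) := by
  have s1 : αs p (v 1) = 0 := by rw [← hs] at h₁; exact h₁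
  have s2 : αs p (X p) = 0 := by have := h.X_mem_u p; rw [← hs] at this; exact this
  have u1 : αu p (v 0) = 0 := by rw [← hu] at h₀; exact h₀
  have u2 : αu p (X p) = 0 := by have := h.X_mem_s p; rw [← hu] at this; exact this
  rw [wedge3, Matrix.det_fin_three]
  simp only [Matrix.of_apply, Matrix.cons_val, h₂, s1, s2, u1, u2, hX]
  ring

theorem wedge3_basis {αs αu αX : OneForm M} (hs : kerField αs = Eu) (hu : kerField αu = Es)
    (hX : ∀ p, αX p (X p) = 1) (p : M) :
    wedge3 αs αu αX p (h.basis p) = αs p (e 0 p) * αu p (e 1 p) := by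
  rw [h.wedge3_of_mem hs hu hX] <;> simp only [h.basis_apply]
  exacts [h.mem_s_zero p, h.mem_u_one p, congrFun h.two p]

/-- If `α = αu + ε αs` with `ε = ±1`, then the derivative of `αs ∧ αu ∧ αX` along the flow is given
by the derivative of `α`. -/
theorem hasDerivAt_wedge3 (hα : IsCnForm 1 α) (hαX : ∀ p, α p (X p) = 0) {αs αu αX : OneForm M}
    (hs : kerField αs = Eu) (hu : kerField αu = Es) (hX : ∀ p, αX p (X p) = 1)
    {ε : ℝ} (hε : ε * ε = 1) (heq : ∀ p v, α p v = αu p v + ε * αs p v) (p : M)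
    (v : Fin 3 → TangentSpace (𝓡 3) p) :
    HasDerivAt (fun t => wedge3 αs αu αX (φ t p) (fun i => push φ t p (v i)))
      (ε * (dForm α p (X p) (e 0 p) * α p (e 1 p) + α p (e 0 p) * dForm α p (X p) (e 1 p)) *
        (h.basis p).det v) 0 := by
  have h1 : ∀ t, wedge3 αs αu αX (φ t p) (fun i => push φ t p (v i)) =
      ε * (α (φ t p) (push φ t p (e 0 p)) * α (φ t p) (push φ t p (e 1 p))) *
        (h.basis p).det v := by
    intro t
    obtain ⟨A, hA⟩ := isAlternating_wedge3 αs αu αX (φ t p)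
    have h2 := congrArg (fun f => f v) (AlternatingMap.eq_smul_basis_det (h.basis p)
      (A.compLinearMap (push φ t p).toLinearMap))
    have h3 : A (fun i => push φ t p (h.basis p i)) =
        ε * (α (φ t p) (push φ t p (e 0 p)) * α (φ t p) (push φ t p (e 1 p))) := by
      rw [← hA, h.wedge3_of_mem hs hu hX] <;> simp only [h.basis_apply]
      · have m0 : αu (φ t p) (push φ t p (e 0 p)) = 0 := by
          have := h.push_mem_s t p; rw [← hu] at this; exact this
        have m1 : αs (φ t p) (push φ t p (e 1 p)) = 0 := by
          have := h.push_mem_u t p; rw [← hs] at this; exact this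
        rw [heq, heq, m0, m1]
        linear_combination (-(αs (φ t p) (push φ t p (e 0 p)) *
          αu (φ t p) (push φ t p (e 1 p)))) * hε
      · exact h.push_mem_s t p
      · exact h.push_mem_u t p
      · rw [h.push_X, h.two]
    rw [hA]
    refine Eq.trans h2 ?_
    rw [← h3]
    rfl
  simp only [h1]
  have d := (h.flow.hasDerivAt_form_push hα hαX p (e 0 p)).mul
    (h.flow.hasDerivAt_form_push hα hαX p (e 1 p))
  have z : ∀ w, α (φ 0 p) (push φ 0 p w) = α p w := fun w =>
    congrArg (fun v : TangentBundle (𝓡 3) M => α v.proj v.snd) (tangentMap_zero φ ⟨p, w⟩)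
  refine ((d.const_mul ε).mul_const _).congr_deriv ?_
  rw [z, z]

include h in
/-- A contact form whose divergence is dominated by its contact volume witnesses that the flow
is Anosov. Here `ε = -1` for positive contact forms and `ε = 1` for negative ones. -/
theorem isAnosov_of_divergence [CompactSpace M] {o : ManifoldOrientation M}
    (ho : ∀ p, (h.basis p).orientation = o.at_point p)
    (hα : IsCnForm 1 α) (hαX : ∀ p, α p (X p) = 0) {αs αu : OneForm M} {Ω : ThreeForm M}
    {δ : M → ℝ} (hV : IsVolumeOfPair o X Es Eu αs αu Ω) (hδ : IsDivergence φ Ω δ)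
    {ε : ℝ} (hε : ε * ε = 1) (heq : ∀ p v, α p v = αu p v + ε * αs p v)
    (h₁ : ThreeFormLT o (scale (fun _ => ε) (contactVolume α)) (scale δ Ω))
    (h₂ : ThreeFormLT o (scale δ Ω) (scale (fun _ => -ε) (contactVolume α))) :
    IsAnosov X φ := by
  obtain ⟨-, -, hs, hu, ⟨αX, hX, rfl⟩, hpos⟩ := hV
  have key : ∀ p, 0 < ε * (α p (e 0 p) * α p (e 1 p)) ∧
      ε * (dForm α p (X p) (e 0 p) * α p (e 1 p)) < 0 ∧
      0 < ε * (α p (e 0 p) * dForm α p (X p) (e 1 p)) := by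
    intro p
    have m0 : αu p (e 0 p) = 0 := by have := h.mem_s_zero p; rw [← hu] at this; exact this
    have m1 : αs p (e 1 p) = 0 := by have := h.mem_u_one p; rw [← hs] at this; exact this
    have k0 := hpos p _ (ho p)
    have k1 := h₁ p _ (ho p)
    have k2 := h₂ p _ (ho p)
    have d := (hδ p (h.basis p)).unique (h.hasDerivAt_wedge3 hα hαX hs hu hX hε heq p _)
    simp only [scale] at k1 k2
    rw [Module.Basis.det_self] at d
    rw [d, h.contactVolume_frame hα hαX] at k1 k2
    rw [h.wedge3_basis hs hu hX, Pi.zero_apply, Pi.zero_apply] at k0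
    refine ⟨?_, by linarith, by linarith⟩
    rw [heq, heq, m0, m1]
    refine k0.trans_eq ?_
    linear_combination (-(αs p (e 0 p) * αu p (e 1 p))) * hε
  have hA : ∀ p, α p (e 0 p) ≠ 0 := fun p h0 => by
    have := (key p).1; rw [h0] at this; simp at this
  have hB : ∀ p, α p (e 1 p) ≠ 0 := fun p h0 => by
    have := (key p).1; rw [h0] at this; simp at this
  refine h.isAnosov_of_form hα hαX hA hB (fun p => ?_) (fun p => ?_)
  · obtain ⟨k0, k1, -⟩ := key p
    have := div_neg_of_neg_of_pos k1 k0
    have hε0 : ε ≠ 0 := by rintro rfl; simp at hε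
    rwa [mul_div_mul_left _ _ hε0, mul_div_mul_right _ _ (hB p)] at this
  · obtain ⟨k0, -, k1⟩ := key p
    have := div_pos k1 k0
    have hε0 : ε ≠ 0 := by rintro rfl; simp at hε
    rwa [mul_div_mul_left _ _ hε0, mul_div_mul_left _ _ (hA p)] at this

end IsSplitFrame

end Volume

section Hyperbolic

variable {M : Type*} [TopologicalSpace M] [ChartedSpace E3 M] [IsManifold (𝓡 3) ∞ M]

theorem IsContinuousSubbundle.exists_section {D : Distribution M} (hD : IsContinuousSubbundle 1 D)
    (p : M) : ∃ U ∈ 𝓝 p, ∃ u : VField M, ContinuousVFieldOn u U ∧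
      ∀ q ∈ U, u q ≠ 0 ∧ Submodule.span ℝ {u q} = D q := by
  obtain ⟨U, hU, e, hc, he⟩ := hD p
  refine ⟨U, hU, e 0, hc 0, fun q hq => ⟨(he q hq).1.ne_zero 0, ?_⟩⟩
  rw [← (he q hq).2, Set.range_unique]
  rfl

/-- Continuous seminorms are comparable on a line bundle over a compact manifold. -/
theorem IsContinuousSubbundle.exists_seminorm_le [CompactSpace M] {D : Distribution M}
    (hD : IsContinuousSubbundle 1 D) {N₁ N₂ : (p : M) → Seminorm ℝ (TangentSpace (𝓡 3) p)}
    (h₁ : Continuous (fun v : TangentBundle (𝓡 3) M => N₁ v.proj v.snd))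
    (h₂ : Continuous (fun v : TangentBundle (𝓡 3) M => N₂ v.proj v.snd))
    (h : ∀ p, ∀ u ∈ D p, N₂ p u = 0 → u = 0) :
    ∃ K > 0, ∀ p, ∀ u ∈ D p, N₁ p u ≤ K * N₂ p u := by
  obtain ⟨K, hK, hK'⟩ : ∃ K > 0, ∀ p ∈ (Set.univ : Set M), ∀ u ∈ D p, N₁ p u ≤ K * N₂ p u := by
    refine isCompact_univ.induction_on
      (p := fun U : Set M => ∃ K > 0, ∀ p ∈ U, ∀ u ∈ D p, N₁ p u ≤ K * N₂ p u)
      ⟨1, one_pos, fun p hp => hp.elim⟩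
      (fun U V hUV ⟨K, hK, hV⟩ => ⟨K, hK, fun p hp => hV p (hUV hp)⟩) ?_ ?_
    · rintro U V ⟨K, hK, hU⟩ ⟨L, hL, hV⟩
      refine ⟨max K L, lt_max_of_lt_left hK, ?_⟩
      rintro p (hp | hp) u hu
      · exact (hU p hp u hu).trans
          (mul_le_mul_of_nonneg_right (le_max_left _ _) (apply_nonneg _ _))
      · exact (hV p hp u hu).trans
          (mul_le_mul_of_nonneg_right (le_max_right _ _) (apply_nonneg _ _))
    · intro p _
      obtain ⟨U, hU, u, hc, hu⟩ := hD.exists_section p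
      have hc1 : ContinuousAt (fun q => N₁ q (u q)) p := ContinuousAt.comp
        (g := fun v : TangentBundle (𝓡 3) M => N₁ v.proj v.snd)
        (f := fun q => (⟨q, u q⟩ : TangentBundle (𝓡 3) M)) h₁.continuousAt (hc.continuousAt hU)
      have hc2 : ContinuousAt (fun q => N₂ q (u q)) p := ContinuousAt.comp
        (g := fun v : TangentBundle (𝓡 3) M => N₂ v.proj v.snd)
        (f := fun q => (⟨q, u q⟩ : TangentBundle (𝓡 3) M)) h₂.continuousAt (hc.continuousAt hU)
      have hpU := hu p (mem_of_mem_nhds hU)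
      have hpos : 0 < N₂ p (u p) := (apply_nonneg _ _).lt_of_ne' fun h0 => hpU.1
        (h p _ (by rw [← hpU.2]; exact Submodule.mem_span_singleton_self _) h0)
      set K := N₁ p (u p) / N₂ p (u p) + 1 with hK
      have hlt : N₁ p (u p) < K * N₂ p (u p) := by
        rw [hK, add_mul, div_mul_cancel₀ _ hpos.ne', one_mul]
        linarith
      refine ⟨{q | N₁ q (u q) ≤ K * N₂ q (u q)} ∩ U, mem_nhdsWithin_of_mem_nhds
        (inter_mem ?_ hU), K, by positivity, ?_⟩
      · filter_upwards [hc1.eventually_lt (hc2.const_mul K) hlt] with q hq using hq.le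
      · rintro q ⟨hq, hqU⟩ v hv
        rw [← (hu q hqU).2] at hv
        obtain ⟨a, rfl⟩ := Submodule.mem_span_singleton.1 hv
        rw [map_smul_eq_mul, map_smul_eq_mul]
        have := mul_le_mul_of_nonneg_left hq (norm_nonneg a)
        linarith
  exact ⟨K, hK, fun p => hK' p trivial⟩

/-- Two line bundles and the direction of the flow which span the tangent space are transverse. -/
theorem disjoint_lineField {X : VField M} {D₁ D₂ : Distribution M}
    (h₁ : IsContinuousSubbundle 1 D₁) (h₂ : IsContinuousSubbundle 1 D₂) {p : M}
    (h : D₁ p ⊔ D₂ p ⊔ lineField X p = ⊤) {u : TangentSpace (𝓡 3) p} (hu : u ∈ D₁ p)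
    (huX : u ∈ lineField X p) : u = 0 := by
  by_contra hu0
  obtain ⟨U, hU, u₁, -, hu₁⟩ := h₁.exists_section p
  obtain ⟨V, hV, u₂, -, hu₂⟩ := h₂.exists_section p
  have e1 := (hu₁ p (mem_of_mem_nhds hU)).2
  have e2 := (hu₂ p (mem_of_mem_nhds hV)).2
  have hX : lineField X p ≤ D₁ p := by
    obtain ⟨a, rfl⟩ := Submodule.mem_span_singleton.1 huX
    have ha : a ≠ 0 := by rintro rfl; simp at hu0
    rw [lineField, Submodule.span_singleton_le_iff_mem]
    exact ((D₁ p).smul_mem_iff ha).1 hu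
  have htop : D₁ p ⊔ D₂ p = ⊤ := by
    rw [← h, eq_comm, sup_eq_left]
    exact hX.trans le_sup_left
  rw [← e1, ← e2] at htop
  have := Submodule.finrank_add_le_finrank_add_finrank (Submodule.span ℝ {u₁ p})
    (Submodule.span ℝ {u₂ p})
  rw [htop, finrank_top, finrank_tangentSpace] at this
  have f1 : Module.finrank ℝ (Submodule.span ℝ {u₁ p}) ≤ 1 := by
    simpa using finrank_span_le_card (R := ℝ) ({u₁ p} : Set (TangentSpace (𝓡 3) p))
  have f2 : Module.finrank ℝ (Submodule.span ℝ {u₂ p}) ≤ 1 := by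
    simpa using finrank_span_le_card (R := ℝ) ({u₂ p} : Set (TangentSpace (𝓡 3) p))
  omega

variable {X : VField M} {φ : Flow ℝ M} {Es Eu : Distribution M} {e : Fin 3 → VField M}
  (h : IsSplitFrame X φ Es Eu e)

namespace IsSplitFrame

/-- The norm `|e⁰| + |e¹|` on the normal bundle. -/
def normalNorm (p : M) : Seminorm ℝ (TangentSpace (𝓡 3) p) :=
  (normSeminorm ℝ ℝ).comp (h.dual 0 p).toLinearMap +
  (normSeminorm ℝ ℝ).comp (h.dual 1 p).toLinearMap

theorem normalNorm_apply (p : M) (v : TangentSpace (𝓡 3) p) :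
    h.normalNorm p v = |h.dual 0 p v| + |h.dual 1 p v| := rfl

theorem continuous_normalNorm :
    Continuous (fun v : TangentBundle (𝓡 3) M => h.normalNorm v.proj v.snd) := by
  have hd := fun i => isCnForm_zero_iff.1 (h.isCnForm_dual i)
  exact (hd 0).abs.add (hd 1).abs

theorem mem_lineField_of_normalNorm {p : M} {v : TangentSpace (𝓡 3) p}
    (hv : h.normalNorm p v = 0) : v ∈ lineField X p := by
  rw [normalNorm_apply] at hv
  have z0 : h.dual 0 p v = 0 := abs_eq_zero.1 (by
    linarith [abs_nonneg (h.dual 0 p v), abs_nonneg (h.dual 1 p v)])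
  have z1 : h.dual 1 p v = 0 := abs_eq_zero.1 (by
    linarith [abs_nonneg (h.dual 0 p v), abs_nonneg (h.dual 1 p v)])
  refine Submodule.mem_span_singleton.2 ⟨h.dual 2 p v, ?_⟩
  conv_rhs => rw [h.sum_dual p v, z0, z1]
  rw [h.two]
  simp

theorem normalNorm_push [CompactSpace M] (t : ℝ) (p : M) (v : TangentSpace (𝓡 3) p) :
    h.normalNorm (φ t p) (push φ t p v) =
      h.mult 0 t p * |h.dual 0 p v| + h.mult 1 t p * |h.dual 1 p v| := by
  rw [normalNorm_apply, h.dual_push (by decide), h.dual_push (by decide), abs_mul, abs_mul,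
    abs_of_pos (h.mult_pos (by decide) t p), abs_of_pos (h.mult_pos (by decide) t p)]

/-- Domination in terms of the multipliers. -/
theorem exists_mult_le [CompactSpace M] (hd : IsDominatedSplitting X φ Es Eu) :
    ∃ K > 0, ∀ t, 0 ≤ t → ∀ p, h.mult 0 t p ≤ K * h.mult 1 t p := by
  obtain ⟨-, -, -, -, -, -, C, N, hC, ⟨hNc, hN0⟩, hN⟩ := hd
  have hc : ∀ i, Continuous (fun p => N p (e i p)) := fun i => Continuous.comp
    (g := fun v : TangentBundle (𝓡 3) M => N v.proj v.snd)
    (f := fun p => (⟨p, e i p⟩ : TangentBundle (𝓡 3) M)) hNc (h.cont i).continuous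
  have hpos : ∀ i : Fin 3, i ≠ 2 → ∀ p, 0 < N p (e i p) := by
    intro i hi p
    refine (apply_nonneg _ _).lt_of_ne' fun h0 => ?_
    obtain ⟨a, ha⟩ := Submodule.mem_span_singleton.1 ((hN0 p _).1 h0)
    have := congrArg (h.dual i p) ha
    rw [← congrFun h.two p, map_smul, h.dual_self, h.dual_self] at this
    simp [hi] at this
  have hpush : ∀ i : Fin 3, i ≠ 2 → ∀ t p,
      N (φ t p) (push φ t p (e i p)) = h.mult i t p * N (φ t p) (e i (φ t p)) := by
    intro i hi t p
    have hX : N (φ t p) (h.shear i t p • e 2 (φ t p)) = 0 := by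
      rw [hN0, h.two]
      exact Submodule.smul_mem _ _ (Submodule.mem_span_singleton_self _)
    rw [h.push_frame hi]
    have := (N (φ t p)).norm_sub_map_le_sub (h.mult i t p • e i (φ t p) +
      h.shear i t p • e 2 (φ t p)) (h.mult i t p • e i (φ t p))
    rw [add_sub_cancel_left, hX, norm_le_zero_iff, sub_eq_zero] at this
    rw [this, map_smul_eq_mul, Real.norm_of_nonneg (h.mult_pos hi t p).le]
  obtain ⟨m₀, hm₀, hm₀'⟩ := exists_pos_le_of_continuous (hc 0) (hpos 0 (by decide))
  obtain ⟨m₁, hm₁, hm₁'⟩ := exists_pos_le_of_continuous (hc 1) (hpos 1 (by decide))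
  obtain ⟨K₀, hK₀, hK₀'⟩ := exists_pos_ge_of_continuous (hc 0)
  obtain ⟨K₁, hK₁, hK₁'⟩ := exists_pos_ge_of_continuous (hc 1)
  refine ⟨K₁ * K₀ / (m₁ * m₀), by positivity, fun t ht p => ?_⟩
  have key := hN t ht p _ (h.mem_s_zero p) _ (h.mem_u_one p)
  rw [hpush 0 (by decide), hpush 1 (by decide)] at key
  have hexp : 1 ≤ Real.exp (C * t) := Real.one_le_exp (by positivity)
  have p0 := h.mult_pos (i := 0) (by decide) t p
  have p1 := h.mult_pos (i := 1) (by decide) t p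
  rw [div_mul_eq_mul_div, le_div_iff₀ (by positivity)]
  calc h.mult 0 t p * (m₁ * m₀) = 1 * m₁ * (h.mult 0 t p * m₀) := by ring
    _ ≤ Real.exp (C * t) * N p (e 1 p) * (h.mult 0 t p * N (φ t p) (e 0 (φ t p))) := by
        gcongr
        · exact hm₁' p
        · exact hm₀' (φ t p)
    _ ≤ _ := key
    _ ≤ h.mult 1 t p * K₁ * K₀ := by
        gcongr
        · exact (le_abs_self _).trans (hK₁' _)
        · exact (le_abs_self _).trans (hK₀' _)
    _ = _ := by ring

/-- The multipliers of an Anosov flow are eventually contracting and expanding. -/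
theorem exists_mult_lt_one_lt_mult [CompactSpace M] (hd : IsDominatedSplitting X φ Es Eu)
    (hA : IsAnosov X φ) :
    ∃ T > 0, ∀ p, h.mult 0 T p < 1 ∧ 1 < h.mult 1 T p := by
  obtain ⟨L, hL, hdom⟩ := h.exists_mult_le hd
  obtain ⟨Ess, Euu, hEss, hEuu, his, hiu, htop, C, N, hC, ⟨hNc, hN0⟩, hN⟩ := hA
  have hns : ∀ p, ∀ u ∈ Ess p, h.normalNorm p u = 0 → u = 0 := fun p u hu h0 =>
    disjoint_lineField hEss hEuu (htop p) hu (h.mem_lineField_of_normalNorm h0)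
  have hnu : ∀ p, ∀ u ∈ Euu p, h.normalNorm p u = 0 → u = 0 := fun p u hu h0 =>
    disjoint_lineField hEuu hEss (by rw [sup_comm (Euu p)]; exact htop p) hu
      (h.mem_lineField_of_normalNorm h0)
  have hn := h.continuous_normalNorm
  obtain ⟨K₁, hK₁, hK₁'⟩ := hEss.exists_seminorm_le hNc hn hns
  obtain ⟨K₂, hK₂, hK₂'⟩ := hEss.exists_seminorm_le hn hNc fun p u _ => (hN0 p u).1
  obtain ⟨K₃, hK₃, hK₃'⟩ := hEuu.exists_seminorm_le hNc hn hnu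
  obtain ⟨K₄, hK₄, hK₄'⟩ := hEuu.exists_seminorm_le hn hNc fun p u _ => (hN0 p u).1
  have hs : ∀ t, 0 ≤ t → ∀ p, ∀ u ∈ Ess p,
      h.mult 0 t p * |h.dual 0 p u| + h.mult 1 t p * |h.dual 1 p u| ≤
        K₁ * K₂ * Real.exp (-C * t) * h.normalNorm p u := by
    intro t ht p u hu
    have hpu : push φ t p u ∈ Ess (φ t p) := by
      rw [← his t p]; exact Submodule.mem_map_of_mem hu
    rw [← h.normalNorm_push]
    calc h.normalNorm (φ t p) (push φ t p u) ≤ K₂ * N (φ t p) (push φ t p u) := hK₂' _ _ hpu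
      _ ≤ K₂ * (Real.exp (-C * t) * (K₁ * h.normalNorm p u)) := by
          gcongr
          refine ((hN t ht p).1 u hu).trans ?_
          gcongr
          exact hK₁' _ _ hu
      _ = _ := by ring
  have hu : ∀ t, 0 ≤ t → ∀ p, ∀ v ∈ Euu p, h.normalNorm p v ≤ K₃ * K₄ * Real.exp (-C * t) *
      (h.mult 0 t p * |h.dual 0 p v| + h.mult 1 t p * |h.dual 1 p v|) := by
    intro t ht p v hv
    have hpv : push φ t p v ∈ Euu (φ t p) := by
      rw [← hiu t p]; exact Submodule.mem_map_of_mem hv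
    rw [← h.normalNorm_push]
    calc h.normalNorm p v ≤ K₄ * N p v := hK₄' _ _ hv
      _ = K₄ * (Real.exp (-C * t) * (Real.exp (C * t) * N p v)) := by
          rw [← mul_assoc (Real.exp _), ← Real.exp_add]; simp
      _ ≤ K₄ * (Real.exp (-C * t) * (K₃ * h.normalNorm (φ t p) (push φ t p v))) := by
          refine mul_le_mul_of_nonneg_left (mul_le_mul_of_nonneg_left ?_ (Real.exp_pos _).le) hK₄.le
          exact ((hN t ht p).2 v hv).trans (hK₃' _ _ hpv)
      _ = _ := by ring
  have hlim : Tendsto (fun t => Real.exp (-C * t)) atTop (𝓝 0) :=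
    Real.tendsto_exp_atBot.comp (tendsto_id.const_mul_atTop_of_neg (neg_lt_zero.2 hC))
  have hvec : ∀ {D : Distribution M}, IsContinuousSubbundle 1 D → ∀ p, ∃ u ∈ D p, u ≠ 0 := by
    intro D hD p
    obtain ⟨U, hU, u, -, hu⟩ := hD.exists_section p
    have := hu p (mem_of_mem_nhds hU)
    exact ⟨u p, by rw [← this.2]; exact Submodule.mem_span_singleton_self _, this.1⟩
  have hmult₀ : ∀ t, 0 ≤ t → ∀ p, h.mult 0 t p ≤ K₁ * K₂ * Real.exp (-C * t) := by
    intro t ht p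
    obtain ⟨u, huE, hu0⟩ := hvec hEss p
    obtain ⟨v, hvE, hv0⟩ := hvec hEuu p
    have hd1 : h.dual 1 p u = 0 := by
      by_contra hne
      have hne' : 0 < |h.dual 1 p u| := abs_pos.2 hne
      set A := K₁ * K₂ * h.normalNorm p u / |h.dual 1 p u| with hA
      have hA0 : 0 ≤ A := by positivity
      have b1 : ∀ t, 0 ≤ t → h.mult 1 t p ≤ A := by
        intro t ht
        have h1 := hs t ht p u huE
        have h2 := mul_nonneg (h.mult_pos (i := 0) (by decide) t p).le (abs_nonneg (h.dual 0 p u))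
        have h3 : Real.exp (-C * t) ≤ 1 := Real.exp_le_one_iff.2 (by nlinarith)
        have h4 : K₁ * K₂ * Real.exp (-C * t) * h.normalNorm p u ≤
            K₁ * K₂ * 1 * h.normalNorm p u := by gcongr
        rw [hA, le_div_iff₀ hne']
        linarith
      have b2 : ∀ t, 0 ≤ t → h.normalNorm p v ≤
          Real.exp (-C * t) * (K₃ * K₄ * (L * A * |h.dual 0 p v| + A * |h.dual 1 p v|)) := by
        intro t ht
        refine (hu t ht p v hvE).trans ?_
        rw [mul_comm (K₃ * K₄), mul_assoc]
        have h0 : h.mult 0 t p ≤ L * A :=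
          (hdom t ht p).trans (mul_le_mul_of_nonneg_left (b1 t ht) hL.le)
        have h1 := b1 t ht
        gcongr
      have b3 := ge_of_tendsto (hlim.mul_const
        (K₃ * K₄ * (L * A * |h.dual 0 p v| + A * |h.dual 1 p v|)))
        ((eventually_ge_atTop 0).mono b2)
      rw [zero_mul] at b3
      exact hv0 (hnu p v hvE (le_antisymm b3 (apply_nonneg _ _)))
    have h1 := hs t ht p u huE
    rw [h.normalNorm_apply, hd1, abs_zero, mul_zero, add_zero, add_zero] at h1
    refine le_of_mul_le_mul_right h1 (abs_pos.2 fun h0 => hu0 (hns p u huE ?_))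
    rw [h.normalNorm_apply, h0, hd1, abs_zero, add_zero]
  have hmult₁ : ∀ t, 0 ≤ t → ∀ p, 1 - K₃ * K₄ * Real.exp (-C * t) * (K₁ * K₂ * Real.exp (-C * t)) ≤
      K₃ * K₄ * Real.exp (-C * t) * h.mult 1 t p := by
    intro t ht p
    obtain ⟨v, hvE, hv0⟩ := hvec hEuu p
    have hpos : 0 < h.normalNorm p v := (apply_nonneg _ _).lt_of_ne' fun h0 => hv0 (hnu p v hvE h0)
    refine le_of_mul_le_mul_right ?_ hpos
    have l0 : |h.dual 0 p v| ≤ h.normalNorm p v := by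
      rw [h.normalNorm_apply]; linarith [abs_nonneg (h.dual 1 p v)]
    have l1 : |h.dual 1 p v| ≤ h.normalNorm p v := by
      rw [h.normalNorm_apply]; linarith [abs_nonneg (h.dual 0 p v)]
    have l2 := hmult₀ t ht p
    have p0 := h.mult_pos (i := 0) (by decide) t p
    have p1 := h.mult_pos (i := 1) (by decide) t p
    have key : K₃ * K₄ * Real.exp (-C * t) *
        (h.mult 0 t p * |h.dual 0 p v| + h.mult 1 t p * |h.dual 1 p v|) ≤
        K₃ * K₄ * Real.exp (-C * t) * (K₁ * K₂ * Real.exp (-C * t) * h.normalNorm p v +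
          h.mult 1 t p * h.normalNorm p v) := by gcongr
    linarith [hu t ht p v hvE]
  have e1 := (hlim.const_mul (K₁ * K₂)).eventually_lt_const (u := 1) (by simp)
  have e2 : ∀ᶠ t in atTop, K₃ * K₄ * Real.exp (-C * t) * (K₁ * K₂ * Real.exp (-C * t)) +
      K₃ * K₄ * Real.exp (-C * t) < 1 :=
    (((hlim.const_mul (K₃ * K₄)).mul (hlim.const_mul (K₁ * K₂))).add
      (hlim.const_mul (K₃ * K₄))).eventually_lt_const (by simp)
  obtain ⟨T, hT, hT1, hT2⟩ := ((eventually_gt_atTop 0).and (e1.and e2)).exists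
  refine ⟨T, hT, fun p => ⟨(hmult₀ T hT.le p).trans_lt hT1, ?_⟩⟩
  have h1 := hmult₁ T hT.le p
  have h2 : K₃ * K₄ * Real.exp (-C * T) * 1 < K₃ * K₄ * Real.exp (-C * T) * h.mult 1 T p := by
    linarith
  exact lt_of_mul_lt_mul_left h2 (by positivity)

end IsSplitFrame

end Hyperbolic

section Construction

variable {M : Type*} [TopologicalSpace M] [ChartedSpace E3 M] [IsManifold (𝓡 3) ∞ M]

theorem IsCnForm.add_smul {β₁ β₂ : OneForm M} (h₁ : IsCnForm 1 β₁) (h₂ : IsCnForm 1 β₂)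
    {g₁ g₂ : M → ℝ} (hg₁ : ContMDiff (𝓡 3) 𝓘(ℝ, ℝ) 1 g₁) (hg₂ : ContMDiff (𝓡 3) 𝓘(ℝ, ℝ) 1 g₂) :
    IsCnForm 1 (fun p => g₁ p • β₁ p + g₂ p • β₂ p) :=
  ContMDiff.add_section (ContMDiff.smul_section hg₁ h₁) (ContMDiff.smul_section hg₂ h₂)

variable {X : VField M} {φ : Flow ℝ M} {Es Eu : Distribution M} {e : Fin 3 → VField M}
  (h : IsSplitFrame X φ Es Eu e) {α β₁ β₂ : OneForm M}

namespace IsSplitFrame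

/-- If `i ≠ 2`, then the form `y eⁱ`, where `eⁱ` is the dual coframe, has a Lie derivative along the
flow, and it is `k eⁱ`. -/
def HasWeightedDeriv (i : Fin 3) (y k : M → ℝ) : Prop :=
  ∀ p, HasDerivAt (fun t => h.mult i t p * y (φ t p)) (k p) 0

theorem hasWeightedDeriv_form (hα : IsCnForm 1 α) (hαX : ∀ p, α p (X p) = 0) {i : Fin 3}
    (hi : i ≠ 2) :
    h.HasWeightedDeriv i (fun p => α p (e i p)) (fun p => dForm α p (X p) (e i p)) := fun p =>
  (h.flow.hasDerivAt_form_push hα hαX p (e i p)).congr_of_eventuallyEq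
    (Eventually.of_forall fun t => (h.form_push hαX hi t p).symm)

variable {h}

theorem HasWeightedDeriv.const_mul {i : Fin 3} {y k : M → ℝ} (hy : h.HasWeightedDeriv i y k)
    (c : ℝ) : h.HasWeightedDeriv i (fun p => c * y p) (fun p => c * k p) := fun p =>
  ((hy p).const_mul c).congr_of_eventuallyEq (Eventually.of_forall fun t => by ring)

theorem HasWeightedDeriv.mul {i : Fin 3} {y k f r : M → ℝ} (hy : h.HasWeightedDeriv i y k)
    (hf : ∀ p, HasDerivAt (fun t => f (φ t p)) (r p) 0) :
    h.HasWeightedDeriv i (fun p => f p * y p) (fun p => r p * y p + f p * k p) := by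
  intro p
  refine (((hf p).mul (hy p)).congr_deriv ?_).congr_of_eventuallyEq
    (Eventually.of_forall fun t => ?_)
  · rw [h.mult_zero, φ.map_zero_apply, one_mul]
  · simp only [Pi.mul_apply]; ring

theorem HasWeightedDeriv.add {i : Fin 3} {y k y' k' : M → ℝ} (hy : h.HasWeightedDeriv i y k)
    (hy' : h.HasWeightedDeriv i y' k') :
    h.HasWeightedDeriv i (fun p => y p + y' p) (fun p => k p + k' p) := fun p =>
  ((hy p).add (hy' p)).congr_of_eventuallyEq (Eventually.of_forall fun t => by
    simp only [Pi.add_apply]; ring)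

theorem HasWeightedDeriv.unique {i : Fin 3} {y k k' : M → ℝ} (hy : h.HasWeightedDeriv i y k)
    (hy' : h.HasWeightedDeriv i y k') (p : M) : k p = k' p :=
  (hy p).unique (hy' p)

/-- Derivative along the flow of a quotient of two determinants. -/
theorem HasWeightedDeriv.div {a b c d a' b' c' d' : Fin 3 → M → ℝ}
    (ha : ∀ i ≠ 2, h.HasWeightedDeriv i (a i) (a' i))
    (hb : ∀ i ≠ 2, h.HasWeightedDeriv i (b i) (b' i))
    (hc : ∀ i ≠ 2, h.HasWeightedDeriv i (c i) (c' i))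
    (hd : ∀ i ≠ 2, h.HasWeightedDeriv i (d i) (d' i))
    (hne : ∀ p, c 0 p * d 1 p - c 1 p * d 0 p ≠ 0) (p : M) :
    HasDerivAt (fun t => (a 0 (φ t p) * b 1 (φ t p) - a 1 (φ t p) * b 0 (φ t p)) /
        (c 0 (φ t p) * d 1 (φ t p) - c 1 (φ t p) * d 0 (φ t p)))
      (((a' 0 p * b 1 p + a 0 p * b' 1 p - (a' 1 p * b 0 p + a 1 p * b' 0 p)) *
          (c 0 p * d 1 p - c 1 p * d 0 p) - (a 0 p * b 1 p - a 1 p * b 0 p) *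
          (c' 0 p * d 1 p + c 0 p * d' 1 p - (c' 1 p * d 0 p + c 1 p * d' 0 p))) /
        (c 0 p * d 1 p - c 1 p * d 0 p) ^ 2) 0 := by
  have h0 : (0 : Fin 3) ≠ 2 := by decide
  have h1 : (1 : Fin 3) ≠ 2 := by decide
  have hnum := ((ha 0 h0 p).mul (hb 1 h1 p)).sub ((ha 1 h1 p).mul (hb 0 h0 p))
  have hden := ((hc 0 h0 p).mul (hd 1 h1 p)).sub ((hc 1 h1 p).mul (hd 0 h0 p))
  have hz : ∀ (i : Fin 3) (y : M → ℝ), h.mult i 0 p * y (φ 0 p) = y p := fun i y => by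
    rw [h.mult_zero, φ.map_zero_apply, one_mul]
  refine ((hnum.div hden ?_).congr_deriv ?_).congr_of_eventuallyEq
    (Eventually.of_forall fun t => ?_)
  · simp only [Pi.sub_apply, Pi.mul_apply, hz]
    exact hne p
  · simp only [Pi.sub_apply, Pi.mul_apply, hz]
  · have m0 := h.mult_ne_zero h0 t p
    have m1 := h.mult_ne_zero h1 t p
    simp only [Pi.sub_apply, Pi.mul_apply, Pi.div_apply]
    rw [← mul_div_mul_left _ _ (mul_ne_zero m0 m1)]
    congr 1 <;> ring

variable (h)

/-- Two transverse `C¹` forms that vanish along the flow generate all forms that vanish along the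
flow and are differentiable along it, up to a small error. -/
theorem exists_form_approx [CompactSpace M] [T2Space M] (hβ₁ : IsCnForm 1 β₁)
    (hβ₂ : IsCnForm 1 β₂) (hX₁ : ∀ p, β₁ p (X p) = 0) (hX₂ : ∀ p, β₂ p (X p) = 0)
    (hne : ∀ p, β₁ p (e 0 p) * β₂ p (e 1 p) - β₁ p (e 1 p) * β₂ p (e 0 p) ≠ 0)
    {y k : Fin 3 → M → ℝ} (hy : ∀ i ≠ 2, Continuous (y i)) (hk : ∀ i ≠ 2, Continuous (k i))
    (hyk : ∀ i ≠ 2, h.HasWeightedDeriv i (y i) (k i)) {η : ℝ} (hη : 0 < η) :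
    ∃ α : OneForm M, IsCnForm 1 α ∧ (∀ p, α p (X p) = 0) ∧ ∀ i ≠ 2, ∀ p,
      |α p (e i p) - y i p| < η ∧ |dForm α p (X p) (e i p) - k i p| < η := by
  have h0 : (0 : Fin 3) ≠ 2 := by decide
  have h1 : (1 : Fin 3) ≠ 2 := by decide
  set b₁ : Fin 3 → M → ℝ := fun i p => β₁ p (e i p) with hb₁
  set b₂ : Fin 3 → M → ℝ := fun i p => β₂ p (e i p) with hb₂
  set d₁ : Fin 3 → M → ℝ := fun i p => dForm β₁ p (X p) (e i p) with hd₁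
  set d₂ : Fin 3 → M → ℝ := fun i p => dForm β₂ p (X p) (e i p) with hd₂
  have cb₁ : ∀ i, Continuous (b₁ i) := h.continuous_form_frame hβ₁.zero
  have cb₂ : ∀ i, Continuous (b₂ i) := h.continuous_form_frame hβ₂.zero
  have cd₁ : ∀ i, Continuous (d₁ i) := h.continuous_dForm_frame hβ₁ hX₁
  have cd₂ : ∀ i, Continuous (d₂ i) := h.continuous_dForm_frame hβ₂ hX₂
  have w₁ : ∀ i ≠ 2, h.HasWeightedDeriv i (b₁ i) (d₁ i) := fun i =>
    h.hasWeightedDeriv_form hβ₁ hX₁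
  have w₂ : ∀ i ≠ 2, h.HasWeightedDeriv i (b₂ i) (d₂ i) := fun i =>
    h.hasWeightedDeriv_form hβ₂ hX₂
  change ∀ p, b₁ 0 p * b₂ 1 p - b₁ 1 p * b₂ 0 p ≠ 0 at hne
  have hf₁ := HasWeightedDeriv.div hyk w₂ w₁ w₂ hne
  have hf₂ := HasWeightedDeriv.div w₁ hyk w₁ w₂ hne
  have cy0 := hy 0 h0
  have cy1 := hy 1 h1
  have ck0 := hk 0 h0
  have ck1 := hk 1 h1
  have hne2 : ∀ p, (b₁ 0 p * b₂ 1 p - b₁ 1 p * b₂ 0 p) ^ 2 ≠ 0 := fun p => pow_ne_zero 2 (hne p)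
  obtain ⟨f₁, hf₁def⟩ : ∃ f₁ : M → ℝ, f₁ = fun p => (y 0 p * b₂ 1 p - y 1 p * b₂ 0 p) /
    (b₁ 0 p * b₂ 1 p - b₁ 1 p * b₂ 0 p) := ⟨_, rfl⟩
  obtain ⟨f₂, hf₂def⟩ : ∃ f₂ : M → ℝ, f₂ = fun p => (b₁ 0 p * y 1 p - b₁ 1 p * y 0 p) /
    (b₁ 0 p * b₂ 1 p - b₁ 1 p * b₂ 0 p) := ⟨_, rfl⟩
  have cf₁ : Continuous f₁ := by
    rw [hf₁def]; exact Continuous.div (by fun_prop) (by fun_prop) hne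
  have cf₂ : Continuous f₂ := by
    rw [hf₂def]; exact Continuous.div (by fun_prop) (by fun_prop) hne
  obtain ⟨r₁, cr₁, hr₁⟩ : ∃ r₁ : M → ℝ, Continuous r₁ ∧
      ∀ p, HasDerivAt (fun t => f₁ (φ t p)) (r₁ p) 0 := by
    rw [hf₁def]; exact ⟨_, Continuous.div (by fun_prop) (by fun_prop) hne2, hf₁⟩
  obtain ⟨r₂, cr₂, hr₂⟩ : ∃ r₂ : M → ℝ, Continuous r₂ ∧
      ∀ p, HasDerivAt (fun t => f₂ (φ t p)) (r₂ p) 0 := by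
    rw [hf₂def]; exact ⟨_, Continuous.div (by fun_prop) (by fun_prop) hne2, hf₂⟩
  have hfy : ∀ i ≠ 2, ∀ p, f₁ p * b₁ i p + f₂ p * b₂ i p = y i p := by
    intro i hi p
    have := hne p
    simp only [hf₁def, hf₂def]
    rw [div_mul_eq_mul_div, div_mul_eq_mul_div, ← add_div, div_eq_iff this]
    fin_cases i
    · simp only [Fin.zero_eta]; ring
    · simp only [Fin.mk_one]; ring
    · exact absurd rfl hi
  have hfk : ∀ i ≠ 2, ∀ p,
      r₁ p * b₁ i p + f₁ p * d₁ i p + (r₂ p * b₂ i p + f₂ p * d₂ i p) = k i p := by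
    intro i hi p
    refine (((w₁ i hi).mul hr₁).add ((w₂ i hi).mul hr₂)).unique ?_ p
    rw [funext (hfy i hi)]
    exact hyk i hi
  obtain ⟨K, hK, hK'⟩ := exists_pos_ge_of_continuous (f := fun p =>
    |b₁ 0 p| + |b₁ 1 p| + |b₂ 0 p| + |b₂ 1 p| + |d₁ 0 p| + |d₁ 1 p| + |d₂ 0 p| + |d₂ 1 p|)
    (by fun_prop)
  have hKi : ∀ i ≠ 2, ∀ p, |b₁ i p| + |b₂ i p| + |d₁ i p| + |d₂ i p| ≤ K := by
    intro i hi p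
    have hp := (le_abs_self _).trans (hK' p)
    have n1 := abs_nonneg (b₁ 0 p)
    have n2 := abs_nonneg (b₁ 1 p)
    have n3 := abs_nonneg (b₂ 0 p)
    have n4 := abs_nonneg (b₂ 1 p)
    have n5 := abs_nonneg (d₁ 0 p)
    have n6 := abs_nonneg (d₁ 1 p)
    have n7 := abs_nonneg (d₂ 0 p)
    have n8 := abs_nonneg (d₂ 1 p)
    fin_cases i
    · simp only [Fin.zero_eta]; linarith
    · simp only [Fin.mk_one]; linarith
    · exact absurd rfl hi
  set ε := η / (K + 1) with hε
  have hε0 : 0 < ε := by positivity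
  have hεη : ε * K < η := by
    rw [hε, div_mul_eq_mul_div, div_lt_iff₀ (by positivity)]
    nlinarith
  obtain ⟨g₁, l₁, hg₁, hl₁, hgf₁, hlr₁⟩ := h.flow.exists_contMDiff_approx cf₁ cr₁ hr₁ hε0
  obtain ⟨g₂, l₂, hg₂, hl₂, hgf₂, hlr₂⟩ := h.flow.exists_contMDiff_approx cf₂ cr₂ hr₂ hε0
  have hα := hβ₁.add_smul hβ₂ hg₁ hg₂
  have hαX : ∀ p, (g₁ p • β₁ p + g₂ p • β₂ p) (X p) = 0 := fun p => by
    simp [hX₁, hX₂]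
  have hαe : ∀ i p, (g₁ p • β₁ p + g₂ p • β₂ p) (e i p) = g₁ p * b₁ i p + g₂ p * b₂ i p :=
    fun i p => rfl
  refine ⟨_, hα, hαX, fun i hi p => ?_⟩
  have hdα : dForm (fun p => g₁ p • β₁ p + g₂ p • β₂ p) p (X p) (e i p) =
      l₁ p * b₁ i p + g₁ p * d₁ i p + (l₂ p * b₂ i p + g₂ p * d₂ i p) :=
    (h.hasWeightedDeriv_form hα hαX hi).unique (((w₁ i hi).mul hl₁).add ((w₂ i hi).mul hl₂)) p
  have hS := hKi i hi p
  have m : ∀ x z : ℝ, |x| < ε → |x * z| ≤ ε * |z| := fun x z hx => by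
    rw [abs_mul]; exact mul_le_mul_of_nonneg_right hx.le (abs_nonneg _)
  have a1 := m _ (b₁ i p) (hgf₁ p)
  have a2 := m _ (b₂ i p) (hgf₂ p)
  have a3 := m _ (d₁ i p) (hgf₁ p)
  have a4 := m _ (d₂ i p) (hgf₂ p)
  have a5 := m _ (b₁ i p) (hlr₁ p)
  have a6 := m _ (b₂ i p) (hlr₂ p)
  have n1 := mul_nonneg hε0.le (abs_nonneg (d₁ i p))
  have n2 := mul_nonneg hε0.le (abs_nonneg (d₂ i p))
  have hS' := mul_le_mul_of_nonneg_left hS hε0.le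
  constructor
  · rw [hαe, ← hfy i hi p, show g₁ p * b₁ i p + g₂ p * b₂ i p - (f₁ p * b₁ i p + f₂ p * b₂ i p) =
      (g₁ p - f₁ p) * b₁ i p + (g₂ p - f₂ p) * b₂ i p by ring]
    refine (abs_add_le _ _).trans_lt ?_
    linarith
  · rw [hdα, ← hfk i hi p, show l₁ p * b₁ i p + g₁ p * d₁ i p + (l₂ p * b₂ i p + g₂ p * d₂ i p) -
      (r₁ p * b₁ i p + f₁ p * d₁ i p + (r₂ p * b₂ i p + f₂ p * d₂ i p)) =
      ((l₁ p - r₁ p) * b₁ i p + (g₁ p - f₁ p) * d₁ i p) +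
      ((l₂ p - r₂ p) * b₂ i p + (g₂ p - f₂ p) * d₂ i p) by ring]
    refine (abs_add_le _ _).trans_lt ?_
    have t1 := abs_add_le ((l₁ p - r₁ p) * b₁ i p) ((g₁ p - f₁ p) * d₁ i p)
    have t2 := abs_add_le ((l₂ p - r₂ p) * b₂ i p) ((g₂ p - f₂ p) * d₂ i p)
    linarith

/-- The average of the multipliers over a time interval. -/
theorem exists_weighted_average [CompactSpace M] {i : Fin 3} (hi : i ≠ 2) {T : ℝ} (hT : 0 < T) :
    ∃ c : M → ℝ, Continuous c ∧ (∀ p, 0 < c p) ∧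
      h.HasWeightedDeriv i c (fun p => h.mult i T p - 1) := by
  have hc : ∀ p, Continuous (fun t => h.mult i t p) := fun p =>
    Continuous.comp (g := fun z : ℝ × M => h.mult i z.1 z.2) (f := fun t : ℝ => (t, p))
      (h.continuous_mult i) (continuous_id.prodMk continuous_const)
  refine ⟨fun p => ∫ t in (0 : ℝ)..T, h.mult i t p, ?_, fun p => ?_, fun p => ?_⟩
  · refine intervalIntegral.continuous_parametric_intervalIntegral_of_continuous' ?_ 0 T
    exact Continuous.comp (g := fun z : ℝ × M => h.mult i z.1 z.2)
      (f := fun z : M × ℝ => (z.2, z.1)) (h.continuous_mult i) continuous_swap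
  · exact intervalIntegral.intervalIntegral_pos_of_pos ((hc p).intervalIntegrable 0 T)
      (fun t => h.mult_pos hi t p) hT
  · have := hasDerivAt_integral_comp_add (hc p) T
    rw [h.mult_zero] at this
    refine this.congr_of_eventuallyEq (Eventually.of_forall fun s => ?_)
    simp only
    rw [← intervalIntegral.integral_const_mul]
    refine intervalIntegral.integral_congr fun t _ => ?_
    exact (h.mult_add hi t s p).symm

end IsSplitFrame

end Construction

section Main

variable {M : Type*} [TopologicalSpace M] [ChartedSpace E3 M] [IsManifold (𝓡 3) ∞ M]
omit [IsManifold (𝓡 3) ∞ M] in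
theorem sup_kerField_eq_top {α₁ α₂ : OneForm M} {p : M} {v₁ v₂ : TangentSpace (𝓡 3) p}
    (hne : α₁ p v₁ * α₂ p v₂ - α₁ p v₂ * α₂ p v₁ ≠ 0) :
    kerField α₁ p ⊔ kerField α₂ p = ⊤ := by
  rw [eq_top_iff]
  intro v _
  set w := α₁ p v₁ • v₂ - α₁ p v₂ • v₁ with hw
  have w1 : α₁ p w = 0 := by
    rw [hw, map_sub, map_smul, map_smul, smul_eq_mul, smul_eq_mul]; ring
  have w2 : α₂ p w ≠ 0 := by
    rwa [hw, map_sub, map_smul, map_smul, smul_eq_mul, smul_eq_mul]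
  refine Submodule.mem_sup.2 ⟨(α₂ p v / α₂ p w) • w, ?_, v - (α₂ p v / α₂ p w) • w, ?_, by abel⟩
  · change α₁ p _ = 0
    rw [map_smul, w1, smul_zero]
  · change α₂ p _ = 0
    rw [map_sub, map_smul, smul_eq_mul, div_mul_cancel₀ _ w2, sub_self]

omit [IsManifold (𝓡 3) ∞ M] in
theorem scale_one (Ω : ThreeForm M) : scale (fun _ => 1) Ω = Ω := by
  funext p v; simp [scale]

omit [IsManifold (𝓡 3) ∞ M] in
theorem scale_neg_one (Ω : ThreeForm M) : scale (fun _ => -1) Ω = -Ω := by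
  funext p v; simp [scale]

variable {X : VField M} {φ : Flow ℝ M} {Es Eu : Distribution M} {e : Fin 3 → VField M}
  (h : IsSplitFrame X φ Es Eu e) {o : ManifoldOrientation M} {ξm ξp : Distribution M}

namespace IsSplitFrame

include h in
theorem exists_transverse_forms (ho : ∀ p, (h.basis p).orientation = o.at_point p)
    (hξ : IsSupportingBiContact o X ξm ξp) :
    ∃ β₁ β₂ : OneForm M, IsCnForm 1 β₁ ∧ IsCnForm 1 β₂ ∧ (∀ p, β₁ p (X p) = 0) ∧
      (∀ p, β₂ p (X p) = 0) ∧
      ∀ p, β₁ p (e 0 p) * β₂ p (e 1 p) - β₁ p (e 1 p) * β₂ p (e 0 p) ≠ 0 := by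
  obtain ⟨⟨β₁, ⟨hβ₁, hc₁⟩, rfl⟩, ⟨β₂, ⟨hβ₂, hc₂⟩, rfl⟩, htr⟩ := hξ
  have hX₁ : ∀ p, β₁ p (X p) = 0 := fun p => (htr p).2.1
  have hX₂ : ∀ p, β₂ p (X p) = 0 := fun p => (htr p).2.2
  refine ⟨β₁, β₂, hβ₁, hβ₂, hX₁, hX₂, fun p h0 => ?_⟩
  have v₁ := hc₁ p _ (ho p)
  have v₂ := hc₂ p _ (ho p)
  rw [h.contactVolume_frame hβ₁ hX₁] at v₁
  rw [h.contactVolume_frame hβ₂ hX₂] at v₂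
  have hle : kerField β₂ p ≤ kerField β₁ p := by
    intro v hv
    have hv : β₂ p v = 0 := hv
    change β₁ p v = 0
    rw [h.form_eq hX₂] at hv
    rw [h.form_eq hX₁]
    by_cases hb : β₂ p (e 0 p) = 0
    · have hb1 : β₂ p (e 1 p) ≠ 0 := fun hb1 => by rw [hb, hb1] at v₂; simp at v₂
      refine (mul_eq_zero.1 ?_).resolve_left hb1
      linear_combination β₁ p (e 1 p) * hv + h.dual 0 p v * h0
    · refine (mul_eq_zero.1 ?_).resolve_left hb
      linear_combination β₁ p (e 0 p) * hv - h.dual 1 p v * h0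
  have htop : kerField β₁ p = ⊤ := by rw [← (htr p).1, eq_comm, sup_eq_left]; exact hle
  have z0 : β₁ p (e 0 p) = 0 := by
    have : e 0 p ∈ kerField β₁ p := by rw [htop]; trivial
    exact this
  have z1 : β₁ p (e 1 p) = 0 := by
    have : e 1 p ∈ kerField β₁ p := by rw [htop]; trivial
    exact this
  rw [z0, z1] at v₁
  simp at v₁

include h in
/-- The forms constructed from an Anosov flow: `σ = 1` gives a negative contact form and `σ = -1`
a positive one. -/
theorem exists_form_of_isAnosov [CompactSpace M] [T2Space M]
    (ho : ∀ p, (h.basis p).orientation = o.at_point p)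
    (hξ : IsSupportingBiContact o X ξm ξp) (hd : IsDominatedSplitting X φ Es Eu)
    (hA : IsAnosov X φ) {σ : ℝ} (hσ : σ * σ = 1) :
    ∃ α : OneForm M, IsCnForm 1 α ∧ (∀ p, α p (X p) = 0) ∧ ∀ p,
      0 < σ * α p (e 0 p) ∧ 0 < α p (e 1 p) ∧ σ * dForm α p (X p) (e 0 p) < 0 ∧
      0 < dForm α p (X p) (e 1 p) := by
  obtain ⟨β₁, β₂, hβ₁, hβ₂, hX₁, hX₂, hne⟩ := h.exists_transverse_forms ho hξ
  obtain ⟨T, hT, hT'⟩ := h.exists_mult_lt_one_lt_mult hd hA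
  obtain ⟨c₀, cc₀, hc₀, hw₀⟩ := h.exists_weighted_average (i := 0) (by decide) hT
  obtain ⟨c₁, cc₁, hc₁, hw₁⟩ := h.exists_weighted_average (i := 1) (by decide) hT
  have cm : ∀ i, Continuous (fun p => h.mult i T p - 1) := fun i =>
    (Continuous.comp (g := fun z : ℝ × M => h.mult i z.1 z.2) (f := fun p : M => (T, p))
      (h.continuous_mult i) (continuous_const.prodMk continuous_id)).sub continuous_const
  obtain ⟨η₀, hη₀, hη₀'⟩ := exists_pos_le_of_continuous cc₀ hc₀
  obtain ⟨η₁, hη₁, hη₁'⟩ := exists_pos_le_of_continuous cc₁ hc₁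
  obtain ⟨η₂, hη₂, hη₂'⟩ := exists_pos_le_of_continuous (cm 0).neg
    fun p => by have := (hT' p).1; simp only [Pi.neg_apply]; linarith
  obtain ⟨η₃, hη₃, hη₃'⟩ := exists_pos_le_of_continuous (cm 1)
    fun p => by have := (hT' p).2; linarith
  set η := min (min η₀ η₁) (min η₂ η₃) with hη
  have l0 : η ≤ η₀ := (min_le_left _ _).trans (min_le_left _ _)
  have l1 : η ≤ η₁ := (min_le_left _ _).trans (min_le_right _ _)
  have l2 : η ≤ η₂ := (min_le_right _ _).trans (min_le_left _ _)
  have l3 : η ≤ η₃ := (min_le_right _ _).trans (min_le_right _ _)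
  have hη0 : 0 < η := lt_min (lt_min hη₀ hη₁) (lt_min hη₂ hη₃)
  obtain ⟨α, hα, hαX, hαe⟩ := h.exists_form_approx hβ₁ hβ₂ hX₁ hX₂ hne
    (y := ![fun p => σ * c₀ p, c₁, 0])
    (k := ![fun p => σ * (h.mult 0 T p - 1), fun p => h.mult 1 T p - 1, 0])
    (fun i hi => by
      fin_cases i
      · exact cc₀.const_mul σ
      · exact cc₁
      · exact absurd rfl hi)
    (fun i hi => by
      fin_cases i
      · exact (cm 0).const_mul σ
      · exact cm 1
      · exact absurd rfl hi)
    (fun i hi => by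
      fin_cases i
      · exact hw₀.const_mul σ
      · exact hw₁
      · exact absurd rfl hi) hη0
  have hσ1 : |σ| = 1 := by
    have := abs_mul σ σ
    rw [hσ, abs_one] at this
    nlinarith [abs_nonneg σ]
  refine ⟨α, hα, hαX, fun p => ?_⟩
  obtain ⟨a0, k0⟩ := hαe 0 (by decide) p
  obtain ⟨a1, k1⟩ := hαe 1 (by decide) p
  simp only [Matrix.cons_val] at a0 a1 k0 k1
  have flip : ∀ x z : ℝ, |x - σ * z| = |σ * x - z| := fun x z => by
    rw [← one_mul |x - σ * z|, ← hσ1, ← abs_mul]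
    congr 1
    linear_combination (-z) * hσ
  rw [flip] at a0 k0
  have b0 := abs_lt.1 a0
  have b1 := abs_lt.1 a1
  have b2 := abs_lt.1 k0
  have b3 := abs_lt.1 k1
  have q0 := hη₀' p
  have q1 := hη₁' p
  have q2 := hη₂' p
  have q3 := hη₃' p
  simp only [Pi.neg_apply] at q2
  exact ⟨by linarith, by linarith, by linarith, by linarith⟩

theorem contactVolume_lt (ho : ∀ p, (h.basis p).orientation = o.at_point p) {α : OneForm M}
    (hα : IsCnForm 1 α) (hαX : ∀ p, α p (X p) = 0) {σ : ℝ}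
    (hs : ∀ p, 0 < σ * α p (e 0 p) ∧ 0 < α p (e 1 p) ∧ σ * dForm α p (X p) (e 0 p) < 0 ∧
      0 < dForm α p (X p) (e 1 p)) :
    ThreeFormLT o (scale (fun _ => σ) (contactVolume α)) 0 := by
  refine threeFormLT_of_frame ((isAlternating_contactVolume α).scale _) isAlternating_zero ho
    fun p => ?_
  obtain ⟨h0, h1, h2, h3⟩ := hs p
  rw [scale, h.contactVolume_frame hα hαX, Pi.zero_apply, Pi.zero_apply]
  nlinarith [mul_pos h0 h3, mul_neg_of_neg_of_pos h2 h1]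

include h in
/-- The volume form of a constructed contact form, and its divergence. -/
theorem exists_volume (ho : ∀ p, (h.basis p).orientation = o.at_point p) {α : OneForm M}
    (hα : IsCnForm 1 α) (hαX : ∀ p, α p (X p) = 0) {σ : ℝ} (hσ : σ * σ = 1)
    (hs : ∀ p, 0 < σ * α p (e 0 p) ∧ 0 < α p (e 1 p) ∧ σ * dForm α p (X p) (e 0 p) < 0 ∧
      0 < dForm α p (X p) (e 1 p)) :
    ∃ (αs αu : OneForm M) (Ω : ThreeForm M) (δ : M → ℝ), IsVolumeOfPair o X Es Eu αs αu Ω ∧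
      (∀ p v, α p v = αu p v + σ * αs p v) ∧ IsDivergence φ Ω δ ∧
      ThreeFormLT o (scale (fun _ => σ) (contactVolume α)) (scale δ Ω) ∧
      ThreeFormLT o (scale δ Ω) (scale (fun _ => -σ) (contactVolume α)) := by
  let αs : OneForm M := fun p => (σ * α p (e 0 p)) • h.dual 0 p
  let αu : OneForm M := fun p => α p (e 1 p) • h.dual 1 p
  have hproj : Continuous (fun v : TangentBundle (𝓡 3) M => v.proj) :=
    continuous_iff_continuousAt.2 continuousAt_proj
  have ca := fun i => h.continuous_form_frame hα.zero i
  have hdual := fun i => isCnForm_zero_iff.1 (h.isCnForm_dual i)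
  have cs : IsCnForm 0 αs := isCnForm_zero_iff.2
    ((((ca 0).const_mul σ).comp hproj).mul (hdual 0))
  have cu : IsCnForm 0 αu := isCnForm_zero_iff.2 (((ca 1).comp hproj).mul (hdual 1))
  have ks : kerField αs = Eu := by
    funext p
    ext v
    rw [h.mem_u]
    change σ * α p (e 0 p) * h.dual 0 p v = 0 ↔ _
    rw [mul_eq_zero, or_iff_right (hs p).1.ne']
  have ku : kerField αu = Es := by
    funext p
    ext v
    rw [h.mem_s]
    change α p (e 1 p) * h.dual 1 p v = 0 ↔ _
    rw [mul_eq_zero, or_iff_right (hs p).2.1.ne']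
  have hdX : ∀ p, h.dual 2 p (X p) = 1 := fun p => by
    rw [← congrFun h.two p, h.dual_self]; simp
  have heq : ∀ p v, α p v = αu p v + σ * αs p v := by
    intro p v
    rw [h.form_eq hαX]
    change _ = α p (e 1 p) * h.dual 1 p v + σ * (σ * α p (e 0 p) * h.dual 0 p v)
    linear_combination (-(α p (e 0 p) * h.dual 0 p v)) * hσ
  have hb : ∀ p, wedge3 αs αu (h.dual 2) p (h.basis p) = σ * α p (e 0 p) * α p (e 1 p) := by
    intro p
    rw [h.wedge3_basis ks ku hdX]
    change σ * α p (e 0 p) * h.dual 0 p (e 0 p) * (α p (e 1 p) * h.dual 1 p (e 1 p)) = _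
    rw [h.dual_self, h.dual_self]
    simp
  have halt := isAlternating_wedge3 αs αu (h.dual 2)
  refine ⟨αs, αu, wedge3 αs αu (h.dual 2), fun p => (dForm α p (X p) (e 0 p) * α p (e 1 p) +
    α p (e 0 p) * dForm α p (X p) (e 1 p)) / (α p (e 0 p) * α p (e 1 p)),
    ⟨cs, cu, ks, ku, ⟨h.dual 2, hdX, rfl⟩, ?_⟩, heq, fun p v => ?_, ?_, ?_⟩
  · refine threeFormLT_of_frame isAlternating_zero halt ho fun p => ?_
    rw [hb]
    exact mul_pos (hs p).1 (hs p).2.1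
  · refine (h.hasDerivAt_wedge3 hα hαX ks ku hdX hσ heq p v).congr_deriv ?_
    rw [halt.eq_mul_det (h.basis p) v, hb]
    have n0 : α p (e 0 p) ≠ 0 := right_ne_zero_of_mul (hs p).1.ne'
    have n1 := (hs p).2.1.ne'
    field_simp
  · refine threeFormLT_of_frame ((isAlternating_contactVolume α).scale _) (halt.scale _) ho
      fun p => ?_
    have n0 : α p (e 0 p) ≠ 0 := right_ne_zero_of_mul (hs p).1.ne'
    have n1 := (hs p).2.1.ne'
    rw [scale, scale, hb, h.contactVolume_frame hα hαX, mul_assoc σ, mul_left_comm,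
      div_mul_cancel₀ _ (mul_ne_zero n0 n1)]
    nlinarith [mul_pos (hs p).1 (hs p).2.2.2]
  · refine threeFormLT_of_frame (halt.scale _) ((isAlternating_contactVolume α).scale _) ho
      fun p => ?_
    have n0 : α p (e 0 p) ≠ 0 := right_ne_zero_of_mul (hs p).1.ne'
    have n1 := (hs p).2.1.ne'
    rw [scale, scale, hb, h.contactVolume_frame hα hαX, mul_assoc σ, mul_left_comm,
      div_mul_cancel₀ _ (mul_ne_zero n0 n1)]
    nlinarith [mul_neg_of_neg_of_pos (hs p).2.2.1 (hs p).2.1]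

end IsSplitFrame

end Main

end BiContact

end

theorem theorem1p3 {M : Type*} [TopologicalSpace M] [ChartedSpace BiContact.E3 M]
    [IsManifold (𝓡 3) ∞ M] [T2Space M] [CompactSpace M] [ConnectedSpace M]
    (o : BiContact.ManifoldOrientation M)
    (X : BiContact.VField M) (hX : BiContact.IsCnVField 1 X) (hX0 : ∀ p, X p ≠ 0)
    (φ : Flow ℝ M) (hφ : BiContact.IsFlowOf X φ)
    (Es Eu : BiContact.Distribution M)
    (hpA : BiContact.IsDominatedSplitting X φ Es Eu)
    (hEs : BiContact.IsOrientableModX X Es) (hEu : BiContact.IsOrientableModX X Eu)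
    (ξm ξp : BiContact.Distribution M)
    (hξ : BiContact.IsSupportingBiContact o X ξm ξp) :
    List.TFAE [
      BiContact.IsAnosov X φ,
      ∃ α : BiContact.OneForm M, BiContact.IsPositiveContactForm o α ∧
        (∃ ξm' : BiContact.Distribution M,
          BiContact.IsSupportingBiContact o X ξm' (BiContact.kerField α)) ∧
        ∃ (Ω : BiContact.ThreeForm M) (δ : M → ℝ),
          BiContact.IsInducedVolumePos o X Es Eu α Ω ∧ BiContact.IsDivergence φ Ω δ ∧
          BiContact.ThreeFormLT o (-BiContact.contactVolume α) (BiContact.scale δ Ω) ∧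
          BiContact.ThreeFormLT o (BiContact.scale δ Ω) (BiContact.contactVolume α),
      ∃ α : BiContact.OneForm M, BiContact.IsNegativeContactForm o α ∧
        (∃ ξp' : BiContact.Distribution M,
          BiContact.IsSupportingBiContact o X (BiContact.kerField α) ξp') ∧
        ∃ (Ω : BiContact.ThreeForm M) (δ : M → ℝ),
          BiContact.IsInducedVolumeNeg o X Es Eu α Ω ∧ BiContact.IsDivergence φ Ω δ ∧
          BiContact.ThreeFormLT o (BiContact.contactVolume α) (BiContact.scale δ Ω) ∧
          BiContact.ThreeFormLT o (BiContact.scale δ Ω) (-BiContact.contactVolume α)] := by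
  obtain ⟨e, h, ho⟩ := hpA.exists_isSplitFrame hX hX0 hφ hEs hEu o
  have hσ : (-1 : ℝ) * -1 = 1 := by norm_num
  have hforward : BiContact.IsAnosov X φ → ∃ αm αp : BiContact.OneForm M,
      BiContact.IsSupportingBiContact o X (BiContact.kerField αm) (BiContact.kerField αp) ∧
      (BiContact.IsNegativeContactForm o αm ∧ ∃ (Ω : BiContact.ThreeForm M) (δ : M → ℝ),
          BiContact.IsInducedVolumeNeg o X Es Eu αm Ω ∧ BiContact.IsDivergence φ Ω δ ∧
          BiContact.ThreeFormLT o (BiContact.contactVolume αm) (BiContact.scale δ Ω) ∧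
          BiContact.ThreeFormLT o (BiContact.scale δ Ω) (-BiContact.contactVolume αm)) ∧
      (BiContact.IsPositiveContactForm o αp ∧ ∃ (Ω : BiContact.ThreeForm M) (δ : M → ℝ),
          BiContact.IsInducedVolumePos o X Es Eu αp Ω ∧ BiContact.IsDivergence φ Ω δ ∧
          BiContact.ThreeFormLT o (-BiContact.contactVolume αp) (BiContact.scale δ Ω) ∧
          BiContact.ThreeFormLT o (BiContact.scale δ Ω) (BiContact.contactVolume αp)) := by
    intro hA
    obtain ⟨αm, hm, hmX, hms⟩ := h.exists_form_of_isAnosov ho hξ hpA hA (one_mul 1)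
    obtain ⟨αp, hp, hpX, hps⟩ := h.exists_form_of_isAnosov ho hξ hpA hA hσ
    have cm := h.contactVolume_lt ho hm hmX hms
    have cp := h.contactVolume_lt ho hp hpX hps
    obtain ⟨αms, αmu, Ωm, δm, v1, v2, v3, v4, v5⟩ := h.exists_volume ho hm hmX (one_mul 1) hms
    obtain ⟨αps, αpu, Ωp, δp, w1, w2, w3, w4, w5⟩ := h.exists_volume ho hp hpX hσ hps
    rw [BiContact.scale_one] at cm v4
    rw [BiContact.scale_neg_one] at cp v5 w4
    rw [neg_neg, BiContact.scale_one] at w5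
    have km : BiContact.IsNegativeContactForm o αm := ⟨hm, cm⟩
    have kp : BiContact.IsPositiveContactForm o αp :=
      ⟨hp, fun p b hb => neg_lt_zero.1 (cp p b hb)⟩
    refine ⟨αm, αp, ⟨⟨αm, km, rfl⟩, ⟨αp, kp, rfl⟩, fun p => ⟨?_, hmX p, hpX p⟩⟩,
      ⟨km, Ωm, δm, ⟨αms, αmu, v1, ?_⟩, v3, v4, v5⟩, ⟨kp, Ωp, δp, ⟨αps, αpu, w1, ?_⟩, w3, w4, w5⟩⟩
    · refine BiContact.sup_kerField_eq_top (v₁ := e 0 p) (v₂ := e 1 p) (ne_of_gt ?_)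
      obtain ⟨m0, m1, -, -⟩ := hms p
      obtain ⟨p0, p1, -, -⟩ := hps p
      nlinarith [mul_pos m0 p1, mul_pos m1 p0]
    · funext p; ext v; rw [v2, one_mul]; rfl
    · funext p; ext v; rw [w2, neg_one_mul, ← sub_eq_add_neg]; rfl
  tfae_have 1 → 2 := fun hA => by
    obtain ⟨αm, αp, hb, -, hp, hv⟩ := hforward hA
    exact ⟨αp, hp, ⟨_, hb⟩, hv⟩
  tfae_have 1 → 3 := fun hA => by
    obtain ⟨αm, αp, hb, ⟨hm, hv⟩, -⟩ := hforward hA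
    exact ⟨αm, hm, ⟨_, hb⟩, hv⟩
  tfae_have 2 → 1 := by
    rintro ⟨α, ⟨hα, -⟩, ⟨ξm', -, -, hb⟩, Ω, δ, ⟨αs, αu, hV, heq⟩, hδ, h1, h2⟩
    refine h.isAnosov_of_divergence ho hα (fun p => (hb p).2.2) hV hδ hσ (fun p v => ?_) ?_ ?_
    · rw [heq, neg_one_mul, ← sub_eq_add_neg]; rfl
    · rwa [BiContact.scale_neg_one]
    · rwa [neg_neg, BiContact.scale_one]
  tfae_have 3 → 1 := by
    rintro ⟨α, ⟨hα, -⟩, ⟨ξp', -, -, hb⟩, Ω, δ, ⟨αs, αu, hV, heq⟩, hδ, h1, h2⟩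
    refine h.isAnosov_of_divergence ho hα (fun p => (hb p).2.1) hV hδ (one_mul 1)
      (fun p v => ?_) ?_ ?_
    · rw [heq, one_mul]; rfl
    · rwa [BiContact.scale_one]
    · rwa [BiContact.scale_neg_one]
  tfae_finish
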